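/- Let $V$ be a complex manifold of dimension $p+1$ and let $D\subset V$ be a free divisor, that is, a reduced hypersurface such that for every point $y\in V$ the $\mathcal O_{V,y}$-module $\mathrm{Der}(\log D)_y$ of germs of holomorphic vector fields tangent to $D$ (those which map the ideal $I(D)_y$ of germs vanishing on $D$ into itself) is free; so $\dim D=p$. For $x \in D$ let $h$ be a reduced equation of $D$ at $x$, i.e. a generator of $I(D)_x$, and put $$\Omega^k_{D,x}=\frac{\Omega^k_{V,x}}{h\,\Omega^k_{V,x}+dh\wedge\Omega^{k-1}_{V,x}},\qquad \check\Omega^k_{D,x}=\frac{\Omega^k_{V,x}}{h\,\Omega^k(\log D)_x},$$ where $\Omega^k(\log D)_x$ is the module of germs at $x$ of meromorphic $k$-forms $\omega$ such that $h\omega$ and $h\,d\omega$ are regular. If $D$ is singular at $x$, then for every $k$ with $1\le k\le p$ the $\mathcal O_{V,x}$-module of Kähler forms satisfies $$\operatorname{depth}\Omega^k_{D,x}=p-1=\dim D-1 .$$ In particular $\Omega^k_{D,x}$ is not Cohen–Macaulay, whereas $\check\Omega^k_{D,x}$ is Cohen–Macaulay. -/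

import Mathlib

open Filter Topology
open scoped Manifold ContDiff

noncomputable section

/-! ### Depth and the Cohen–Macaulay property over a local ring -/

section Depth

variable (R : Type*) [CommRing R] [IsLocalRing R] (M : Type*) [AddCommGroup M] [Module R M]

/-- The depth of a (finitely generated, nonzero) module over a local ring: the supremum of the
lengths of the `M`-regular sequences in the maximal ideal. -/
def moduleDepth : ℕ∞ :=
  ⨆ (rs : List R) (_ : RingTheory.Sequence.IsRegular M rs)
    (_ : ∀ r ∈ rs, r ∈ IsLocalRing.maximalIdeal R), (rs.length : ℕ∞)

/-- A module over a local ring is Cohen–Macaulay if it is zero or its depth equals the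
Krull dimension of its support. -/
def IsCohenMacaulayModule : Prop :=
  Subsingleton M ∨ (moduleDepth R M : WithBot ℕ∞) = Module.supportDim R M

end Depth

/-! ### Vector fields and differential forms on a local `ℂ`-algebra `R`

The vector fields are the `ℂ`-derivations of `R`, and the `k`-forms are the alternating
`R`-multilinear maps in `k` vector fields. -/

section Forms

variable (R : Type*) [CommRing R] [Algebra ℂ R]

/-- Vector fields. -/
abbrev VField : Type _ := Derivation ℂ R R

/-- Regular `k`-forms. -/
abbrev Forms (k : ℕ) : Type _ := VField R [⋀^Fin k]→ₗ[R] R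

/-- Meromorphic `k`-forms. -/
abbrev MeroForms (k : ℕ) : Type _ := VField R [⋀^Fin k]→ₗ[R] FractionRing R

variable {R}

/-- The differential of a function, as a linear function of vector fields: `(df)(X) = X f`. -/
def dFun (f : R) : VField R →ₗ[R] R where
  toFun X := X f
  map_add' _ _ := rfl
  map_smul' _ _ := rfl

/-- The wedge product `df ∧ α`:
`(df ∧ α)(X₀, …, X_k) = ∑ i, (-1) ^ i * (X_i f) * α(X₀, …, X̂_i, …, X_k)`. -/
def dWedge {k : ℕ} (f : R) (α : Forms R k) : Forms R (k + 1) :=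
  AlternatingMap.alternatizeUncurryFin ((dFun f).smulRight α)

/-- The relations which hold among `k`-forms on the subspace with ideal `I`: the submodule
`I Ω^k + dI ∧ Ω^(k-1)`. If `I` is generated by `f₁, …, f_n`, this is
`(f₁, …, f_n) Ω^k + ∑ df_i ∧ Ω^(k-1)`. -/
def kahlerRelations (I : Ideal R) : (k : ℕ) → Submodule R (Forms R k)
  | 0 => I • ⊤
  | k + 1 => I • ⊤ ⊔ Submodule.span R {η | ∃ f ∈ I, ∃ α : Forms R k, η = dWedge f α}

/-- Kähler `k`-forms on the subspace with ideal `I`. -/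
abbrev KahlerForms (I : Ideal R) (k : ℕ) : Type _ := Forms R k ⧸ kahlerRelations I k

/-- The submodule of vector fields which are tangent to the subspace with ideal `I`. -/
def derLog (I : Ideal R) : Submodule R (VField R) where
  carrier := {X | ∀ f ∈ I, X f ∈ I}
  add_mem' hX hY f hf := I.add_mem (hX f hf) (hY f hf)
  zero_mem' _ _ := I.zero_mem
  smul_mem' c _ hX f hf := I.mul_mem_left c (hX f hf)

open KaehlerDifferential in
/-- The unique extension of a vector field to a derivation of the total ring of fractions
(given by the quotient rule). -/
def VField.ext (X : VField R) : Derivation ℂ (FractionRing R) (FractionRing R) :=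
  letI φ : Ω[R⁄ℂ] →ₗ[R] FractionRing R :=
    (Algebra.linearMap R (FractionRing R)).comp X.liftKaehlerDifferential
  letI ψ : Ω[FractionRing R⁄ℂ] →ₗ[R] FractionRing R :=
    IsLocalizedModule.lift (nonZeroDivisors R) (map ℂ ℂ R (FractionRing R)) φ fun s =>
      (IsLocalizedModule.map_units (Algebra.linearMap R (FractionRing R)) s)
  (ψ.extendScalarsOfIsLocalization (nonZeroDivisors R) (FractionRing R)).compDer
    (D ℂ (FractionRing R))

theorem VField.ext_algebraMap (X : VField R) (f : R) :
    X.ext (algebraMap R (FractionRing R) f) = algebraMap R (FractionRing R) (X f) := by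
  have h := IsLocalizedModule.lift_apply (nonZeroDivisors R)
    (KaehlerDifferential.map ℂ ℂ R (FractionRing R))
    ((Algebra.linearMap R (FractionRing R)).comp X.liftKaehlerDifferential)
    (fun s => (IsLocalizedModule.map_units (Algebra.linearMap R (FractionRing R)) s))
    (KaehlerDifferential.D ℂ R f)
  simpa [VField.ext] using h

/-- The exterior derivative of a meromorphic form, evaluated on vector fields:
`dα(X₀, …, X_k) = ∑ i, (-1) ^ i X_i (α(X₀, …, X̂_i, …, X_k))
  + ∑ i < j, (-1) ^ (i + j) α([X_i, X_j], X₀, …, X̂_i, …, X̂_j, …, X_k)`.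
In the second sum of the code the pair `(i, j)` stands for the pair `(i, j + 1)` of this formula,
which changes the sign. -/
def extD : {k : ℕ} → MeroForms R k → (Fin (k + 1) → VField R) → FractionRing R
  | 0, α, X => (X 0).ext (α ![])
  | k + 1, α, X =>
    (∑ i : Fin (k + 2), (-1) ^ (i : ℕ) * (X i).ext (α (i.removeNth X))) -
      ∑ i : Fin (k + 1), ∑ j ≥ i, (-1) ^ (i + j : ℕ) *
        α (Matrix.vecCons ⁅X i.castSucc, X j.succ⁆ (j.removeNth (i.castSucc.removeNth X)))

theorem VField.ext_smul (X : VField R) (c : R) (a : FractionRing R) :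
    X.ext (c • a) = c • X.ext a + X c • a := by
  rw [Algebra.smul_def, Derivation.leibniz, VField.ext_algebraMap]
  simp [Algebra.smul_def, mul_comm]

theorem extD_zero {k : ℕ} (X : Fin (k + 1) → VField R) : extD (0 : MeroForms R k) X = 0 := by
  cases k <;> simp [extD]

theorem extD_add {k : ℕ} (α α' : MeroForms R k) (X : Fin (k + 1) → VField R) :
    extD (α + α') X = extD α X + extD α' X := by
  cases k with
  | zero => simp [extD]
  | succ k =>
    simp only [extD, AlternatingMap.add_apply, map_add, mul_add, Finset.sum_add_distrib]
    ring

theorem extD_smul {k : ℕ} (c : R) (α : MeroForms R k) (X : Fin (k + 1) → VField R) :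
    extD (c • α) X = c • extD α X +
      ∑ i : Fin (k + 1), (-1) ^ (i : ℕ) * (X i c • α (i.removeNth X)) := by
  cases k with
  | zero =>
    simp only [extD, AlternatingMap.smul_apply, VField.ext_smul]
    simp [Subsingleton.elim (Fin.removeNth 0 X) ![]]
  | succ k =>
    simp only [extD, AlternatingMap.smul_apply, VField.ext_smul, mul_add, Finset.sum_add_distrib,
      smul_sub, Finset.smul_sum, mul_smul_comm]
    ring

/-- A meromorphic function is regular. -/
def IsRegularFun (a : FractionRing R) : Prop := a ∈ (algebraMap R (FractionRing R)).range

/-- The module `h Ω^k(log D)`, where `D` has the equation `h`: the regular forms `η = h α`, where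
`α` is a logarithmic form, that is, a meromorphic form such that `h α` and `h dα` are regular. A
form is regular if and only if its values on vector fields are regular. -/
def hLogForms (h : R) (k : ℕ) : Submodule R (Forms R k) where
  carrier := {η | ∃ α : MeroForms R k,
    (∀ X, algebraMap R (FractionRing R) h * α X = algebraMap R (FractionRing R) (η X)) ∧
    ∀ X, IsRegularFun (algebraMap R (FractionRing R) h * extD α X)}
  add_mem' := by
    rintro η η' ⟨α, h1, h2⟩ ⟨α', h1', h2'⟩
    refine ⟨α + α', fun X => ?_, fun X => ?_⟩
    · simp [mul_add, h1, h1']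
    · rw [extD_add, mul_add]
      exact add_mem (h2 X) (h2' X)
  zero_mem' := ⟨0, fun X => by simp, fun X => by
    rw [extD_zero, mul_zero]
    exact zero_mem _⟩
  smul_mem' := by
    rintro c η ⟨α, h1, h2⟩
    refine ⟨c • α, fun X => ?_, fun X => ?_⟩
    · rw [AlternatingMap.smul_apply, mul_smul_comm, h1, AlternatingMap.smul_apply, smul_eq_mul,
        map_mul, Algebra.smul_def]
    · rw [extD_smul, mul_add, Finset.mul_sum]
      refine add_mem ?_ (sum_mem fun i _ => ?_)
      · rw [mul_smul_comm, Algebra.smul_def]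
        exact mul_mem ⟨c, rfl⟩ (h2 X)
      · rw [mul_left_comm, mul_smul_comm, h1, Algebra.smul_def]
        exact mul_mem (pow_mem (neg_mem (one_mem _)) _) (mul_mem ⟨_, rfl⟩ ⟨_, rfl⟩)

/-- The quotient `Ω^k / h Ω^k(log D)`, where `D` has the equation `h`. -/
abbrev CheckForms (h : R) (k : ℕ) : Type _ := Forms R k ⧸ hLogForms h k

end Forms

/-! ### Germs of holomorphic functions on a complex manifold -/

section Germs

/-- `ℂⁿ`, the model space of complex manifolds of dimension `n`. -/
abbrev CSpace (n : ℕ) : Type := EuclideanSpace ℂ (Fin n)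

variable {n : ℕ} {V : Type*} [TopologicalSpace V] [ChartedSpace (CSpace n) V]

/-- The function `g` is holomorphic in a neighbourhood of `x`. -/
abbrev HolAt (n : ℕ) {V : Type*} [TopologicalSpace V] [ChartedSpace (CSpace n) V]
    (g : V → ℂ) (x : V) : Prop :=
  ContMDiffAt 𝓘(ℂ, CSpace n) 𝓘(ℂ) ω g x

/-- Germs at `x` of holomorphic functions, as a subring of all germs of functions. -/
def holGermSubring (n : ℕ) {V : Type*} [TopologicalSpace V] [ChartedSpace (CSpace n) V]
    (x : V) : Subring (Germ (𝓝 x) ℂ) where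
  carrier := {f | ∃ g : V → ℂ, HolAt n g x ∧ (g : Germ (𝓝 x) ℂ) = f}
  mul_mem' := by
    rintro _ _ ⟨g, hg, rfl⟩ ⟨g', hg', rfl⟩
    exact ⟨g * g', hg.mul hg', rfl⟩
  one_mem' := ⟨1, contMDiffAt_const, rfl⟩
  add_mem' := by
    rintro _ _ ⟨g, hg, rfl⟩ ⟨g', hg', rfl⟩
    exact ⟨g + g', hg.add hg', rfl⟩
  zero_mem' := ⟨0, contMDiffAt_const, rfl⟩
  neg_mem' := by
    rintro _ ⟨g, hg, rfl⟩
    exact ⟨-g, hg.neg, rfl⟩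

/-- The local ring `𝒪_{V,x}` of germs at `x` of holomorphic functions. -/
abbrev HolGerm (n : ℕ) {V : Type*} [TopologicalSpace V] [ChartedSpace (CSpace n) V]
    (x : V) : Type _ := holGermSubring n x

/-- The germ at `x` of a function which is holomorphic near `x`. -/
def HolAt.germ {g : V → ℂ} {x : V} (hg : HolAt n g x) : HolGerm n x :=
  ⟨(g : Germ (𝓝 x) ℂ), g, hg, rfl⟩

instance HolGerm.instAlgebra (x : V) : Algebra ℂ (HolGerm n x) :=
  RingHom.toAlgebra
    { toFun c := HolAt.germ (n := n) (x := x) (g := fun _ => c) contMDiffAt_const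
      map_one' := rfl
      map_mul' _ _ := rfl
      map_zero' := rfl
      map_add' _ _ := rfl }

/-- The value at `x` of a germ. -/
def HolGerm.eval (x : V) : HolGerm n x →+* ℂ :=
  (Germ.valueRingHom : Germ (𝓝 x) ℂ →+* ℂ).comp (holGermSubring n x).subtype

instance HolGerm.instIsLocalRing (x : V) : IsLocalRing (HolGerm n x) := by
  have : IsLocalHom (HolGerm.eval (n := n) x) := by
    constructor
    rintro ⟨_, g, hg, rfl⟩ hu
    have h0 : g x ≠ 0 := hu.ne_zero
    refine IsUnit.of_mul_eq_one (HolAt.germ (hg.inv₀ h0)) ?_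
    apply Subtype.ext
    refine Germ.coe_eq.2 ?_
    filter_upwards [hg.continuousAt.eventually_ne h0] with y hy
    exact mul_inv_cancel₀ hy
  exact RingHom.domain_isLocalRing (HolGerm.eval (n := n) x)

end Germs

/-! ### Hypersurfaces in complex manifolds -/

section Divisors

variable {n : ℕ} {V : Type*} [TopologicalSpace V] [ChartedSpace (CSpace n) V]

/-- The ideal in `𝒪_{V,x}` of the germs which vanish on `D`. -/
def idealAt (n : ℕ) {V : Type*} [TopologicalSpace V] [ChartedSpace (CSpace n) V]
    (D : Set V) (x : V) : Ideal (HolGerm n x) where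
  carrier := {f | ∃ (g : V → ℂ) (hg : HolAt n g x), hg.germ = f ∧ ∀ᶠ y in 𝓝 x, y ∈ D → g y = 0}
  add_mem' := by
    rintro _ _ ⟨g, hg, rfl, h⟩ ⟨g', hg', rfl, h'⟩
    refine ⟨g + g', hg.add hg', rfl, ?_⟩
    filter_upwards [h, h'] with y hy hy' hD
    simp [hy hD, hy' hD]
  zero_mem' := ⟨0, contMDiffAt_const, rfl, by simp⟩
  smul_mem' := by
    rintro ⟨_, c, hc, rfl⟩ _ ⟨g, hg, rfl, h⟩
    refine ⟨c * g, hc.mul hg, rfl, ?_⟩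
    filter_upwards [h] with y hy hD
    simp [hy hD]

/-- The germ `h ≠ 0` is a reduced equation of `D` at `x`: near `x` the set `D` is the zero set of
`h`, and every germ which vanishes on `D` is a multiple of `h`. -/
structure IsReducedEquation (D : Set V) (x : V) (h : HolGerm n x) : Prop where
  ne_zero : h ≠ 0
  zeroSet : ∃ (g : V → ℂ) (hg : HolAt n g x), hg.germ = h ∧ ∀ᶠ y in 𝓝 x, y ∈ D ↔ g y = 0
  ideal_eq : idealAt n D x = Ideal.span {h}

/-- A (reduced) divisor, that is, a hypersurface: a subset which has a reduced equation at every
point of the manifold (at points outside `D` this is a unit). -/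
def IsDivisor (n : ℕ) {V : Type*} [TopologicalSpace V] [ChartedSpace (CSpace n) V]
    (D : Set V) : Prop :=
  ∀ x : V, ∃ h : HolGerm n x, IsReducedEquation D x h

/-- A free divisor: the germs of vector fields tangent to `D` form a free module at every point. -/
def IsFreeDivisor (n : ℕ) {V : Type*} [TopologicalSpace V] [ChartedSpace (CSpace n) V]
    (D : Set V) : Prop :=
  IsDivisor n D ∧ ∀ x : V, Module.Free (HolGerm n x) (derLog (idealAt n D x))

/-- The divisor `D` is singular at its point `x`: all first derivatives at `x` of all functions
which vanish on `D` (equivalently, of a reduced equation of `D`) are zero. -/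
def IsSingularAt (n : ℕ) {V : Type*} [TopologicalSpace V] [ChartedSpace (CSpace n) V]
    (D : Set V) (x : V) : Prop :=
  x ∈ D ∧ ∀ f ∈ idealAt n D x, ∀ X : VField (HolGerm n x), HolGerm.eval x (X f) = 0

end Divisors

end

/-! Put n = p + 1 and R = 𝒪_{V,x}. R is the ring of convergent power series in n variables, a
regular local ring of dimension n; the algebra uses only that it is a Noetherian local domain with
coordinates generating the maximal ideal and with dual partial derivatives (`RegularCoords`).

Saito's criterion (`exists_logFrame`): a basis δ of the free module Der(log D) has n members and
determinant a unit times h. Since h η' is logarithmic exactly when dh ∧ η is divisible by h (where η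
= h η'; `hLogForms_eq`), the module h Ω^j(log D) is free. Its basis consists of the forms `detForm`,
which are det with the vectors δ_i, i ∉ s, inserted in the slots outside s.

Hence Ω̌^k = Ω^k / h Ω^k(log D) has a free resolution of length one, so its depth is at least n - 1.
It is killed by h, so its dimension is at most n - 1, and it is Cohen–Macaulay.

For the Kähler forms consider Ω^k ⊕ Ω^(k-1) → Ω^k, (α, β) ↦ h α + dh ∧ β. Its cokernel is Ω^k_D. Its
kernel is h Ω^(k-1)(log D), since β must satisfy h ∣ dh ∧ β and then determines α. This is a free
resolution of length two. By the long exact sequences of Ext(k, -), k the residue field, the depth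
is n - 2 as soon as some basis vector of the last module is mapped into 𝔪 times the middle one, for
then Ext^n(k, -) of the last map is not injective (`moduleDepth_of_resolution_two`).

Singularity enters exactly here. If all derivatives of h vanish at x, Cramer's rule shows that the n
× n matrix of δ, enlarged by the row of the quotients δ_i h / h, has rank less than n at x. So the
frame can be changed until one member vanishes at x together with its quotient (`exists_adapted`). A
basis form whose index set s avoids that member is mapped into 𝔪 times the middle module.

Finally Ω^k_D surjects onto Ω̌^k, so its support has dimension at least n - 1, more than its depth n
- 2. -/

set_option linter.unusedSectionVars false

/-! ### Ext modules of the residue field and depth -/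

section ExtResidue

universe u

open CategoryTheory Abelian IsLocalRing

variable {R : Type u} [CommRing R] [IsLocalRing R]
variable {M N P : Type u} [AddCommGroup M] [Module R M] [AddCommGroup N] [Module R N]
  [AddCommGroup P] [Module R P]

variable (R M) in
/-- `Ext^i(k, M)` for the residue field `k` of the local ring `R`. -/
abbrev ResExt (i : ℕ) : Type u :=
  Ext (ModuleCat.of R (R ⧸ maximalIdeal R)) (ModuleCat.of R M) i

/-- The map on `Ext^i(k, -)` induced by a linear map. -/
noncomputable def resExtMap (f : M →ₗ[R] N) (i : ℕ) : ResExt R M i →+ ResExt R N i :=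
  (Ext.mk₀ (ModuleCat.ofHom f)).postcomp _ (add_zero i)

theorem resExtMap_id (i : ℕ) (x : ResExt R M i) : resExtMap LinearMap.id i x = x :=
  Ext.comp_mk₀_id x

theorem resExtMap_comp (g : N →ₗ[R] P) (f : M →ₗ[R] N) (i : ℕ) (x : ResExt R M i) :
    resExtMap (g ∘ₗ f) i x = resExtMap g i (resExtMap f i x) := by
  simp [resExtMap, ModuleCat.ofHom_comp, ← Ext.mk₀_comp_mk₀]

theorem resExtMap_add (f g : M →ₗ[R] N) (i : ℕ) (x : ResExt R M i) :
    resExtMap (f + g) i x = resExtMap f i x + resExtMap g i x := by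
  simp [resExtMap, ModuleCat.ofHom_add, Ext.mk₀_add]

theorem resExtMap_zero (i : ℕ) (x : ResExt R M i) :
    resExtMap (0 : M →ₗ[R] N) i x = 0 := by
  have : ModuleCat.ofHom (0 : M →ₗ[R] N) = 0 := rfl
  simp [resExtMap, this]

theorem resExtMap_sum {ι : Type*} (s : Finset ι) (f : ι → M →ₗ[R] N) (i : ℕ) (x : ResExt R M i) :
    resExtMap (∑ j ∈ s, f j) i x = ∑ j ∈ s, resExtMap (f j) i x := by
  classical
  induction s using Finset.induction_on with
  | empty => simp [resExtMap_zero]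
  | insert a s ha ih => rw [Finset.sum_insert ha, Finset.sum_insert ha, resExtMap_add, ih]

/-- Such an `r` kills the residue field, hence every Ext out of it. -/
theorem resExtMap_smul_id {r : R} (hr : r ∈ maximalIdeal R) (i : ℕ) (x : ResExt R M i) :
    resExtMap (r • LinearMap.id : M →ₗ[R] M) i x = 0 := by
  have h : r ∈ Module.annihilator R (R ⧸ maximalIdeal R) := by
    rwa [Ideal.annihilator_quotient]
  have := Ext.postcomp_smul_id_eq_zero_of_mem_annihilator (M := ModuleCat.of R M)
    (N := ModuleCat.of R (R ⧸ maximalIdeal R)) h i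
  exact DFunLike.congr_fun (congrArg AddCommGrpCat.Hom.hom this) x

/-- The identity of a finite free module is a sum of maps factoring through `R`. -/
theorem subsingleton_resExt_of_free [Module.Free R M] [Module.Finite R M] {i : ℕ}
    (h : Subsingleton (ResExt R R i)) : Subsingleton (ResExt R M i) := by
  have b := Module.finBasis R M
  have hid : (LinearMap.id : M →ₗ[R] M) =
      ∑ j, (LinearMap.toSpanSingleton R M (b j)) ∘ₗ b.coord j := by
    ext x
    simp [b.sum_repr x]
  refine subsingleton_of_forall_eq 0 fun x => ?_
  rw [← resExtMap_id i x, hid, resExtMap_sum]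
  refine Finset.sum_eq_zero fun j _ => ?_
  rw [resExtMap_comp, Subsingleton.elim (resExtMap _ i x) 0, map_zero]

theorem shortExact_of_linear {f : M →ₗ[R] N} {g : N →ₗ[R] P} (hf : Function.Injective f)
    (hfg : Function.Exact f g) (hg : Function.Surjective g) :
    (ShortComplex.mk (ModuleCat.ofHom f) (ModuleCat.ofHom g)
      (by rw [← ModuleCat.ofHom_comp, hfg.linearMap_comp_eq_zero]; rfl)).ShortExact where
  exact := (ShortComplex.ShortExact.moduleCat_exact_iff_function_exact _).mpr hfg
  mono_f := (ModuleCat.mono_iff_injective _).mpr hf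
  epi_g := (ModuleCat.epi_iff_surjective _).mpr hg

theorem subsingleton_resExt_of_exact {f : M →ₗ[R] N} {g : N →ₗ[R] P}
    (hf : Function.Injective f) (hfg : Function.Exact f g) (hg : Function.Surjective g) {i : ℕ}
    (hN : Subsingleton (ResExt R N i)) (hM : Subsingleton (ResExt R M (i + 1))) :
    Subsingleton (ResExt R P i) := by
  refine subsingleton_of_forall_eq 0 fun x => ?_
  obtain ⟨y, rfl⟩ := Ext.covariant_sequence_exact₃ _ (shortExact_of_linear hf hfg hg) x rfl
    (Subsingleton.elim (α := ResExt R M (i + 1)) _ _)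
  rw [Subsingleton.elim (α := ResExt R N i) y 0, Ext.zero_comp]

theorem exists_resExt_ne_zero_of_exact {f : M →ₗ[R] N} {g : N →ₗ[R] P}
    (hf : Function.Injective f) (hfg : Function.Exact f g) (hg : Function.Surjective g) {i : ℕ}
    {x : ResExt R M (i + 1)} (hx : x ≠ 0) (hfx : resExtMap f (i + 1) x = 0) :
    ∃ y : ResExt R P i, y ≠ 0 := by
  obtain ⟨y, hy⟩ := Ext.covariant_sequence_exact₁ _ (shortExact_of_linear hf hfg hg) x hfx rfl
  refine ⟨y, ?_⟩
  rintro rfl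
  exact hx (by rw [← hy, Ext.zero_comp])

theorem resExtMap_eq_zero_of_forall_mem {ι : Type*} [Fintype ι] (f : M →ₗ[R] N)
    (r : ι → R) (hr : ∀ j, r j ∈ maximalIdeal R) (g : ι → M →ₗ[R] N) (hf : f = ∑ j, r j • g j)
    (i : ℕ) (x : ResExt R M i) : resExtMap f i x = 0 := by
  rw [hf, resExtMap_sum]
  refine Finset.sum_eq_zero fun j _ => ?_
  have : r j • g j = (g j) ∘ₗ (r j • LinearMap.id) := by ext; simp
  rw [this, resExtMap_comp, resExtMap_smul_id (hr j), map_zero]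

end ExtResidue

/-! ### Depth as the first nonvanishing Ext of the residue field -/

section DepthCriteria

universe u

open CategoryTheory Abelian IsLocalRing RingTheory.Sequence

variable {R : Type u} [CommRing R] [IsLocalRing R] [IsNoetherianRing R]
variable (M : Type u) [AddCommGroup M] [Module R M] [Module.Finite R M]

theorem support_residue :
    Module.support R (ModuleCat.of R (R ⧸ maximalIdeal R)) =
      PrimeSpectrum.zeroLocus (maximalIdeal R) := by
  rw [Module.support_eq_zeroLocus, Ideal.annihilator_quotient]

theorem maximalIdeal_smul_top_lt [Nontrivial M] :
    maximalIdeal R • (⊤ : Submodule R M) < ⊤ := by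
  refine lt_top_iff_ne_top.mpr fun h => ?_
  exact Submodule.top_ne_ideal_smul_of_le_jacobson_annihilator
    ((IsLocalRing.maximalIdeal_le_jacobson _)) h.symm

theorem exists_isRegular_of_subsingleton_resExt [Nontrivial M] (d : ℕ)
    (h : ∀ i < d, Subsingleton (ResExt R M i)) :
    ∃ rs : List R, rs.length = d ∧ (∀ r ∈ rs, r ∈ maximalIdeal R) ∧ IsRegular M rs :=
  ModuleCat.exists_isRegular_of_exists_subsingleton_ext (maximalIdeal R) d (ModuleCat.of R M)
    (maximalIdeal_smul_top_lt M) (ModuleCat.of R (R ⧸ maximalIdeal R)) support_residue h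

theorem subsingleton_resExt_of_isRegular [Nontrivial M] {rs : List R}
    (hrs : ∀ r ∈ rs, r ∈ maximalIdeal R) (h : IsRegular M rs) {i : ℕ} (hi : i < rs.length) :
    Subsingleton (ResExt R M i) :=
  ModuleCat.subsingleton_ext_of_exists_isRegular (maximalIdeal R)
    (ModuleCat.of R (R ⧸ maximalIdeal R)) support_residue.subset (ModuleCat.of R M)
    (maximalIdeal_smul_top_lt M) rs hrs h i hi

theorem le_moduleDepth_of_subsingleton_resExt [Nontrivial M] {d : ℕ}
    (h : ∀ i < d, Subsingleton (ResExt R M i)) : (d : ℕ∞) ≤ moduleDepth R M := by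
  obtain ⟨rs, hl, hm, hr⟩ := exists_isRegular_of_subsingleton_resExt M d h
  rw [← hl]
  exact le_iSup₂_of_le rs hr (le_iSup_of_le hm le_rfl)

/-- Rees: vanishing below `d` produces a regular sequence of length `d`, and a longer one would
force the vanishing in degree `d`. -/
theorem moduleDepth_eq_of_resExt [Nontrivial M] {d : ℕ}
    (h : ∀ i < d, Subsingleton (ResExt R M i)) (hd : ∃ x : ResExt R M d, x ≠ 0) :
    moduleDepth R M = d := by
  refine le_antisymm (iSup₂_le fun rs hr => iSup_le fun hm => ?_)
    (le_moduleDepth_of_subsingleton_resExt M h)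
  by_contra hlt
  obtain ⟨x, hx⟩ := hd
  have := subsingleton_resExt_of_isRegular M hm hr (i := d) (by simpa using hlt)
  exact hx (Subsingleton.elim _ _)

/-- Each member of a regular sequence lowers the dimension of the support by one, and the dimension
left at the end is nonnegative because the quotient is nonzero. -/
theorem moduleDepth_le_supportDim [Nontrivial M] :
    (moduleDepth R M : WithBot ℕ∞) ≤ Module.supportDim R M := by
  have key : ∀ rs : List R, IsRegular M rs → (rs.length : WithBot ℕ∞) ≤ Module.supportDim R M := by
    intro rs hr
    rw [← Module.supportDim_add_length_eq_supportDim_of_isRegular rs hr]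
    have := hr.quot_ofList_smul_nontrivial (⊤ : Submodule R M)
    have h0 : (0 : WithBot ℕ∞) ≤ Module.supportDim R (M ⧸ Ideal.ofList rs • (⊤ : Submodule R M)) :=
      Order.krullDim_nonneg_iff.mpr (Module.nonempty_support_of_nontrivial.to_subtype)
    exact le_add_of_nonneg_left h0
  obtain ⟨d, hd⟩ := WithBot.ne_bot_iff_exists.mp (Module.supportDim_ne_bot_of_nontrivial R M)
  rw [← hd]
  refine WithBot.coe_le_coe.mpr (iSup₂_le fun rs hr => iSup_le fun _ => ?_)
  have := key rs hr
  rw [← hd] at this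
  exact WithBot.coe_le_coe.mp this

end DepthCriteria

/-! ### Depth from free resolutions of length one and two -/

section Resolutions

universe u

open CategoryTheory Abelian IsLocalRing RingTheory.Sequence

variable {R : Type u} [CommRing R] [IsLocalRing R] [IsNoetherianRing R]

/-- If the maximal ideal of `R` is generated by the regular sequence `rs`, then
`Ext^i(k, R)` vanishes exactly for `i < rs.length` (in the range `i ≤ rs.length`). -/
theorem exists_resExt_self_ne_zero {rs : List R} (h : IsRegular R rs)
    (hm : Ideal.ofList rs = maximalIdeal R) : ∃ x : ResExt R R rs.length, x ≠ 0 := by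
  -- Otherwise Ext vanishes in all degrees up to `rs.length`, which yields a regular sequence longer
  -- than the dimension of `R`.
  by_contra! H
  have hrs : ∀ r ∈ rs, r ∈ maximalIdeal R := fun r hr => hm ▸ Ideal.subset_span hr
  obtain ⟨ss, hl, hs, hss⟩ := exists_isRegular_of_subsingleton_resExt R
    (rs.length + 1) fun i hi => by
    rcases (Nat.lt_succ_iff_lt_or_eq.mp hi) with h' | rfl
    · exact subsingleton_resExt_of_isRegular R hrs h h'
    · exact subsingleton_of_forall_eq 0 H
  have h1 := ringKrullDim_add_length_eq_ringKrullDim_of_isRegular rs h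
  have h2 := le_trans (le_iSup₂_of_le ss hss (le_iSup_of_le hs le_rfl) :
    (ss.length : ℕ∞) ≤ moduleDepth R R) le_rfl
  have h3 := moduleDepth_le_supportDim (R := R) R
  rw [Module.supportDim_self_eq_ringKrullDim, ← h1, hm] at h3
  have h4 : ringKrullDim (R ⧸ maximalIdeal R) = 0 :=
    ringKrullDim_eq_zero_of_isField (Ideal.Quotient.field _ |>.toIsField)
  rw [h4, zero_add] at h3
  have h5 := h2.trans (WithBot.coe_le_coe.mp h3)
  rw [hl] at h5
  norm_cast at h5
  omega

variable {F₀ F₁ F₂ M : Type u} [AddCommGroup F₀] [Module R F₀] [AddCommGroup F₁] [Module R F₁]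
  [AddCommGroup F₂] [Module R F₂] [AddCommGroup M] [Module R M]
  [Module.Free R F₀] [Module.Finite R F₀] [Module.Free R F₁] [Module.Finite R F₁]
  [Module.Free R F₂] [Module.Finite R F₂]

/-- In the long exact sequence Ext^i(k, M) lies between Ext^i(k, F₀) and Ext^(i+1)(k, F₁); the
second term costs one degree. -/
theorem le_moduleDepth_of_resolution_one [Nontrivial M] {rs : List R} (hr : IsRegular R rs)
    (hm : ∀ r ∈ rs, r ∈ maximalIdeal R)
    {f : F₁ →ₗ[R] F₀} {g : F₀ →ₗ[R] M} (hf : Function.Injective f) (hfg : Function.Exact f g)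
    (hg : Function.Surjective g) : ((rs.length - 1 : ℕ) : ℕ∞) ≤ moduleDepth R M := by
  have := Module.Finite.of_surjective g hg
  refine le_moduleDepth_of_subsingleton_resExt M fun i hi => ?_
  exact subsingleton_resExt_of_exact hf hfg hg
    (subsingleton_resExt_of_free (subsingleton_resExt_of_isRegular R hm hr (by omega)))
    (subsingleton_resExt_of_free (subsingleton_resExt_of_isRegular R hm hr (by omega)))

/-- A module with a free resolution of length two, whose last map is not split, has depth
`depth R - 2`. -/
theorem moduleDepth_of_resolution_two [Nontrivial M] {rs : List R} (hr : IsRegular R rs)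
    (hm : Ideal.ofList rs = maximalIdeal R) (hlen : 2 ≤ rs.length)
    {f : F₂ →ₗ[R] F₁} {g : F₁ →ₗ[R] F₀} {π : F₀ →ₗ[R] M} (hf : Function.Injective f)
    (hfg : Function.Exact f g) (hgπ : Function.Exact g π) (hπ : Function.Surjective π)
    (v : F₂) (φ : F₂ →ₗ[R] R) (hφ : φ v = 1)
    (hv : f v ∈ maximalIdeal R • (⊤ : Submodule R F₁)) :
    moduleDepth R M = ((rs.length - 2 : ℕ) : ℕ∞) := by
  have hmem : ∀ r ∈ rs, r ∈ maximalIdeal R := fun r hr => hm ▸ Ideal.subset_span hr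
  have := Module.Finite.of_surjective π hπ
  have h0 : ∀ i < rs.length, Subsingleton (ResExt R R i) := fun i hi =>
    subsingleton_resExt_of_isRegular R hmem hr hi
  have e1 : Function.Exact f g.rangeRestrict := fun x => by
    rw [← hfg x]
    exact ⟨fun h => congrArg Subtype.val h, fun h => Subtype.ext h⟩
  have e2 : Function.Exact g.range.subtype π := fun x => by
    rw [hgπ x]
    simp
  refine moduleDepth_eq_of_resExt M (fun i hi => ?_) ?_
  · refine subsingleton_resExt_of_exact g.range.injective_subtype e2 hπ
      (subsingleton_resExt_of_free (h0 _ (by omega))) ?_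
    exact subsingleton_resExt_of_exact hf e1 g.surjective_rangeRestrict
      (subsingleton_resExt_of_free (h0 _ (by omega)))
      (subsingleton_resExt_of_free (h0 _ (by omega)))
  · obtain ⟨l, hl⟩ : ∃ l, rs.length = l + 2 := ⟨rs.length - 2, by omega⟩
    have hne := exists_resExt_self_ne_zero hr hm
    rw [hl] at hne h0
    rw [hl]
    obtain ⟨x, hx⟩ := hne
    -- Since `φ v = 1`, the line spanned by `v` is a direct summand, so a nonzero class of `R` stays
    -- nonzero in `F₂`.
    have hx2 : resExtMap (LinearMap.toSpanSingleton R F₂ v) (l + 2) x ≠ 0 := by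
      intro h
      apply hx
      have := congrArg (resExtMap φ (l + 2)) h
      rw [← resExtMap_comp, map_zero] at this
      rwa [show φ ∘ₗ LinearMap.toSpanSingleton R F₂ v = LinearMap.id by ext; simp [hφ],
        resExtMap_id] at this
    -- The map 1 ↦ `f v` has all its coordinates in the maximal ideal, hence is zero on Ext.
    have hx1 : resExtMap f (l + 2) (resExtMap (LinearMap.toSpanSingleton R F₂ v) (l + 2) x) =
        0 := by
      rw [← resExtMap_comp]
      have b := Module.finBasis R F₁
      refine resExtMap_eq_zero_of_forall_mem _ (fun j => b.repr (f v) j) (fun j => ?_)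
        (fun j => LinearMap.toSpanSingleton R F₁ (b j)) ?_ _ _
      · refine Submodule.smul_induction_on hv (fun r hr n _ => ?_) fun a c ha hc => ?_
        · simpa using Ideal.mul_mem_right _ _ hr
        · simpa using add_mem ha hc
      · ext
        simp [b.sum_repr]
    -- Two dimension shifts along the connecting maps: from `F₂` to the image of `g`, and from there
    -- to `M`, where no obstruction arises because Ext^(l+1)(k, F₀) vanishes.
    obtain ⟨y, hy⟩ := exists_resExt_ne_zero_of_exact hf e1 g.surjective_rangeRestrict
      (i := l + 1) hx2 hx1
    refine exists_resExt_ne_zero_of_exact g.range.injective_subtype e2 hπ (i := l) hy ?_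
    have := subsingleton_resExt_of_free (M := F₀) (h0 (l + 1) (by omega))
    exact Subsingleton.elim _ _

end Resolutions

/-! ### Regular local `ℂ`-algebras with coordinates and partial derivatives -/

section RegularCoords

open IsLocalRing RingTheory.Sequence

/-- Coordinates and partial derivatives on a local `ℂ`-algebra with residue field `ℂ`. -/
structure RegularCoords (n : ℕ) (R : Type*) [CommRing R] [Algebra ℂ R] [IsLocalRing R] where
  /-- The coordinates. -/
  x : Fin n → R
  /-- The partial derivatives. -/
  pd : Fin n → Derivation ℂ R R
  pd_x : ∀ i j, pd i (x j) = if i = j then 1 else 0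
  span_x : Ideal.span (Set.range x) = maximalIdeal R
  residue : ∀ f : R, ∃ c : ℂ, f - algebraMap ℂ R c ∈ maximalIdeal R

variable {n : ℕ} {R : Type*} [CommRing R] [Algebra ℂ R] [IsLocalRing R] [IsNoetherianRing R]

theorem eq_zero_of_forall_mem_maximalIdeal_pow {f : R} (h : ∀ k : ℕ, f ∈ maximalIdeal R ^ k) :
    f = 0 := by
  have := Ideal.iInf_pow_eq_bot_of_isLocalRing (maximalIdeal R) Ideal.IsPrime.ne_top'
  rw [← Ideal.mem_bot, ← this]
  exact Ideal.mem_iInf.mpr h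

theorem mem_of_forall_mem_sup_maximalIdeal_pow {I : Ideal R} {f : R}
    (h : ∀ k : ℕ, f ∈ I ⊔ maximalIdeal R ^ k) : f ∈ I := by
  have := Ideal.iInf_pow_smul_eq_bot_of_isLocalRing (M := R ⧸ I) (maximalIdeal R)
    Ideal.IsPrime.ne_top'
  rw [← Ideal.Quotient.eq_zero_iff_mem, ← Submodule.mem_bot R, ← this]
  refine (Submodule.mem_iInf _).mpr fun k => ?_
  obtain ⟨a, ha, b, hb, rfl⟩ := Submodule.mem_sup.mp (h k)
  rw [map_add, Ideal.Quotient.eq_zero_iff_mem.mpr ha, zero_add]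
  have : Ideal.Quotient.mk I b = b • (1 : R ⧸ I) := by
    rw [Algebra.smul_def, mul_one]; rfl
  rw [this]
  exact Submodule.smul_mem_smul hb trivial

theorem natCast_smul_mem_iff {I : Ideal R} {k : ℕ} (hk : k ≠ 0) {f : R} :
    (k : R) * f ∈ I ↔ f ∈ I := by
  have : IsUnit (k : R) := by
    rw [← map_natCast (algebraMap ℂ R)]
    exact (isUnit_iff_ne_zero.mpr (Nat.cast_ne_zero.mpr hk)).map _
  exact Ideal.unit_mul_mem_iff_mem I this

/-- If the derivation `d` preserves the ideal `I` and `d t = 1` for an element `t` of the maximal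
ideal, then `t` is a nonzerodivisor modulo `I`. -/
theorem mem_of_mul_mem_of_derivation {I : Ideal R} (d : Derivation ℂ R R)
    (hd : ∀ f ∈ I, d f ∈ I) {t : R} (ht : t ∈ maximalIdeal R) (hdt : d t = 1) {f : R}
    (hf : t * f ∈ I) : f ∈ I := by
  -- This is d^(k+1) applied to `t * f`.
  have h1 : ∀ k : ℕ, t * d^[k + 1] f + ((k + 1 : ℕ) : R) * d^[k] f ∈ I := by
    intro k
    induction k with
    | zero =>
      have := hd _ hf
      simpa [hdt] using this
    | succ k ih =>
      have := hd _ ih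
      rw [map_add, Derivation.leibniz, Derivation.leibniz, hdt, Derivation.map_natCast] at this
      rw [Function.iterate_succ_apply' d (k + 1), Function.iterate_succ_apply' d k] at *
      convert this using 1
      simp only [smul_eq_mul]
      push_cast
      ring
  -- Solving the previous relation for d^k f, as `k + 1` is invertible. It puts `f` in `I` + 𝔪^k for
  -- all `k`, and Krull's intersection theorem applies.
  have h2 : ∀ k : ℕ, ∃ c : R, f - c * t ^ k * d^[k] f ∈ I := by
    intro k
    induction k with
    | zero => exact ⟨1, by simp⟩
    | succ k ih =>
      obtain ⟨c, hc⟩ := ih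
      have hu : IsUnit ((k + 1 : ℕ) : R) := by
        rw [← map_natCast (algebraMap ℂ R)]
        exact (isUnit_iff_ne_zero.mpr (Nat.cast_ne_zero.mpr k.succ_ne_zero)).map _
      obtain ⟨u, hu⟩ := hu
      refine ⟨-c * ↑u⁻¹, ?_⟩
      have h3 := I.mul_mem_left (c * t ^ k * ↑u⁻¹) (h1 k)
      convert add_mem hc h3 using 1
      rw [← hu]
      have : (↑u⁻¹ : R) * u = 1 := u.inv_mul
      linear_combination (-c * t ^ k * d^[k] f) * this
  refine mem_of_forall_mem_sup_maximalIdeal_pow fun k => ?_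
  obtain ⟨c, hc⟩ := h2 k
  rw [← sub_add_cancel f (c * t ^ k * d^[k] f)]
  refine add_mem (Ideal.mem_sup_left hc) (Ideal.mem_sup_right ?_)
  exact Ideal.mul_mem_right _ _ (Ideal.mul_mem_left _ _ (Ideal.pow_mem_pow ht k))

theorem derivation_sum_apply {ι : Type*} (s : Finset ι) (X : ι → Derivation ℂ R R) (f : R) :
    (∑ i ∈ s, X i) f = ∑ i ∈ s, X i f := by
  classical
  induction s using Finset.induction_on with
  | empty => simp
  | insert a s ha ih => rw [Finset.sum_insert ha, Finset.sum_insert ha, Derivation.add_apply, ih]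

namespace RegularCoords

variable (S : RegularCoords n R)

theorem x_mem (i : Fin n) : S.x i ∈ maximalIdeal R := by
  rw [← S.span_x]
  exact Ideal.subset_span ⟨i, rfl⟩

theorem exists_sum {f : R} (hf : f ∈ maximalIdeal R) : ∃ g : Fin n → R, ∑ i, g i * S.x i = f := by
  rw [← S.span_x] at hf
  exact Ideal.mem_span_range_iff_exists_fun.mp hf

/-- Writing f = c + ∑ g_i x_i gives X f = ∑ x_i X(g_i). By iteration all values lie in every power
of the maximal ideal, so Krull's intersection theorem replaces any continuity argument. -/
theorem derivation_eq_zero {X : Derivation ℂ R R} (h : ∀ i, X (S.x i) = 0) : X = 0 := by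
  have key : ∀ (k : ℕ) (f : R), X f ∈ maximalIdeal R ^ k := by
    intro k
    induction k with
    | zero => simp
    | succ k ih =>
      intro f
      obtain ⟨c, hc⟩ := S.residue f
      obtain ⟨g, hg⟩ := S.exists_sum hc
      have : X f = ∑ i, S.x i * X (g i) := by
        rw [← sub_add_cancel f (algebraMap ℂ R c), ← hg]
        simp [h]
      rw [this, pow_succ']
      exact sum_mem fun i _ => Ideal.mul_mem_mul (S.x_mem i) (ih _)
  ext f
  exact eq_zero_of_forall_mem_maximalIdeal_pow fun k => key k f

/-- The partial derivatives are a basis of the module of vector fields. -/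
noncomputable def basis : Module.Basis (Fin n) R (VField R) :=
  Module.Basis.ofEquivFun
    { toFun X i := X (S.x i)
      map_add' _ _ := rfl
      map_smul' _ _ := rfl
      invFun c := ∑ i, c i • S.pd i
      left_inv X := by
        refine sub_eq_zero.mp (S.derivation_eq_zero fun j => ?_)
        simp [derivation_sum_apply, S.pd_x]
      right_inv c := by
        ext j
        simp [derivation_sum_apply, S.pd_x] }

theorem basis_apply (i : Fin n) : S.basis i = S.pd i := by
  rw [basis, Module.Basis.coe_ofEquivFun]
  simp [Pi.single_apply]

theorem sum_pd (X : VField R) : ∑ i, X (S.x i) • S.pd i = X := by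
  conv_rhs => rw [← S.basis.sum_repr X]
  simp only [basis_apply]
  rfl

/-- The Euler vector field. -/
noncomputable def euler : Derivation ℂ R R := ∑ i, S.x i • S.pd i

theorem euler_apply (f : R) : S.euler f = ∑ i, S.x i * S.pd i f := by
  rw [euler, derivation_sum_apply]
  rfl

theorem euler_sub_mem {k : ℕ} {f : R} (hf : f ∈ maximalIdeal R ^ k) :
    S.euler f - k * f ∈ maximalIdeal R ^ (k + 1) := by
  have h0 : ∀ g, S.euler g ∈ maximalIdeal R := fun g => by
    rw [euler_apply]
    exact sum_mem fun i _ => Ideal.mul_mem_right _ _ (S.x_mem i)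
  have h1 : ∀ b ∈ maximalIdeal R, S.euler b - b ∈ maximalIdeal R ^ 2 := by
    intro b hb
    obtain ⟨g, rfl⟩ := S.exists_sum hb
    rw [map_sum, ← Finset.sum_sub_distrib]
    refine sum_mem fun i _ => ?_
    have : S.euler (S.x i) = S.x i := by rw [euler_apply]; simp [S.pd_x]
    rw [Derivation.leibniz, this, smul_eq_mul, smul_eq_mul, add_sub_cancel_left, pow_two]
    exact Ideal.mul_mem_mul (S.x_mem i) (h0 _)
  induction k generalizing f with
  | zero => simpa using h0 f
  | succ k ih =>
    rw [pow_succ] at hf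
    refine Submodule.mul_induction_on hf (fun a ha b hb => ?_) fun a b ha hb => ?_
    · have e : S.euler (a * b) - ((k + 1 : ℕ) : R) * (a * b) =
          a * (S.euler b - b) + (S.euler a - k * a) * b := by
        rw [Derivation.leibniz]
        simp only [smul_eq_mul]
        push_cast
        ring
      rw [e]
      refine add_mem ?_ ?_
      · rw [add_assoc k 1 1, pow_add]
        exact Ideal.mul_mem_mul ha (h1 b hb)
      · rw [pow_succ _ (k + 1)]
        exact Ideal.mul_mem_mul (ih ha) hb
    · convert add_mem ha hb using 1
      rw [map_add]
      ring

/-- A proper ideal which is preserved by all partial derivatives is zero. -/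
theorem eq_bot_of_pd_mem {J : Ideal R} (hJ : ∀ i, ∀ f ∈ J, S.pd i f ∈ J) (h : J ≠ ⊤) : J = ⊥ := by
  have key : ∀ k : ℕ, J ≤ maximalIdeal R ^ (k + 1) := by
    intro k
    induction k with
    | zero => simpa using le_maximalIdeal h
    | succ k ih =>
      intro f hf
      -- The Euler field multiplies the initial part of `f`, of degree k + 1, by k + 1. But it also
      -- sends `f` to ∑ x_i ∂_i f, which has order k + 2 since the derivatives stay in `J`; so the
      -- initial part is zero.
      have h1 := S.euler_sub_mem (ih hf)
      have h2 : S.euler f ∈ maximalIdeal R ^ (k + 1 + 1) := by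
        rw [euler_apply, pow_succ']
        exact sum_mem fun i _ => Ideal.mul_mem_mul (S.x_mem i) (ih (hJ i f hf))
      have h3 := sub_mem h2 h1
      rw [sub_sub_cancel] at h3
      exact (natCast_smul_mem_iff k.succ_ne_zero).mp h3
  refine (Submodule.eq_bot_iff J).mpr fun f hf => eq_zero_of_forall_mem_maximalIdeal_pow fun k => ?_
  exact Ideal.pow_le_pow_right k.le_succ (key k hf)

/-- If `I ≠ 0` is a radical ideal and `f · X(g) ∈ I` for all `g ∈ I` and all vector fields `X`,
then `f ∈ I`. -/
theorem mem_of_mul_derivation_mem (S : RegularCoords n R) {I : Ideal R} (hI : I.IsRadical)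
    (h0 : I ≠ ⊥) {f : R}
    (hf : ∀ g ∈ I, ∀ X : VField R, f * X g ∈ I) : f ∈ I := by
  -- The colon ideal (I : f) is stable under vector fields: expanding f · X(g f) shows (X g · f)² ∈
  -- `I`, and `I` is radical. As it contains the nonzero ideal `I`, it cannot be proper.
  have hstab : ∀ X : VField R, ∀ g, g * f ∈ I → X g * f ∈ I := by
    intro X g hg
    refine hI ⟨2, ?_⟩
    have h1 := hf _ hg X
    rw [Derivation.leibniz, smul_eq_mul, smul_eq_mul] at h1
    have h2 := I.mul_mem_left (X f) hg
    have h3 := I.mul_mem_left (X g) (sub_mem h1 h2)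
    convert h3 using 1
    ring
  let J : Ideal R :=
    { carrier := {g | g * f ∈ I}
      add_mem' := fun ha hb => by
        rw [Set.mem_ofPred_eq, add_mul]
        exact add_mem ha hb
      zero_mem' := by simp
      smul_mem' := fun c g hg => by
        rw [Set.mem_ofPred_eq, smul_eq_mul, mul_assoc]
        exact I.mul_mem_left c hg }
  have hJ : J = ⊤ := by
    by_contra hne
    apply h0
    rw [← le_bot_iff, ← S.eq_bot_of_pd_mem (J := J) (fun i g hg => hstab (S.pd i) g hg) hne]
    exact fun g hg => I.mul_mem_right f hg
  have : (1 : R) ∈ J := hJ ▸ trivial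
  simpa [J] using this

/-- ∂_i preserves the ideal of the earlier coordinates and sends x_i to 1, so
`mem_of_mul_mem_of_derivation` makes x_i a nonzerodivisor modulo them. -/
theorem isRegular_ofFn : IsRegular R (List.ofFn S.x) := by
  rw [IsLocalRing.isRegular_iff_isWeaklyRegular_of_subset_maximalIdeal (by
    intro r hr
    obtain ⟨i, rfl⟩ := List.mem_ofFn.mp hr
    exact S.x_mem i), isWeaklyRegular_iff]
  intro i hi
  have hin : i < n := by simpa using hi
  rw [isSMulRegular_quotient_iff_mem_of_smul_mem]
  intro f hf
  rw [smul_eq_mul, Ideal.mul_top, smul_eq_mul, List.getElem_ofFn] at *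
  refine mem_of_mul_mem_of_derivation (S.pd ⟨i, hin⟩) (fun g hg => ?_) (S.x_mem ⟨i, hin⟩)
    (by simp [S.pd_x]) hf
  refine Submodule.span_induction (fun r hr => ?_) (by simp) (fun a b _ _ ha hb => ?_)
    (fun c a ha' ha => ?_) hg
  · obtain ⟨j, hj, rfl⟩ := List.mem_take_iff_getElem.mp hr
    rw [List.getElem_ofFn, S.pd_x,
      if_neg (by intro h; have := congrArg Fin.val h; simp at this hj; omega)]
    exact zero_mem _
  · rw [map_add]
    exact add_mem ha hb
  · rw [smul_eq_mul, Derivation.leibniz, smul_eq_mul, smul_eq_mul]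
    exact add_mem (Ideal.mul_mem_left _ _ ha) (Ideal.mul_mem_right _ _ ha')

theorem ofList_ofFn : Ideal.ofList (List.ofFn S.x) = maximalIdeal R := by
  rw [← S.span_x, Ideal.ofList]
  congr 1
  ext r
  simp [List.mem_ofFn]

theorem ringKrullDim_eq (S : RegularCoords n R) : ringKrullDim R = n := by
  rw [← ringKrullDim_add_length_eq_ringKrullDim_of_isRegular _ S.isRegular_ofFn, S.ofList_ofFn,
    ringKrullDim_eq_zero_of_isField (Ideal.Quotient.field _ |>.toIsField), List.length_ofFn,
    zero_add]

end RegularCoords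

end RegularCoords

/-! ### Alternating forms given by partial evaluation of the determinant -/

section DetForm

variable {R : Type*} [CommRing R] {V : Type*} [AddCommGroup V] [Module R V] {n : ℕ}
  (b : Module.Basis (Fin n) R V)

theorem extend_update {ι κ α : Type*} [DecidableEq ι] [DecidableEq κ] {s : ι → κ}
    (hs : Function.Injective s) (X : ι → α) (δ : κ → α) (t : ι) (v : α) :
    Function.extend s (Function.update X t v) δ =
      Function.update (Function.extend s X δ) (s t) v := by
  ext i
  by_cases hi : ∃ u, s u = i
  · obtain ⟨u, rfl⟩ := hi
    by_cases h : u = t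
    · subst h
      simp [hs.extend_apply]
    · simp [hs.extend_apply, h, hs.ne h]
  · rw [Function.extend_apply' _ _ _ hi, Function.update_of_ne, Function.extend_apply' _ _ _ hi]
    rintro rfl
    exact hi ⟨t, rfl⟩

theorem alternatingMap_sum_apply {ι : Type*} {j : ℕ} (s : Finset ι) (f : ι → V [⋀^Fin j]→ₗ[R] R)
    (X : Fin j → V) : (∑ i ∈ s, f i) X = ∑ i ∈ s, f i X := by
  classical
  induction s using Finset.induction_on with
  | empty => simp
  | insert a s ha ih =>
    rw [Finset.sum_insert ha, Finset.sum_insert ha, AlternatingMap.add_apply, ih]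

/-- The alternating form which sends `X` to the determinant of the family which is obtained from
`δ` by replacing the members with indices `s t` by `X t`. -/
noncomputable def detForm {j : ℕ} (δ : Fin n → V) (s : Fin j ↪o Fin n) : V [⋀^Fin j]→ₗ[R] R where
  toFun X := b.det (Function.extend s X δ)
  map_update_add' X t v w := by
    simp only [extend_update s.injective, AlternatingMap.map_update_add]
  map_update_smul' X t c v := by
    simp only [extend_update s.injective, AlternatingMap.map_update_smul]
  map_eq_zero_of_eq' X t t' h hne := by
    refine AlternatingMap.map_eq_zero_of_eq _ _ (i := s t) (j := s t') ?_ (s.injective.ne hne)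
    rw [s.injective.extend_apply, s.injective.extend_apply, h]

variable {j : ℕ} (δ : Fin n → V) (s s' : Fin j ↪o Fin n)

theorem detForm_apply (X : Fin j → V) : detForm b δ s X = b.det (Function.extend s X δ) := rfl

theorem detForm_self : detForm b δ s (δ ∘ s) = b.det δ := by
  rw [detForm_apply]
  congr 1
  ext i
  by_cases hi : ∃ t, s t = i
  · obtain ⟨t, rfl⟩ := hi
    rw [s.injective.extend_apply, Function.comp_apply]
  · rw [Function.extend_apply' _ _ _ hi]

theorem detForm_of_ne_range {f : Fin j → Fin n} {t : Fin j} (h : f t ∉ Set.range s) :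
    detForm b δ s (δ ∘ f) = 0 := by
  rw [detForm_apply]
  refine AlternatingMap.map_eq_zero_of_eq _ _ (i := s t) (j := f t) ?_ fun e => h ⟨t, e⟩
  rw [s.injective.extend_apply, Function.extend_apply' _ _ _ h, Function.comp_apply]

-- If s ≠ s' have the same size, s' takes some value i outside s, and δ_i then occurs twice in the
-- determinant. Together with `detForm_self` this makes the forms dual, up to det δ, to the
-- subfamilies of δ.
variable {s s'} in
theorem detForm_ne (h : s ≠ s') : detForm b δ s (δ ∘ s') = 0 := by
  by_cases hs : ∃ t, s' t ∉ Set.range s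
  · exact detForm_of_ne_range b δ s hs.choose_spec
  · push Not at hs
    refine absurd ?_ h
    have hsub : Set.range s' ⊆ Set.range s := by
      rintro _ ⟨t, rfl⟩
      exact hs t
    have heq : Set.range s' = Set.range s := by
      refine Set.eq_of_subset_of_ncard_le hsub ?_ (Set.toFinite _)
      rw [Set.ncard_range_of_injective s.injective, Set.ncard_range_of_injective s'.injective]
    exact OrderEmbedding.range_inj.mp heq.symm

-- The column of δ_{i₀} is not replaced and vanishes modulo `I`.
variable {s} in
theorem detForm_mem {I : Ideal R} {i₀ : Fin n} (hi : i₀ ∉ Set.range s)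
    (hδ : ∀ l, b.repr (δ i₀) l ∈ I) (X : Fin j → V) : detForm b δ s X ∈ I := by
  rw [detForm_apply, Module.Basis.det_apply, ← Ideal.Quotient.eq_zero_iff_mem,
    ← Ideal.Quotient.mk_eq_mk, Ideal.Quotient.mk_eq_mk, RingHom.map_det]
  refine Matrix.det_eq_zero_of_column_eq_zero i₀ fun l => ?_
  rw [RingHom.mapMatrix_apply, Matrix.map_apply, Module.Basis.toMatrix_apply,
    Function.extend_apply' _ _ _ hi]
  exact Ideal.Quotient.eq_zero_iff_mem.mpr (hδ l)

/-- The linear map which sends the basis `b` to the family `δ`. -/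
noncomputable def familyMap : V →ₗ[R] V := Matrix.toLin b b (b.toMatrix δ)

theorem familyMap_basis (i : Fin n) : familyMap b δ (b i) = δ i := by
  rw [familyMap, Matrix.toLin_self]
  simp [Module.Basis.toMatrix_apply, b.sum_repr]

theorem det_familyMap : LinearMap.det (familyMap b δ) = b.det δ := by
  rw [familyMap, LinearMap.det_toLin, Module.Basis.det_apply]

theorem exists_familyMap_eq_smul (X : V) : ∃ Y, familyMap b δ Y = b.det δ • X := by
  refine ⟨Matrix.toLin b b (b.toMatrix δ).adjugate X, ?_⟩
  rw [familyMap, ← LinearMap.comp_apply, ← Matrix.toLin_mul, Matrix.mul_adjugate, map_smul,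
    Matrix.toLin_one, Module.Basis.det_apply]
  rfl

theorem familyMap_mem {L : Submodule R V} (h : ∀ i, δ i ∈ L) (X : V) : familyMap b δ X ∈ L := by
  rw [← b.sum_repr X, map_sum]
  refine sum_mem fun i _ => ?_
  rw [map_smul, familyMap_basis]
  exact L.smul_mem _ (h i)

theorem det_smul_mem {L : Submodule R V} (h : ∀ i, δ i ∈ L) (X : V) : b.det δ • X ∈ L := by
  obtain ⟨Y, hY⟩ := exists_familyMap_eq_smul b δ X
  exact hY ▸ familyMap_mem b δ h Y

theorem det_dvd_of_mem_span {w : Fin n → V} (h : ∀ i, w i ∈ Submodule.span R (Set.range δ)) :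
    b.det δ ∣ b.det w := by
  have : ∀ i, ∃ u, familyMap b δ u = w i := by
    intro i
    obtain ⟨c, hc⟩ := (Submodule.mem_span_range_iff_exists_fun R).mp (h i)
    exact ⟨∑ i, c i • b i, by simp [familyMap_basis, hc]⟩
  choose u hu using this
  have e : w = familyMap b δ ∘ u := funext fun i => (hu i).symm
  rw [e, b.det_comp, det_familyMap]
  exact dvd_mul_right _ _

theorem alternating_eq_zero_of_basis {γ : V [⋀^Fin j]→ₗ[R] R}
    (h : ∀ s : Fin j ↪o Fin n, γ (b ∘ s) = 0) : γ = 0 := by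
  refine b.ext_alternating fun f hf => ?_
  let σ := Tuple.sort f
  have hmono : StrictMono (f ∘ σ) :=
    (Tuple.monotone_sort f).strictMono_of_injective (hf.comp σ.injective)
  have h1 := h (OrderEmbedding.ofStrictMono _ hmono)
  have h2 := γ.map_perm (fun i => b (f i)) σ
  rw [show (b ∘ (OrderEmbedding.ofStrictMono _ hmono)) = (fun i => b (f i)) ∘ σ from rfl, h2] at h1
  rw [AlternatingMap.zero_apply]
  rcases Int.units_eq_one_or (Equiv.Perm.sign σ) with h3 | h3 <;> simpa [h3] using h1

variable [IsDomain R] {δ}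

/-- The family δ need not span, but the adjugate matrix puts det δ · X into its span; by
multilinearity (det δ)^j γ(X) = 0, and the factor cancels in a domain. -/
theorem alternating_eq_zero (hd : b.det δ ≠ 0) {γ : V [⋀^Fin j]→ₗ[R] R}
    (h : ∀ s : Fin j ↪o Fin n, γ (δ ∘ s) = 0) : γ = 0 := by
  have h1 : γ.compLinearMap (familyMap b δ) = 0 := by
    refine alternating_eq_zero_of_basis b fun s => ?_
    rw [AlternatingMap.compLinearMap_apply, ← h s]
    congr 1
    ext t
    simp [familyMap_basis]
  ext X
  choose Y hY using fun t => exists_familyMap_eq_smul b δ (X t)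
  have h2 := DFunLike.congr_fun h1 Y
  rw [AlternatingMap.compLinearMap_apply] at h2
  simp only [hY, AlternatingMap.zero_apply] at h2
  rw [γ.map_smul_univ (fun _ => b.det δ) X] at h2
  simpa [hd] using h2

theorem eq_sum_detForm (hd : b.det δ ≠ 0) {γ : V [⋀^Fin j]→ₗ[R] R} {c : (Fin j ↪o Fin n) → R}
    (h : ∀ s : Fin j ↪o Fin n, γ (δ ∘ s) = c s * b.det δ) : γ = ∑ s, c s • detForm b δ s := by
  classical
  rw [← sub_eq_zero]
  refine alternating_eq_zero b hd fun s' => ?_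
  rw [AlternatingMap.sub_apply, alternatingMap_sum_apply, h,
    Finset.sum_eq_single s' (fun s _ hs => by simp [detForm_ne b δ hs]) (by simp)]
  simp [detForm_self]

theorem linearIndependent_detForm (hd : b.det δ ≠ 0) :
    LinearIndependent R (fun s : Fin j ↪o Fin n => detForm b δ s) := by
  classical
  rw [Fintype.linearIndependent_iff]
  intro c hc s'
  have := DFunLike.congr_fun hc (δ ∘ s')
  rw [alternatingMap_sum_apply,
    Finset.sum_eq_single s' (fun s _ hs => by simp [detForm_ne b δ hs]) (by simp)] at this
  simpa [detForm_self, hd] using this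

variable (j) in
/-- The alternating forms whose values on subfamilies of `δ` are multiples of `det δ` have the
basis `detForm b δ s`. -/
noncomputable def detFormBasis (hd : b.det δ ≠ 0) (L : Submodule R (V [⋀^Fin j]→ₗ[R] R))
    (h₁ : ∀ s, detForm b δ s ∈ L) (h₂ : ∀ γ ∈ L, ∀ s : Fin j ↪o Fin n, b.det δ ∣ γ (δ ∘ s)) :
    Module.Basis (Fin j ↪o Fin n) R L :=
  Module.Basis.mk (v := fun s => (⟨detForm b δ s, h₁ s⟩ : L))
    (LinearIndependent.of_comp L.subtype (linearIndependent_detForm b hd)) (by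
      rintro ⟨γ, hγ⟩ -
      choose c hc using fun s => h₂ γ hγ s
      have := eq_sum_detForm b hd (γ := γ) (c := c) fun s => by rw [hc, mul_comm]
      have e : (⟨γ, hγ⟩ : L) = ∑ s, c s • (⟨detForm b δ s, h₁ s⟩ : L) := by
        ext1
        simpa using this
      rw [e]
      exact sum_mem fun s _ => Submodule.smul_mem _ _ (Submodule.subset_span ⟨s, rfl⟩))

theorem detFormBasis_apply (hd : b.det δ ≠ 0) (L : Submodule R (V [⋀^Fin j]→ₗ[R] R))
    (h₁ : ∀ s, detForm b δ s ∈ L) (h₂ : ∀ γ ∈ L, ∀ s : Fin j ↪o Fin n, b.det δ ∣ γ (δ ∘ s))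
    (s : Fin j ↪o Fin n) : (detFormBasis b j hd L h₁ h₂ s : V [⋀^Fin j]→ₗ[R] R) =
      detForm b δ s := by
  rw [detFormBasis, Module.Basis.mk_apply]

end DetForm

/-! ### Logarithmic forms -/

section LogForms

variable {R : Type*} [CommRing R] [Algebra ℂ R]

theorem dWedge_apply {k : ℕ} (f : R) (α : Forms R k) (X : Fin (k + 1) → VField R) :
    dWedge f α X = ∑ i : Fin (k + 1), (-1) ^ (i : ℕ) * (X i f * α (i.removeNth X)) := by
  simp [dWedge, AlternatingMap.alternatizeUncurryFin_apply, dFun]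

/-- The wedge product with `df` as a linear map. -/
def dWedgeHom (f : R) (k : ℕ) : Forms R k →ₗ[R] Forms R (k + 1) where
  toFun := dWedge f
  map_add' α α' := by
    ext X
    simp [dWedge_apply, mul_add, Finset.sum_add_distrib]
  map_smul' c α := by
    ext X
    simp only [dWedge_apply, AlternatingMap.smul_apply, smul_eq_mul, RingHom.id_apply,
      Finset.mul_sum]
    exact Finset.sum_congr rfl fun i _ => by ring

theorem dWedgeHom_apply {k : ℕ} (f : R) (α : Forms R k) : dWedgeHom f k α = dWedge f α := rfl

/-- The `k`-forms `β` such that `dh ∧ β` is divisible by `h`. -/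
def logForms (h : R) (k : ℕ) : Submodule R (Forms R k) :=
  (LinearMap.range (LinearMap.lsmul R (Forms R (k + 1)) h)).comap (dWedgeHom h k)

theorem mem_logForms {h : R} {k : ℕ} {β : Forms R k} :
    β ∈ logForms h k ↔ ∃ γ : Forms R (k + 1), dWedge h β = h • γ := by
  simp [logForms, dWedgeHom_apply, eq_comm]

theorem dWedge_mul {k : ℕ} (f g : R) (α : Forms R k) :
    dWedge (f * g) α = f • dWedge g α + g • dWedge f α := by
  ext X
  simp only [dWedge_apply, AlternatingMap.add_apply, AlternatingMap.smul_apply, smul_eq_mul,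
    Derivation.leibniz, Finset.mul_sum, ← Finset.sum_add_distrib]
  exact Finset.sum_congr rfl fun i _ => by ring

variable (R) in
/-- The map `(α, β) ↦ h α + dh ∧ β`. -/
def relationMap (h : R) (k : ℕ) : Forms R (k + 1) × Forms R k →ₗ[R] Forms R (k + 1) :=
  (LinearMap.lsmul R _ h).coprod (dWedgeHom h k)

/-- The generator alone suffices because d(c h) ∧ α = h (dc ∧ α) + dh ∧ (c α). -/
theorem range_relationMap (h : R) (k : ℕ) :
    LinearMap.range (relationMap R h k) = kahlerRelations (Ideal.span {h}) (k + 1) := by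
  apply le_antisymm
  · rintro _ ⟨⟨α, β⟩, rfl⟩
    rw [relationMap, LinearMap.coprod_apply]
    refine add_mem (Submodule.mem_sup_left ?_) (Submodule.mem_sup_right ?_)
    · exact Submodule.smul_mem_smul (Ideal.mem_span_singleton_self h) trivial
    · exact Submodule.subset_span ⟨h, Ideal.mem_span_singleton_self h, β, rfl⟩
  · refine sup_le ?_ (Submodule.span_le.mpr ?_)
    · refine Submodule.smul_le.mpr fun r hr α _ => ?_
      obtain ⟨c, rfl⟩ := Ideal.mem_span_singleton'.mp hr
      exact ⟨(c • α, 0), by simp [relationMap, smul_smul, mul_comm]⟩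
    · rintro _ ⟨f, hf, α, rfl⟩
      obtain ⟨c, rfl⟩ := Ideal.mem_span_singleton'.mp hf
      refine ⟨(dWedge c α, c • α), ?_⟩
      rw [dWedge_mul]
      simp [relationMap, dWedgeHom_apply, add_comm]

section Mero

variable [IsDomain R]

/-- A regular form as a meromorphic form. -/
noncomputable def Forms.toMero {k : ℕ} (η : Forms R k) : MeroForms R k :=
  (Algebra.linearMap R (FractionRing R)).compAlternatingMap η

theorem isRegularFun_extD_toMero {k : ℕ} (η : Forms R k) (X : Fin (k + 1) → VField R) :
    IsRegularFun (extD η.toMero X) := by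
  have h1 : ∀ (Y : VField R) (Z : Fin k → VField R), IsRegularFun (Y.ext (η.toMero Z)) :=
    fun Y Z => ⟨Y (η Z), (VField.ext_algebraMap Y (η Z)).symm⟩
  have hs : ∀ m : ℕ, ((-1 : FractionRing R)) ^ m ∈ (algebraMap R (FractionRing R)).range :=
    fun m => pow_mem (neg_mem (one_mem _)) _
  cases k with
  | zero => exact h1 _ _
  | succ k =>
    rw [extD]
    refine sub_mem (sum_mem fun i _ => mul_mem (hs _) (h1 _ _))
      (sum_mem fun i _ => sum_mem fun j _ => mul_mem (hs _) ⟨_, rfl⟩)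

/-- A form `η` with `η / h` logarithmic is the same as a form such that `dh ∧ η` is divisible
by `h`. -/
theorem hLogForms_eq {h : R} (h0 : h ≠ 0) (k : ℕ) : hLogForms h k = logForms h k := by
  set K := FractionRing R
  have hK : algebraMap R K h ≠ 0 := by
    simpa using (IsFractionRing.injective R K).ne h0
  -- the criterion for a meromorphic form `α` with `h α = η`
  have key : ∀ (η : Forms R k) (α : MeroForms R k),
      (∀ X, algebraMap R K h * α X = algebraMap R K (η X)) →
      ((∀ X, IsRegularFun (algebraMap R K h * extD α X)) ↔ η ∈ logForms h k) := by
    intro η α hα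
    have e1 : h • α = η.toMero := by
      ext X
      rw [AlternatingMap.smul_apply, Algebra.smul_def, hα]
      rfl
    have e2 : ∀ X : Fin (k + 1) → VField R, algebraMap R K h * ∑ i : Fin (k + 1), (-1) ^ (i : ℕ) *
        (X i h • α (i.removeNth X)) = algebraMap R K (dWedge h η X) := by
      intro X
      rw [dWedge_apply, map_sum, Finset.mul_sum]
      refine Finset.sum_congr rfl fun i _ => ?_
      rw [map_mul, map_mul, ← hα, Algebra.smul_def, map_pow, map_neg, map_one]
      ring
    -- By Leibniz dη = dh ∧ α + h dα, and dη is regular; so h dα is regular exactly when dh ∧ α =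
    -- (dh ∧ η) / h is.
    have e3 : ∀ X, IsRegularFun (algebraMap R K h * extD α X) ↔ h ∣ dWedge h η X := by
      intro X
      have e4 := extD_smul h α X
      rw [e1, Algebra.smul_def] at e4
      have e5 : IsRegularFun (algebraMap R K h * extD α X) ↔
          IsRegularFun (∑ i : Fin (k + 1), (-1) ^ (i : ℕ) * (X i h • α (i.removeNth X))) := by
        have e6 := isRegularFun_extD_toMero η X
        constructor
        · intro e7
          have := sub_mem e6 e7
          rwa [e4, add_sub_cancel_left] at this
        · intro e7
          have := sub_mem e6 e7
          rwa [e4, add_sub_cancel_right] at this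
      rw [e5]
      constructor
      · rintro ⟨c, hc⟩
        refine ⟨c, IsFractionRing.injective R K ?_⟩
        rw [← e2, ← hc, map_mul]
      · rintro ⟨c, hc⟩
        refine ⟨c, mul_left_cancel₀ hK ?_⟩
        rw [e2, hc, map_mul]
    simp_rw [e3]
    rw [mem_logForms]
    constructor
    · intro hdiv
      -- Quotients by `h` are unique in a domain, so the pointwise quotients form an alternating
      -- map.
      choose c hc using hdiv
      refine ⟨{ toFun := c
                map_update_add' := fun X i x y => mul_left_cancel₀ h0 ?_
                map_update_smul' := fun X i r x => mul_left_cancel₀ h0 ?_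
                map_eq_zero_of_eq' := fun X i j hX hij => mul_left_cancel₀ h0 ?_ }, ?_⟩
      · rw [mul_add, ← hc, ← hc, ← hc, AlternatingMap.map_update_add]
      · rw [smul_eq_mul, mul_left_comm, ← hc, ← hc, AlternatingMap.map_update_smul, smul_eq_mul]
      · rw [← hc, mul_zero, AlternatingMap.map_eq_zero_of_eq _ _ hX hij]
      · ext X
        exact hc X
    · rintro ⟨γ, hγ⟩ X
      rw [hγ]
      exact ⟨γ X, rfl⟩
  ext η
  constructor
  · rintro ⟨α, h1, h2⟩
    exact (key η α h1).mp h2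
  · intro hη
    let α : MeroForms R k :=
      (LinearMap.lsmul R K).flip (algebraMap R K h)⁻¹ |>.compAlternatingMap η
    have hα : ∀ X, algebraMap R K h * α X = algebraMap R K (η X) := by
      intro X
      have : α X = algebraMap R K (η X) * (algebraMap R K h)⁻¹ := by
        simp [α, Algebra.smul_def]
      rw [this, mul_left_comm, mul_inv_cancel₀ hK, mul_one]
    exact ⟨α, hα, (key η α hα).mpr hη⟩

end Mero

end LogForms

/-! ### Saito's criterion -/

section Saito

open IsLocalRing RingTheory.Sequence

variable {n : ℕ} {R : Type*} [CommRing R] [Algebra ℂ R] [IsLocalRing R] [IsNoetherianRing R]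
  [IsDomain R] (S : RegularCoords n R)

/-- A family of `n` logarithmic vector fields whose determinant is a unit times `h`. -/
structure LogFrame (S : RegularCoords n R) (h : R) where
  /-- The vector fields. -/
  δ : Fin n → VField R
  /-- The quotients `δ i h / h`. -/
  a : Fin n → R
  apply_eq : ∀ i, δ i h = a i * h
  /-- The unit factor of the determinant. -/
  c : R
  isUnit_c : IsUnit c
  det_eq : S.basis.det δ = c * h

theorem mem_derLog_span_singleton {h : R} {X : VField R} :
    X ∈ derLog (Ideal.span {h}) ↔ h ∣ X h := by
  constructor
  · intro hX
    exact Ideal.mem_span_singleton.mp (hX h (Ideal.mem_span_singleton_self h))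
  · intro hX f hf
    obtain ⟨c, rfl⟩ := Ideal.mem_span_singleton'.mp hf
    rw [Derivation.leibniz]
    exact add_mem (Ideal.mul_mem_left _ _ (Ideal.mem_span_singleton.mpr hX))
      (Ideal.mul_mem_right _ _ (Ideal.mem_span_singleton_self h))

namespace RegularCoords

theorem apply_eq_sum (X : VField R) (f : R) : X f = ∑ i, X (S.x i) * S.pd i f := by
  conv_lhs => rw [← S.sum_pd X]
  rw [derivation_sum_apply]
  rfl

/-- As `h` is reduced, its derivatives do not all vanish on any component of the hypersurface; hence
nothing nonzero modulo `h` is killed by all of them. -/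
theorem dvd_of_forall_dvd_mul (S : RegularCoords n R) {h : R} (h0 : h ≠ 0)
    (hrad : (Ideal.span {h}).IsRadical) {f : R} (hf : ∀ X : VField R, h ∣ f * X h) : h ∣ f := by
  rw [← Ideal.mem_span_singleton]
  refine S.mem_of_mul_derivation_mem hrad (by simpa using h0) fun g hg X => ?_
  obtain ⟨c, rfl⟩ := Ideal.mem_span_singleton'.mp hg
  rw [Derivation.leibniz, mul_add, Ideal.mem_span_singleton, smul_eq_mul, smul_eq_mul,
    mul_left_comm f c, mul_left_comm f h]
  exact dvd_add ((hf X).mul_left c) (dvd_mul_right _ _)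

theorem dvd_of_forall_dvd_mul_pd {h : R} (h0 : h ≠ 0)
    (hrad : (Ideal.span {h}).IsRadical) {f : R} (hf : ∀ i, h ∣ f * S.pd i h) : h ∣ f := by
  refine S.dvd_of_forall_dvd_mul h0 hrad fun X => ?_
  rw [S.apply_eq_sum, Finset.mul_sum]
  refine Finset.dvd_sum fun i _ => ?_
  rw [mul_left_comm]
  exact (hf i).mul_left _

theorem pow_dvd_of_forall_dvd_mul_pd {h : R} (h0 : h ≠ 0)
    (hrad : (Ideal.span {h}).IsRadical) (m : ℕ) {f : R} (hf : ∀ i, h ^ m ∣ f * S.pd i h) :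
    h ^ m ∣ f := by
  induction m generalizing f with
  | zero => simp
  | succ m ih =>
    obtain ⟨g, rfl⟩ := S.dvd_of_forall_dvd_mul_pd h0 hrad fun i =>
      (dvd_pow_self h m.succ_ne_zero).trans (hf i)
    rw [pow_succ']
    refine mul_dvd_mul_left h (ih fun i => ?_)
    have := hf i
    rw [pow_succ', mul_assoc] at this
    exact (mul_dvd_mul_iff_left h0).mp this

/-- Divisibility by a power of `h` may be tested off the singular locus. The N-th powers of the
partial derivatives generate, up to radical, the Jacobian ideal J; hence some J^M multiplies `e`
into (h^m), and the factors J are removed one at a time. -/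
theorem pow_dvd_of_forall_dvd_mul_pd_pow {h : R} (h0 : h ≠ 0)
    (hrad : (Ideal.span {h}).IsRadical) (m N : ℕ) {e : R}
    (he : ∀ i, h ^ m ∣ e * S.pd i h ^ N) : h ^ m ∣ e := by
  let K : Ideal R :=
    { carrier := {f | h ^ m ∣ e * f}
      add_mem' := fun ha hb => by
        rw [Set.mem_ofPred_eq, mul_add]
        exact dvd_add ha hb
      zero_mem' := by simp
      smul_mem' := fun c g hg => by
        rw [Set.mem_ofPred_eq, smul_eq_mul, mul_left_comm]
        exact Dvd.dvd.mul_left hg c }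
  let J : Ideal R := Ideal.span (Set.range fun i => S.pd i h)
  have hJ : J ≤ K.radical := by
    refine Ideal.span_le.mpr ?_
    rintro _ ⟨i, rfl⟩
    exact ⟨N, he i⟩
  obtain ⟨M, hM⟩ := Ideal.exists_pow_le_of_le_radical_of_fg hJ (IsNoetherian.noetherian J)
  have key : ∀ M : ℕ, ∀ e : R, (∀ f ∈ J ^ M, h ^ m ∣ e * f) → h ^ m ∣ e := by
    intro M
    induction M with
    | zero =>
      intro e he
      simpa using he 1 (by simp)
    | succ M ih =>
      intro e he
      refine ih e fun f hf => S.pow_dvd_of_forall_dvd_mul_pd h0 hrad m fun i => ?_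
      rw [mul_assoc]
      refine he _ ?_
      rw [pow_succ]
      exact Ideal.mul_mem_mul hf (Ideal.subset_span ⟨i, rfl⟩)
  exact key M e fun f hf => hM hf

/-- All these fields are logarithmic, since ∂_i h ∂_j - ∂_j h ∂_i annihilates `h`. They form a frame
where ∂_i h is invertible. The matrix is block triangular, with N = n - 1. -/
theorem det_twist_eq (i : Fin n) (h : R) : ∃ N : ℕ,
    S.basis.det (fun j => if j = i then h • S.pd i else S.pd i h • S.pd j - S.pd j h • S.pd i) =
      S.pd i h ^ N * h := by
  classical
  refine ⟨Fintype.card {j // j ≠ i}, ?_⟩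
  rw [Module.Basis.det_apply, ← Matrix.det_transpose]
  set W := (S.basis.toMatrix fun j => if j = i then h • S.pd i else
    S.pd i h • S.pd j - S.pd j h • S.pd i).transpose with hW
  have hWi : ∀ l, W i l = if l = i then h else 0 := by
    intro l
    simp [hW, Module.Basis.toMatrix_apply, ← S.basis_apply, Finsupp.single_apply, eq_comm]
  have hWj : ∀ j l, j ≠ i → l ≠ i → W j l = if j = l then S.pd i h else 0 := by
    intro j l hj hl
    simp [hW, Module.Basis.toMatrix_apply, ← S.basis_apply, Finsupp.single_apply, hj, hl.symm]
  rw [Matrix.twoBlockTriangular_det W (fun j => j ≠ i) (by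
    intro j hj l hl
    obtain rfl : j = i := not_not.mp hj
    rw [hWi, if_neg hl])]
  congr 1
  · have : W.toSquareBlockProp (fun j => j ≠ i) = Matrix.scalar _ (S.pd i h) := by
      ext j l
      simp [Matrix.toSquareBlockProp, hWj j l j.2 l.2, Matrix.diagonal_apply, Subtype.ext_iff]
    rw [this, Matrix.scalar_apply, Matrix.det_diagonal]
    simp
  · have : Unique {j // ¬ j ≠ i} := ⟨⟨⟨i, by simp⟩⟩, fun j => Subtype.ext (not_not.mp j.2)⟩
    rw [Matrix.det_unique]
    have hd : ((default : {j // ¬ j ≠ i}) : Fin n) = i :=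
      not_not.mp (default : {j // ¬ j ≠ i}).2
    simp [Matrix.toSquareBlockProp, hd, hWi]

/-- From h · Der ⊆ Der(log) ⊆ Der the rank is `n`. The determinant of a basis is h c, and `c`
divides the determinant of every logarithmic family divided by `h`: it divides powers of all ∂_i h,
so it can only vanish on the singular locus, while it also divides h^n. By the preceding lemmas it
is a unit. -/
theorem exists_logFrame {h : R} (h0 : h ≠ 0) (hrad : (Ideal.span {h}).IsRadical)
    (hfree : Module.Free R (derLog (Ideal.span {h}))) : Nonempty (LogFrame S h) := by
  have : Module.Finite R (VField R) := Module.Finite.of_basis S.basis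
  have : Module.Free R (VField R) := Module.Free.of_basis S.basis
  set D := derLog (Ideal.span {h})
  have hV : Module.finrank R (VField R) = n := by
    rw [Module.finrank_eq_card_basis S.basis, Fintype.card_fin]
  have hle : Module.finrank R D ≤ n := hV ▸ Submodule.finrank_le D
  have hsmul : ∀ X : VField R, h • X ∈ D := fun X =>
    mem_derLog_span_singleton.mpr (dvd_mul_right h (X h))
  have hge : n ≤ Module.finrank R D := by
    rw [← hV]
    refine LinearMap.finrank_le_finrank_of_injective
      (f := (LinearMap.lsmul R (VField R) h).codRestrict D hsmul) fun X Y hXY => ?_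
    have := congrArg Subtype.val hXY
    have : h • X = h • Y := this
    have hsub : h • (X - Y) = 0 := by rw [smul_sub, this, sub_self]
    have := (S.basis.smul_eq_zero.mp hsub).resolve_left h0
    exact sub_eq_zero.mp this
  let B := (Module.finBasis R D).reindex (finCongr (le_antisymm hle hge))
  let δ : Fin n → VField R := fun i => B i
  have hspan : ∀ X ∈ D, X ∈ Submodule.span R (Set.range δ) := by
    intro X hX
    have := congrArg Subtype.val (B.sum_repr ⟨X, hX⟩)
    rw [← show _ = X from this, Submodule.coe_sum]
    exact sum_mem fun i _ => Submodule.smul_mem _ _ (Submodule.subset_span ⟨i, rfl⟩)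
  have hδ : ∀ i, δ i ∈ D := fun i => (B i).2
  -- By Cramer det δ · X is a combination of the δ_i, hence logarithmic for every `X`.
  have h1 : h ∣ S.basis.det δ := by
    refine S.dvd_of_forall_dvd_mul h0 hrad fun X => ?_
    exact mem_derLog_span_singleton.mp (det_smul_mem S.basis δ hδ X)
  obtain ⟨c, hc⟩ := h1
  have h2 : c ∣ h ^ n := by
    have h3 := det_dvd_of_mem_span S.basis δ (w := fun i => h • S.basis i)
      fun i => hspan _ (hsmul _)
    have h4 : S.basis.det (fun i => h • S.basis i) = h ^ n := by
      have := S.basis.det.map_smul_univ (fun _ => h) S.basis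
      simpa [S.basis.det_self] using this
    rw [h4, hc] at h3
    exact (dvd_mul_left c h).trans h3
  have h5 : ∀ i, ∃ N, c ∣ S.pd i h ^ N := by
    intro i
    obtain ⟨N, hN⟩ := S.det_twist_eq i h
    have h6 := det_dvd_of_mem_span S.basis δ (w := fun j => if j = i then h • S.pd i else
      S.pd i h • S.pd j - S.pd j h • S.pd i) fun j => hspan _ (by
        split_ifs with hj
        · exact hsmul _
        · refine mem_derLog_span_singleton.mpr ⟨0, ?_⟩
          rw [Derivation.sub_apply, Derivation.smul_apply, Derivation.smul_apply, smul_eq_mul,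
            smul_eq_mul, mul_comm, sub_self, mul_zero])
    rw [hN, hc, mul_comm h c] at h6
    exact ⟨N, (mul_dvd_mul_iff_right h0).mp h6⟩
  choose N hN using h5
  obtain ⟨e, he⟩ := h2
  -- With h^n = c e and (∂_i h)^N = c d one gets e (∂_i h)^N = h^n d; the sum of the `N i` serves as
  -- common exponent. Then h^n ∣ e makes `c` invertible.
  have h7 : h ^ n ∣ e := by
    refine S.pow_dvd_of_forall_dvd_mul_pd_pow h0 hrad n (∑ i, N i) fun i => ?_
    have h8 : c ∣ S.pd i h ^ ∑ i, N i :=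
      (hN i).trans (pow_dvd_pow _ (Finset.single_le_sum (fun _ _ => Nat.zero_le _)
        (Finset.mem_univ i)))
    obtain ⟨d, hd⟩ := h8
    exact ⟨d, by rw [hd, he]; ring⟩
  obtain ⟨e', rfl⟩ := h7
  have hunit : IsUnit c := by
    refine IsUnit.of_mul_eq_one e' ?_
    have : h ^ n * (c * e') = h ^ n * 1 := by
      conv_rhs => rw [mul_one, he]
      ring
    exact mul_left_cancel₀ (pow_ne_zero n h0) this
  choose a ha using fun i => mem_derLog_span_singleton.mp (hδ i)
  exact ⟨⟨δ, a, fun i => by rw [ha, mul_comm], c, hunit, by rw [hc, mul_comm]⟩⟩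

end RegularCoords

end Saito

/-! ### Resolutions of the modules of forms -/

section FormModules

open IsLocalRing RingTheory.Sequence

universe u

theorem exists_orderEmbedding_avoiding {n j : ℕ} (hj : j + 1 ≤ n) (i : Fin n) :
    ∃ s : Fin j ↪o Fin n, i ∉ Set.range s := by
  have hcard : j ≤ (Finset.univ.erase i).card := by
    rw [Finset.card_erase_of_mem (Finset.mem_univ i), Finset.card_univ, Fintype.card_fin]
    omega
  obtain ⟨T, hT, hTj⟩ := Finset.exists_subset_card_eq hcard
  refine ⟨T.orderEmbOfFin hTj, ?_⟩
  rw [Finset.range_orderEmbOfFin]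
  exact fun h => Finset.notMem_erase i _ (hT h)

/-- An (n + 1) × n matrix whose maximal minors vanish has a kernel. Otherwise the kernel vectors of
the n + 1 square submatrices would each be detected by the omitted row only, and so would span an
image of dimension n + 1. -/
theorem exists_mulVec_eq_zero_and_dotProduct_eq_zero {k : Type*} [Field k] {n : ℕ}
    (A : Matrix (Fin n) (Fin n) k) (a : Fin n → k) (hA : A.det = 0)
    (hAa : ∀ l, (A.updateRow l a).det = 0) : ∃ v ≠ 0, A.mulVec v = 0 ∧ a ⬝ᵥ v = 0 := by
  by_contra! H
  obtain ⟨v, hv, hAv⟩ := Matrix.exists_mulVec_eq_zero_iff.mpr hA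
  choose w hw hAw using fun l => Matrix.exists_mulVec_eq_zero_iff.mpr (hAa l)
  have hwa : ∀ l, a ⬝ᵥ w l = 0 := by
    intro l
    have := congrFun (hAw l) l
    simpa [Matrix.mulVec] using this
  have hwA : ∀ l m, m ≠ l → A.mulVec (w l) m = 0 := by
    intro l m hm
    have := congrFun (hAw l) m
    simpa [Matrix.mulVec, Matrix.updateRow_ne hm] using this
  have hs : ∀ l, A.mulVec (w l) l ≠ 0 := by
    intro l h0
    refine H (w l) (hw l) (funext fun m => ?_) (hwa l)
    by_cases hm : m = l
    · rw [hm, h0, Pi.zero_apply]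
    · exact hwA l m hm
  let T : (Fin n → k) →ₗ[k] (Fin n → k) × k :=
    (Matrix.mulVecLin A).prod (LinearMap.lsum k (fun _ => k) k fun i => LinearMap.lsmul k k (a i))
  have hT : ∀ u, T u = (A.mulVec u, a ⬝ᵥ u) := by
    intro u
    simp [T, dotProduct]
  have hsurj : Function.Surjective T := by
    rintro ⟨y, r⟩
    refine ⟨∑ l, (y l / A.mulVec (w l) l) • w l + (r / (a ⬝ᵥ v)) • v, ?_⟩
    have hav : a ⬝ᵥ v ≠ 0 := H v hv hAv
    simp only [map_add, map_sum, map_smul]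
    simp only [hT, hAv, hwa]
    ext m
    · simp only [Prod.fst_add, Prod.fst_sum, Prod.smul_mk, smul_zero, add_zero, Finset.sum_apply,
        Pi.smul_apply, smul_eq_mul]
      rw [Finset.sum_eq_single m (fun l _ hl => by rw [hwA l m hl.symm, mul_zero]) (by simp)]
      exact div_mul_cancel₀ _ (hs m)
    · simp [Prod.snd_sum, div_mul_cancel₀ _ hav]
  have := LinearMap.finrank_le_finrank_of_surjective (f := T) hsurj
  simp at this

variable {n : ℕ} {R : Type u} [CommRing R] [Algebra ℂ R] [IsLocalRing R] [IsNoetherianRing R]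
  [IsDomain R] {S : RegularCoords n R} {h : R}

theorem det_basis_self_ne_zero : S.basis.det (S.basis : Fin n → VField R) ≠ 0 := by
  rw [S.basis.det_self]
  exact one_ne_zero

variable (S) in
/-- The basis of the module of `j`-forms given by the wedge products of the differentials of the
coordinates. -/
noncomputable def formsBasis (j : ℕ) : Module.Basis (Fin j ↪o Fin n) R (Forms R j) :=
  (detFormBasis S.basis j (det_basis_self_ne_zero (S := S)) ⊤ (fun _ => trivial) fun γ _ s => by
    rw [S.basis.det_self]
    exact one_dvd _).map Submodule.topEquiv

theorem mem_smul_top_of_forall_apply_mem (S : RegularCoords n R) {I : Ideal R} {j : ℕ}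
    {η : Forms R j}
    (hη : ∀ X, η X ∈ I) : η ∈ I • (⊤ : Submodule R (Forms R j)) := by
  rw [eq_sum_detForm S.basis (det_basis_self_ne_zero (S := S)) (γ := η)
    (c := fun s => η (S.basis ∘ s)) (fun s => by rw [S.basis.det_self, mul_one])]
  exact sum_mem fun s _ => Submodule.smul_mem_smul (hη _) trivial

/-- Evaluate dh ∧ β on (X, D₁, …, D_j): modulo `h` only X h · β(D) survives, and `X` is arbitrary.
-/
theorem dvd_apply_of_mem_logForms (S : RegularCoords n R) (h0 : h ≠ 0)
    (hrad : (Ideal.span {h}).IsRadical) {j : ℕ} {β : Forms R j} (hβ : β ∈ logForms h j)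
    {D : Fin j → VField R} (hD : ∀ t, h ∣ D t h) : h ∣ β D := by
  obtain ⟨γ, hγ⟩ := mem_logForms.mp hβ
  refine S.dvd_of_forall_dvd_mul h0 hrad fun X => ?_
  have h1 := DFunLike.congr_fun hγ (Fin.cons X D)
  rw [dWedge_apply, Fin.sum_univ_succ] at h1
  have h2 : h ∣ ∑ i : Fin j, (-1) ^ ((i.succ : Fin (j + 1)) : ℕ) *
      ((Fin.cons X D : Fin (j + 1) → VField R) i.succ h *
        β (i.succ.removeNth (Fin.cons X D : Fin (j + 1) → VField R))) := by
    refine Finset.dvd_sum fun i _ => ?_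
    rw [Fin.cons_succ]
    exact ((hD i).mul_right _).mul_left _
  have h3 : h ∣ (h • γ) (Fin.cons X D) := ⟨γ (Fin.cons X D), rfl⟩
  rw [← h1] at h3
  have h4 := (dvd_add_left h2).mp h3
  rw [Fin.removeNth_zero, Fin.tail_cons] at h4
  simpa [mul_comm] using h4

namespace LogFrame

variable (F : LogFrame S h)

theorem det_ne_zero (h0 : h ≠ 0) : S.basis.det F.δ ≠ 0 := by
  rw [F.det_eq]
  exact mul_ne_zero F.isUnit_c.ne_zero h0

/-- The coefficients of `dh / h ∧ ω` in the basis of logarithmic forms, where `ω` is the member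
of this basis with index `s`. -/
def wedgeCoeff {j : ℕ} (s : Fin j ↪o Fin n) (s' : Fin (j + 1) ↪o Fin n) : R :=
  ∑ t : Fin (j + 1), (-1) ^ (t : ℕ) * (F.a (s' t) *
    if (Fin.succAboveOrderEmb t).trans s' = s then 1 else 0)

/-- Both sides are compared on subfamilies of δ, where δ_i h = a_i h supplies the factor `h` and
duality leaves only the terms in which removing one index of s' gives s. -/
theorem dWedge_detForm (h0 : h ≠ 0) {j : ℕ} (s : Fin j ↪o Fin n) :
    dWedge h (detForm S.basis F.δ s) =
      h • ∑ s', F.wedgeCoeff s s' • detForm S.basis F.δ s' := by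
  rw [eq_sum_detForm S.basis (F.det_ne_zero h0) (γ := dWedge h (detForm S.basis F.δ s))
    (c := fun s' => h * F.wedgeCoeff s s'), Finset.smul_sum]
  · exact Finset.sum_congr rfl fun s' _ => by rw [smul_smul]
  · intro s'
    rw [dWedge_apply, wedgeCoeff, Finset.mul_sum, Finset.sum_mul]
    refine Finset.sum_congr rfl fun t _ => ?_
    have e : t.removeNth (F.δ ∘ s') = F.δ ∘ ((Fin.succAboveOrderEmb t).trans s') := rfl
    rw [e, Function.comp_apply, F.apply_eq]
    split_ifs with hs
    · rw [hs, detForm_self]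
      ring
    · rw [detForm_ne _ _ (Ne.symm hs)]
      ring

/-- The basis of the module of logarithmic forms (multiplied by `h`). -/
noncomputable def logBasis (h0 : h ≠ 0) (hrad : (Ideal.span {h}).IsRadical) (j : ℕ) :
    Module.Basis (Fin j ↪o Fin n) R (logForms h j) :=
  detFormBasis S.basis j (F.det_ne_zero h0) (logForms h j)
    (fun s => mem_logForms.mpr ⟨_, F.dWedge_detForm h0 s⟩) fun γ hγ s => by
      rw [F.det_eq, F.isUnit_c.mul_left_dvd]
      exact dvd_apply_of_mem_logForms S h0 hrad hγ fun t => ⟨F.a (s t), by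
        rw [Function.comp_apply, F.apply_eq, mul_comm]⟩

theorem logBasis_apply (h0 : h ≠ 0) (hrad : (Ideal.span {h}).IsRadical) {j : ℕ}
    (s : Fin j ↪o Fin n) : (F.logBasis h0 hrad j s : Forms R j) = detForm S.basis F.δ s :=
  detFormBasis_apply ..

/-- At a singular point there is a frame one of whose members `X` vanishes, with `X h / h`
vanishing as well. -/
theorem exists_adapted (F : LogFrame S h) (h0 : h ≠ 0) (hm : h ∈ maximalIdeal R)
    (hsing : ∀ X : VField R, X h ∈ maximalIdeal R) :
    ∃ (F' : LogFrame S h) (i₀ : Fin n), (∀ l, S.basis.repr (F'.δ i₀) l ∈ maximalIdeal R) ∧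
      F'.a i₀ ∈ maximalIdeal R := by
  set A := S.basis.toMatrix F.δ with hA
  have hdet : A.det = F.c * h := by rw [hA, ← Module.Basis.det_apply, F.det_eq]
  have hrow : h • F.a = ∑ m, S.pd m h • A m := by
    ext i
    have := F.apply_eq i
    have h2 := congrArg (fun X : VField R => X h) (S.basis.sum_repr (F.δ i))
    simp only [derivation_sum_apply, S.basis_apply, Derivation.smul_apply, smul_eq_mul] at h2
    rw [Pi.smul_apply, Finset.sum_apply, smul_eq_mul, mul_comm, ← this, ← h2]
    exact Finset.sum_congr rfl fun m _ => by
      simp [hA, Module.Basis.toMatrix_apply, mul_comm]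
  -- Cramer's rule: by `hrow`, h · a is the combination of the rows of A with coefficients ∂_m h, so
  -- the determinant with row l replaced by h · a is ∂_l h · det A = ∂_l h · c h. Cancel `h`.
  have hcramer : ∀ l, (A.updateRow l F.a).det = F.c * S.pd l h := by
    intro l
    have h1 : (A.updateRow l (h • F.a)).det = h * (A.updateRow l F.a).det :=
      Matrix.det_updateRow_smul _ _ _ _
    rw [hrow, Matrix.det_updateRow_sum, hdet, smul_eq_mul] at h1
    apply mul_left_cancel₀ h0
    rw [← h1]
    ring
  let ρ := residue R
  have hρ : ∀ r : R, ρ r = 0 ↔ r ∈ maximalIdeal R := fun r => residue_eq_zero_iff r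
  obtain ⟨v, hv, hAv, hav⟩ := exists_mulVec_eq_zero_and_dotProduct_eq_zero (A.map ρ) (ρ ∘ F.a)
    (by
      rw [← RingHom.mapMatrix_apply, ← RingHom.map_det, hdet, hρ]
      exact Ideal.mul_mem_left _ _ hm)
    (fun l => by
      have : (A.map ρ).updateRow l (ρ ∘ F.a) = (A.updateRow l F.a).map ρ :=
        (Matrix.map_updateRow ..).symm
      rw [this, ← RingHom.mapMatrix_apply, ← RingHom.map_det, hcramer, hρ]
      exact Ideal.mul_mem_left _ _ (hsing _))
  choose u hu using fun i => residue_surjective (R := R) (v i)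
  obtain ⟨i₀, hi₀⟩ := Function.ne_iff.mp hv
  have hunit : IsUnit (u i₀) := by
    by_contra hnu
    exact hi₀ (by rw [← hu i₀, Pi.zero_apply]; exact (hρ _).mpr hnu)
  -- `u` lifts the common kernel vector found over the residue field. Since u_{i₀} is a unit,
  -- replacing δ_{i₀} by ∑ u_i δ_i changes the determinant by a unit only.
  refine ⟨⟨Function.update F.δ i₀ (∑ i, u i • F.δ i), Function.update F.a i₀ (∑ i, u i * F.a i),
    fun i => ?_, u i₀ * F.c, hunit.mul F.isUnit_c, ?_⟩, i₀, fun l => ?_, ?_⟩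
  · by_cases hi : i = i₀
    · subst hi
      rw [Function.update_self, Function.update_self, derivation_sum_apply, Finset.sum_mul]
      exact Finset.sum_congr rfl fun j _ => by
        rw [Derivation.smul_apply, F.apply_eq, smul_eq_mul, mul_assoc]
    · rw [Function.update_of_ne hi, Function.update_of_ne hi, F.apply_eq]
  · rw [AlternatingMap.map_update_sum, Finset.sum_eq_single i₀ (fun i _ hi => ?_) (by simp)]
    · rw [AlternatingMap.map_update_smul, Function.update_eq_self, F.det_eq, smul_eq_mul, mul_assoc]
    · rw [AlternatingMap.map_update_smul, AlternatingMap.map_update_self _ _ (Ne.symm hi),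
        smul_zero]
  · have := congrFun hAv l
    dsimp only
    rw [Function.update_self, ← hρ, map_sum, Finsupp.finsetSum_apply, map_sum]
    rw [Matrix.mulVec, dotProduct] at this
    rw [← show _ = (0 : ResidueField R) from this]
    refine Finset.sum_congr rfl fun i _ => ?_
    rw [← hu i]
    simp [hA, Module.Basis.toMatrix_apply, ρ, mul_comm]
  · dsimp only
    rw [Function.update_self, ← hρ, map_sum, ← hav, dotProduct]
    refine Finset.sum_congr rfl fun i _ => ?_
    rw [← hu i]
    simp [ρ, mul_comm]

end LogFrame

theorem dWedge_dWedge {j : ℕ} (f : R) (β : Forms R j) : dWedge f (dWedge f β) = 0 := by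
  have := AlternatingMap.alternatizeUncurryFin_alternatizeUncurryFinLM_comp_of_symmetric
    (f := (dFun f).smulRight ((dFun f).smulRight β)) fun x y => by
      simp [smul_smul, mul_comm]
  have e : AlternatingMap.alternatizeUncurryFinLM ∘ₗ (dFun f).smulRight ((dFun f).smulRight β) =
      (dFun f).smulRight (dWedge f β) := by
    refine LinearMap.ext fun x => ?_
    rw [LinearMap.comp_apply, LinearMap.smulRight_apply, map_smul]
    rfl
  rw [e] at this
  exact this

/-- dh ∧ (h α + dh ∧ β) = h (dh ∧ α). -/
theorem range_relationMap_le_logForms (j : ℕ) :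
    LinearMap.range (relationMap R h j) ≤ logForms h (j + 1) := by
  rintro _ ⟨⟨α, β⟩, rfl⟩
  refine mem_logForms.mpr ⟨dWedge h α, ?_⟩
  rw [← dWedgeHom_apply, relationMap, LinearMap.coprod_apply, map_add, LinearMap.lsmul_apply,
    map_smul, dWedgeHom_apply, dWedgeHom_apply, dWedgeHom_apply, dWedge_dWedge, add_zero]

/-- If `h` divided dh ∧ η for all η, products η of coordinate differentials avoiding dx_i would give
h ∣ ∂_i h for every i, and `h` would be a unit. The bound on `k` leaves room to avoid an index. -/
theorem logForms_ne_top (S : RegularCoords n R) (h0 : h ≠ 0) (hm : h ∈ maximalIdeal R)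
    (hrad : (Ideal.span {h}).IsRadical) {k : ℕ} (hk : k + 1 ≤ n) : logForms h k ≠ ⊤ := by
  intro htop
  have h1 : h ∣ 1 := by
    refine S.dvd_of_forall_dvd_mul_pd h0 hrad fun i => ?_
    obtain ⟨s, hs⟩ := exists_orderEmbedding_avoiding hk i
    have hmem : detForm S.basis S.basis s ∈ logForms h k := htop ▸ trivial
    obtain ⟨γ, hγ⟩ := mem_logForms.mp hmem
    have h2 := DFunLike.congr_fun hγ (S.basis ∘ (Fin.cons i s : Fin (k + 1) → Fin n))
    rw [dWedge_apply, Fin.sum_univ_succ, Finset.sum_eq_zero, add_zero] at h2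
    · have e : (0 : Fin (k + 1)).removeNth (S.basis ∘ (Fin.cons i s : Fin (k + 1) → Fin n)) =
          S.basis ∘ s := rfl
      rw [e, detForm_self, S.basis.det_self] at h2
      refine ⟨γ (S.basis ∘ (Fin.cons i s : Fin (k + 1) → Fin n)), ?_⟩
      simpa [S.basis_apply] using h2
    · intro t _
      cases k with
      | zero => exact t.elim0
      | succ k =>
        have e : t.succ.removeNth (S.basis ∘ (Fin.cons i s : Fin (k + 2) → Fin n)) =
            S.basis ∘ (t.succ.removeNth (Fin.cons i s : Fin (k + 2) → Fin n)) := rfl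
        rw [e, detForm_of_ne_range S.basis S.basis s (t := 0), mul_zero, mul_zero]
        have e2 : t.succ.removeNth (Fin.cons i s : Fin (k + 2) → Fin n) 0 = i := by
          simp [Fin.removeNth]
        rw [e2]
        exact hs
  exact (mem_maximalIdeal h).mp hm (isUnit_of_dvd_one h1)

/-- The kernel of `(α, β) ↦ h α + dh ∧ β` is isomorphic to the module of logarithmic forms. -/
noncomputable def kerRelationEquiv (h0 : h ≠ 0) (j : ℕ) :
    LinearMap.ker (relationMap R h j) ≃ₗ[R] logForms h j :=
  LinearEquiv.ofBijective
    (((LinearMap.snd R _ _).comp (LinearMap.ker (relationMap R h j)).subtype).codRestrict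
      (logForms h j) (by
        rintro ⟨⟨α, β⟩, hαβ⟩
        refine mem_logForms.mpr ⟨-α, ?_⟩
        rw [LinearMap.mem_ker, relationMap, LinearMap.coprod_apply, LinearMap.lsmul_apply] at hαβ
        rw [smul_neg]
        exact (neg_eq_of_add_eq_zero_right hαβ).symm)) <| by
    constructor
    · rintro ⟨⟨α, β⟩, hαβ⟩ ⟨⟨α', β'⟩, hαβ'⟩ heq
      obtain rfl : β = β' := congrArg Subtype.val heq
      rw [LinearMap.mem_ker, relationMap, LinearMap.coprod_apply, LinearMap.lsmul_apply] at hαβ hαβ'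
      have h1 : h • α = h • α' := add_right_cancel (hαβ.trans hαβ'.symm)
      have h2 : α = α' := by
        ext X
        exact mul_left_cancel₀ h0 (DFunLike.congr_fun h1 X)
      subst h2
      rfl
    · rintro ⟨β, hβ⟩
      obtain ⟨γ, hγ⟩ := mem_logForms.mp hβ
      refine ⟨⟨(-γ, β), ?_⟩, rfl⟩
      rw [LinearMap.mem_ker, relationMap, LinearMap.coprod_apply, LinearMap.lsmul_apply,
        dWedgeHom_apply, hγ, smul_neg, neg_add_cancel]

theorem free_forms (S : RegularCoords n R) (j : ℕ) :
    Module.Free R (Forms R j) ∧ Module.Finite R (Forms R j) :=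
  ⟨Module.Free.of_basis (formsBasis S j), Module.Finite.of_basis (formsBasis S j)⟩

theorem nontrivial_checkForms (S : RegularCoords n R) (h0 : h ≠ 0) (hm : h ∈ maximalIdeal R)
    (hrad : (Ideal.span {h}).IsRadical) {k : ℕ} (hk : k + 1 ≤ n) : Nontrivial (CheckForms h k) := by
  rw [Submodule.Quotient.nontrivial_iff, hLogForms_eq h0]
  exact logForms_ne_top S h0 hm hrad hk

/-- The module is killed by `h`, a nonzerodivisor in the maximal ideal. -/
theorem supportDim_checkForms_le (S : RegularCoords n R) (h0 : h ≠ 0) (hm : h ∈ maximalIdeal R)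
    (k : ℕ) : Module.supportDim R (CheckForms h k) + 1 ≤ n := by
  have := (free_forms S k).2
  have hann : Ideal.span {h} ≤ Module.annihilator R (CheckForms h k) := by
    rw [Ideal.span_singleton_le_iff_mem, Module.mem_annihilator]
    intro m
    obtain ⟨η, rfl⟩ := Submodule.Quotient.mk_surjective _ m
    rw [← Submodule.Quotient.mk_smul, Submodule.Quotient.mk_eq_zero, hLogForms_eq h0, mem_logForms]
    exact ⟨dWedge h η, by rw [← dWedgeHom_apply, map_smul, dWedgeHom_apply]⟩
  rw [Module.supportDim_eq_ringKrullDim_quotient_annihilator, ← S.ringKrullDim_eq,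
    ← ringKrullDim_quotient_span_singleton_succ_eq_ringKrullDim_of_mem_nonZeroDivisors
      (mem_nonZeroDivisors_of_ne_zero h0) hm]
  gcongr
  exact ringKrullDim_le_of_surjective (Ideal.Quotient.factor hann)
    (Ideal.Quotient.factor_surjective hann)

theorem le_moduleDepth_checkForms (S : RegularCoords n R) (h0 : h ≠ 0) (hm : h ∈ maximalIdeal R)
    (hrad : (Ideal.span {h}).IsRadical) (F : LogFrame S h) {k : ℕ} (hk : k + 1 ≤ n) :
    ((n - 1 : ℕ) : ℕ∞) ≤ moduleDepth R (CheckForms h k) := by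
  have := nontrivial_checkForms S h0 hm hrad hk
  obtain ⟨_, _⟩ := free_forms S k
  have hb := (F.logBasis h0 hrad k).map (LinearEquiv.ofEq _ _ (hLogForms_eq h0 k).symm)
  have := Module.Free.of_basis hb
  have := Module.Finite.of_basis hb
  have h1 := le_moduleDepth_of_resolution_one (M := CheckForms h k) (rs := List.ofFn S.x)
    S.isRegular_ofFn (fun r hr => by
      rw [← S.ofList_ofFn]
      exact Ideal.subset_span hr)
    (F₁ := hLogForms h k) (f := (hLogForms h k).subtype) (g := (hLogForms h k).mkQ)
    (Submodule.injective_subtype _)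
    (LinearMap.exact_subtype_mkQ _) (Submodule.mkQ_surjective _)
  simpa using h1

theorem isCohenMacaulay_checkForms (S : RegularCoords n R) (h0 : h ≠ 0) (hm : h ∈ maximalIdeal R)
    (hrad : (Ideal.span {h}).IsRadical) (F : LogFrame S h) {k : ℕ} (hk : k + 1 ≤ n) :
    Module.supportDim R (CheckForms h k) = ((n - 1 : ℕ) : WithBot ℕ∞) ∧
      IsCohenMacaulayModule R (CheckForms h k) := by
  have := nontrivial_checkForms S h0 hm hrad hk
  have := (free_forms S k).2
  have h1 : (((n - 1 : ℕ) : ℕ∞) : WithBot ℕ∞) ≤ moduleDepth R (CheckForms h k) :=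
    WithBot.coe_le_coe.mpr (le_moduleDepth_checkForms S h0 hm hrad F hk)
  have h2 := moduleDepth_le_supportDim (R := R) (CheckForms h k)
  have h3 := supportDim_checkForms_le S h0 hm k
  have h4 : Module.supportDim R (CheckForms h k) ≤ (((n - 1 : ℕ) : ℕ∞) : WithBot ℕ∞) := by
    obtain ⟨l, rfl⟩ : ∃ l, n = l + 1 := ⟨n - 1, by omega⟩
    rw [Nat.add_sub_cancel]
    push_cast at h3
    exact ENat.WithBot.add_le_add_one_right_iff.mp h3
  exact ⟨le_antisymm h4 (h1.trans h2), Or.inr (le_antisymm h2 (h4.trans h1))⟩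

/-- The Kähler forms surject onto Ω̌, which is nonzero of dimension exactly n - 1. -/
theorem supportDim_kahlerForms_ge (S : RegularCoords n R) (h0 : h ≠ 0) (hm : h ∈ maximalIdeal R)
    (hrad : (Ideal.span {h}).IsRadical) (F : LogFrame S h) {j : ℕ} (hj : j + 2 ≤ n) :
    Nontrivial (KahlerForms (Ideal.span {h}) (j + 1)) ∧ ((n - 1 : ℕ) : WithBot ℕ∞) ≤
      Module.supportDim R (KahlerForms (Ideal.span {h}) (j + 1)) := by
  have hle : kahlerRelations (Ideal.span {h}) (j + 1) ≤ hLogForms h (j + 1) := by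
    rw [hLogForms_eq h0, ← range_relationMap]
    exact range_relationMap_le_logForms j
  have hs := Submodule.factor_surjective hle
  have := nontrivial_checkForms S h0 hm hrad (k := j + 1) hj
  refine ⟨hs.nontrivial, ?_⟩
  rw [← (isCohenMacaulay_checkForms S h0 hm hrad F hj).1]
  exact Module.supportDim_le_of_surjective _ hs

/-- The kernel of `relationMap` is free on the logarithmic basis, giving a resolution of length two.
The test vector is the basis element indexed by a set `s` avoiding the vanishing field δ_{i₀} of an
adapted frame. -/
theorem moduleDepth_kahlerForms (S : RegularCoords n R) (h0 : h ≠ 0) (hm : h ∈ maximalIdeal R)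
    (hrad : (Ideal.span {h}).IsRadical) (hsing : ∀ X : VField R, X h ∈ maximalIdeal R)
    (F : LogFrame S h) {j : ℕ} (hj : j + 2 ≤ n) :
    moduleDepth R (KahlerForms (Ideal.span {h}) (j + 1)) = ((n - 2 : ℕ) : ℕ∞) := by
  obtain ⟨hnt, -⟩ := supportDim_kahlerForms_ge S h0 hm hrad F hj
  obtain ⟨G, i₀, hδ, ha⟩ := F.exists_adapted h0 hm hsing
  obtain ⟨s, hs⟩ := exists_orderEmbedding_avoiding (show j + 1 ≤ n by omega) i₀
  obtain ⟨_, _⟩ := free_forms S j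
  obtain ⟨_, _⟩ := free_forms S (j + 1)
  let e := kerRelationEquiv h0 j
  let B := (G.logBasis h0 hrad j).map e.symm
  have := Module.Free.of_basis B
  have := Module.Finite.of_basis B
  have hv : ∀ v : LinearMap.ker (relationMap R h j), (e v : Forms R j) =
      (v : Forms R (j + 1) × Forms R j).2 := fun _ => rfl
  have hex : Function.Exact (relationMap R h j)
      (kahlerRelations (Ideal.span {h}) (j + 1)).mkQ := fun x => by
    rw [Submodule.mkQ_apply, Submodule.Quotient.mk_eq_zero, ← range_relationMap]
    rfl
  have h1 := moduleDepth_of_resolution_two (M := KahlerForms (Ideal.span {h}) (j + 1))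
    (rs := List.ofFn S.x) S.isRegular_ofFn S.ofList_ofFn (by simpa using by omega)
    (f := (LinearMap.ker (relationMap R h j)).subtype) (g := relationMap R h j)
    (π := (kahlerRelations (Ideal.span {h}) (j + 1)).mkQ)
    (Submodule.injective_subtype _) (LinearMap.exact_subtype_ker_map _)
    hex
    (Submodule.mkQ_surjective _) (B s) (B.coord s) (by simp) ?_
  · simpa using h1
  · have e2 : ((B s : LinearMap.ker (relationMap R h j)) : Forms R (j + 1) × Forms R j).2 =
        detForm S.basis G.δ s := by
      rw [← hv, ← G.logBasis_apply h0 hrad]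
      simp [B]
    have e1 : ((B s : LinearMap.ker (relationMap R h j)) : Forms R (j + 1) × Forms R j).1 =
        -∑ s', G.wedgeCoeff s s' • detForm S.basis G.δ s' := by
      have h3 : h • ((B s : LinearMap.ker (relationMap R h j)) : Forms R (j + 1) × Forms R j).1 +
          dWedgeHom h j ((B s : LinearMap.ker (relationMap R h j)) :
            Forms R (j + 1) × Forms R j).2 = 0 := (B s).2
      rw [e2, dWedgeHom_apply, G.dWedge_detForm h0, ← smul_add] at h3
      have h4 : ((B s : LinearMap.ker (relationMap R h j)) : Forms R (j + 1) × Forms R j).1 +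
          ∑ s', G.wedgeCoeff s s' • detForm S.basis G.δ s' = 0 := by
        ext X
        exact (mul_eq_zero.mp (DFunLike.congr_fun h3 X)).resolve_left h0
      exact eq_neg_of_add_eq_zero_left h4
    have m2 : detForm S.basis G.δ s ∈ maximalIdeal R • (⊤ : Submodule R (Forms R j)) :=
      mem_smul_top_of_forall_apply_mem S fun X => detForm_mem S.basis G.δ hs hδ X
    have m1 : -∑ s', G.wedgeCoeff s s' • detForm S.basis G.δ s' ∈
        maximalIdeal R • (⊤ : Submodule R (Forms R (j + 1))) := by
      refine neg_mem (sum_mem fun s' _ => ?_)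
      -- If s' contains i₀, then s, which does not, arises from s' only by removing i₀, so the
      -- coefficient is a multiple of a_{i₀} ∈ 𝔪. If not, the form itself has its values in 𝔪,
      -- through the column δ_{i₀}.
      by_cases hs' : i₀ ∈ Set.range s'
      · refine Submodule.smul_mem_smul (sum_mem fun t _ => Ideal.mul_mem_left _ _ ?_) trivial
        split_ifs with ht
        · obtain ⟨t', rfl⟩ := hs'
          by_cases htt : t = t'
          · subst htt
            exact Ideal.mul_mem_right _ _ ha
          · obtain ⟨l, hl⟩ := Fin.exists_succAbove_eq (Ne.symm htt)
            refine absurd ⟨l, ?_⟩ hs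
            rw [← ht, ← hl]
            rfl
        · simp
      · exact Submodule.smul_mem _ _ (mem_smul_top_of_forall_apply_mem S fun X =>
          detForm_mem S.basis G.δ hs' hδ X)
    have hsplit : ((B s : LinearMap.ker (relationMap R h j)) : Forms R (j + 1) × Forms R j) =
        LinearMap.inl R _ _ (-∑ s', G.wedgeCoeff s s' • detForm S.basis G.δ s') +
          LinearMap.inr R _ _ (detForm S.basis G.δ s) := by
      rw [← e1, ← e2]
      simp
    rw [Submodule.subtype_apply, hsplit]
    refine add_mem ?_ ?_
    · have := Submodule.mem_map_of_mem (f := LinearMap.inl R (Forms R (j + 1)) (Forms R j)) m1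
      rw [Submodule.map_smul''] at this
      exact Submodule.smul_mono le_rfl le_top this
    · have := Submodule.mem_map_of_mem (f := LinearMap.inr R (Forms R (j + 1)) (Forms R j)) m2
      rw [Submodule.map_smul''] at this
      exact Submodule.smul_mono le_rfl le_top this

end FormModules

/-! ### Convergent power series -/

section ConvergentSeries

open scoped ENNReal

variable {n : ℕ}

/-- The number `∏ p_i ^ α_i`, where `p_i` is the `i`-th prime number. -/
noncomputable def primeWeight (α : Fin n →₀ ℕ) : ℕ := ∏ i : Fin n, Nat.nth Nat.Prime i ^ α i

theorem primeWeight_add (α β : Fin n →₀ ℕ) :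
    primeWeight (α + β) = primeWeight α * primeWeight β := by
  simp [primeWeight, pow_add, Finset.prod_mul_distrib]

theorem primeWeight_pos (α : Fin n →₀ ℕ) : 0 < primeWeight α :=
  Finset.prod_pos fun i _ => pow_pos (Nat.prime_nth_prime i).pos _

theorem factorization_primeWeight (α : Fin n →₀ ℕ) (i : Fin n) :
    (primeWeight α).factorization (Nat.nth Nat.Prime i) = α i := by
  rw [primeWeight, Nat.factorization_prod (g := fun j : Fin n => Nat.nth Nat.Prime j ^ α j)
    fun j _ => pow_ne_zero _ (Nat.prime_nth_prime j).ne_zero, Finsupp.finsetSum_apply,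
    Finset.sum_eq_single i (fun j _ hj => ?_) (by simp)]
  · simp
  · rw [Nat.factorization_pow, (Nat.prime_nth_prime j).factorization, Finsupp.smul_single,
      Finsupp.single_apply, if_neg]
    exact fun h => hj (Fin.ext (Nat.nth_injective Nat.infinite_setOfPred_prime h))

/-- Unique factorization makes the weight a monomial order: exponents are totally ordered by an
additive, integer-valued function, so nonzero series have a unique leading term. The same primes
give the radii p_i^(-s) of the polydiscs, so on small polydiscs this term dominates. -/
theorem primeWeight_injective : Function.Injective (primeWeight (n := n)) := by
  intro α β h
  ext i
  rw [← factorization_primeWeight α, h, factorization_primeWeight]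

theorem two_pow_degree_le_primeWeight (α : Fin n →₀ ℕ) : 2 ^ (∑ i, α i) ≤ primeWeight α := by
  rw [← Finset.prod_pow_eq_pow_sum]
  exact Finset.prod_le_prod' fun i _ => Nat.pow_le_pow_left (Nat.prime_nth_prime i).two_le _

/-- Lets the factor produced by differentiating a monomial be absorbed by raising `s` by one. -/
theorem le_primeWeight (α : Fin n →₀ ℕ) (i : Fin n) : α i ≤ primeWeight α :=
  (Finset.single_le_sum (f := fun i => α i) (fun _ _ => Nat.zero_le _) (Finset.mem_univ i)).trans
    (Nat.lt_two_pow_self.le.trans (two_pow_degree_le_primeWeight α))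

/-- The multiplicative weights `∏ p_i ^ (-s α_i)`. -/
noncomputable def serWeight (s : ℕ) (α : Fin n →₀ ℕ) : ℝ≥0∞ := ((primeWeight α : ℝ≥0∞)⁻¹) ^ s

theorem serWeight_add (s : ℕ) (α β : Fin n →₀ ℕ) :
    serWeight s (α + β) = serWeight s α * serWeight s β := by
  rw [serWeight, primeWeight_add, Nat.cast_mul, ENNReal.mul_inv (by simp) (by simp), mul_pow]
  rfl

theorem serWeight_ne_zero (s : ℕ) (α : Fin n →₀ ℕ) : serWeight s α ≠ 0 :=
  pow_ne_zero _ (ENNReal.inv_ne_zero.mpr (by simp))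

theorem serWeight_ne_top (s : ℕ) (α : Fin n →₀ ℕ) : serWeight s α ≠ ⊤ :=
  ENNReal.pow_ne_top (ENNReal.inv_ne_top.mpr (by simpa using (primeWeight_pos α).ne'))

theorem serWeight_le_one (s : ℕ) (α : Fin n →₀ ℕ) : serWeight s α ≤ 1 :=
  pow_le_one' (ENNReal.inv_le_one.mpr (by exact_mod_cast primeWeight_pos α)) s

theorem serWeight_exp_add (s t : ℕ) (α : Fin n →₀ ℕ) :
    serWeight (s + t) α = serWeight s α * serWeight t α := pow_add _ _ _

/-- The weighted `ℓ¹`-norm of a power series. -/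
noncomputable def serNorm (s : ℕ) (a : MvPowerSeries (Fin n) ℂ) : ℝ≥0∞ :=
  ∑' α, ‖MvPowerSeries.coeff α a‖ₑ * serWeight s α

theorem serNorm_antitone (a : MvPowerSeries (Fin n) ℂ) : Antitone fun s => serNorm s a := by
  intro s t hst
  refine ENNReal.tsum_le_tsum fun α => ?_
  obtain ⟨u, rfl⟩ := Nat.exists_eq_add_of_le hst
  rw [serWeight_exp_add]
  gcongr
  exact mul_le_of_le_one_right' (serWeight_le_one u α)

theorem coeff_le_serNorm (s : ℕ) (a : MvPowerSeries (Fin n) ℂ) (α : Fin n →₀ ℕ) :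
    ‖MvPowerSeries.coeff α a‖ₑ * serWeight s α ≤ serNorm s a := ENNReal.le_tsum α

theorem serNorm_zero (s : ℕ) : serNorm s (0 : MvPowerSeries (Fin n) ℂ) = 0 := by
  simp [serNorm]

theorem serNorm_add_le (s : ℕ) (a b : MvPowerSeries (Fin n) ℂ) :
    serNorm s (a + b) ≤ serNorm s a + serNorm s b := by
  rw [serNorm, serNorm, serNorm, ← ENNReal.tsum_add]
  refine ENNReal.tsum_le_tsum fun α => ?_
  rw [map_add, ← add_mul]
  gcongr
  exact enorm_add_le _ _

theorem serNorm_sum_le {ι : Type*} (t : Finset ι) (s : ℕ) (a : ι → MvPowerSeries (Fin n) ℂ) :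
    serNorm s (∑ i ∈ t, a i) ≤ ∑ i ∈ t, serNorm s (a i) := by
  classical
  induction t using Finset.induction_on with
  | empty => simp [serNorm_zero]
  | insert i t hi ih =>
    rw [Finset.sum_insert hi, Finset.sum_insert hi]
    exact (serNorm_add_le _ _ _).trans (by gcongr)

theorem serNorm_neg (s : ℕ) (a : MvPowerSeries (Fin n) ℂ) : serNorm s (-a) = serNorm s a := by
  simp [serNorm]

theorem serNorm_monomial (s : ℕ) (α : Fin n →₀ ℕ) (c : ℂ) :
    serNorm s (MvPowerSeries.monomial α c) = ‖c‖ₑ * serWeight s α := by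
  classical
  rw [serNorm, tsum_eq_single α fun β hβ => by rw [MvPowerSeries.coeff_monomial_ne hβ]; simp,
    MvPowerSeries.coeff_monomial_same]

theorem serNorm_mul_le (s : ℕ) (a b : MvPowerSeries (Fin n) ℂ) :
    serNorm s (a * b) ≤ serNorm s a * serNorm s b := by
  classical
  have h1 : serNorm s a * serNorm s b = ∑' p : (Fin n →₀ ℕ) × (Fin n →₀ ℕ),
      (‖MvPowerSeries.coeff p.1 a‖ₑ * serWeight s p.1) *
        (‖MvPowerSeries.coeff p.2 b‖ₑ * serWeight s p.2) := by
    rw [ENNReal.tsum_prod', serNorm, ← ENNReal.tsum_mul_right]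
    exact tsum_congr fun α => ENNReal.tsum_mul_left.symm
  rw [h1, ← Finset.HasAntidiagonal.sigmaAntidiagonalEquivProd.tsum_eq, ENNReal.tsum_sigma']
  refine ENNReal.tsum_le_tsum fun γ => ?_
  rw [tsum_fintype, MvPowerSeries.coeff_mul]
  refine (mul_le_mul_left (enorm_sum_le _ _) _).trans ?_
  rw [Finset.sum_mul, ← Finset.sum_coe_sort]
  refine Finset.sum_le_sum fun p _ => ?_
  have hp : p.1.1 + p.1.2 = γ := Finset.HasAntidiagonal.mem_antidiagonal.mp p.2
  have hw : serWeight s γ = serWeight s p.1.1 * serWeight s p.1.2 :=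
    (congrArg (serWeight s) hp).symm.trans (serWeight_add s _ _)
  rw [Finset.HasAntidiagonal.sigmaAntidiagonalEquivProd_apply, hw, enorm_mul]
  exact le_of_eq (by ring)

variable (n) in
/-- The algebra of convergent power series. -/
noncomputable def ConvSeries : Subalgebra ℂ (MvPowerSeries (Fin n) ℂ) where
  carrier := {a | ∃ s, serNorm s a ≠ ⊤}
  mul_mem' := by
    rintro a b ⟨s, hs⟩ ⟨t, ht⟩
    refine ⟨max s t, ne_top_of_le_ne_top (ENNReal.mul_ne_top ?_ ?_) (serNorm_mul_le _ a b)⟩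
    · exact ne_top_of_le_ne_top hs (serNorm_antitone a (le_max_left s t))
    · exact ne_top_of_le_ne_top ht (serNorm_antitone b (le_max_right s t))
  add_mem' := by
    rintro a b ⟨s, hs⟩ ⟨t, ht⟩
    refine ⟨max s t, ne_top_of_le_ne_top (ENNReal.add_ne_top.mpr ⟨?_, ?_⟩) (serNorm_add_le _ a b)⟩
    · exact ne_top_of_le_ne_top hs (serNorm_antitone a (le_max_left s t))
    · exact ne_top_of_le_ne_top ht (serNorm_antitone b (le_max_right s t))
  algebraMap_mem' c := by
    refine ⟨0, ?_⟩
    have : algebraMap ℂ (MvPowerSeries (Fin n) ℂ) c = MvPowerSeries.monomial 0 c := rfl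
    rw [this, serNorm_monomial]
    exact ENNReal.mul_ne_top enorm_ne_top (serWeight_ne_top _ _)

/-- The exponent `e` belongs to the leading term of `a`, that is, to the term with minimal
weight. -/
def IsLeadExp (a : MvPowerSeries (Fin n) ℂ) (e : Fin n →₀ ℕ) : Prop :=
  MvPowerSeries.coeff e a ≠ 0 ∧
    ∀ α, MvPowerSeries.coeff α a ≠ 0 → primeWeight e ≤ primeWeight α

theorem exists_isLeadExp {a : MvPowerSeries (Fin n) ℂ} (ha : a ≠ 0) : ∃ e, IsLeadExp a e := by
  have hne : {α | MvPowerSeries.coeff α a ≠ 0}.Nonempty := by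
    by_contra h
    rw [Set.not_nonempty_iff_eq_empty] at h
    refine ha (MvPowerSeries.ext fun α => ?_)
    by_contra h'
    exact (Set.eq_empty_iff_forall_notMem.mp h α) h'
  obtain ⟨e, he, hmin⟩ := WellFounded.has_min (measure (primeWeight (n := n))).wf _ hne
  exact ⟨e, he, fun α hα => not_lt.mp (hmin α hα)⟩

/-- On small polydiscs a convergent power series is dominated by its leading term. -/
theorem IsLeadExp.exists_serNorm_le {a : MvPowerSeries (Fin n) ℂ} {e : Fin n →₀ ℕ}
    (h : IsLeadExp a e) (ha : a ∈ ConvSeries n) : ∃ s₀, ∀ s ≥ s₀,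
      serNorm s (a - MvPowerSeries.monomial e (MvPowerSeries.coeff e a)) ≤
        2⁻¹ * (‖MvPowerSeries.coeff e a‖ₑ * serWeight s e) := by
  classical
  obtain ⟨s₁, hs₁⟩ := ha
  set c := MvPowerSeries.coeff e a
  set b := a - MvPowerSeries.monomial e c with hb
  have hbs : serNorm s₁ b ≠ ⊤ := by
    rw [hb, sub_eq_add_neg]
    refine ne_top_of_le_ne_top (ENNReal.add_ne_top.mpr ⟨hs₁, ?_⟩) (serNorm_add_le _ _ _)
    rw [serNorm_neg, serNorm_monomial]
    exact ENNReal.mul_ne_top enorm_ne_top (serWeight_ne_top _ _)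
  have hsupp : ∀ α, MvPowerSeries.coeff α b ≠ 0 → primeWeight e + 1 ≤ primeWeight α := by
    intro α hα
    have hne : α ≠ e := by
      rintro rfl
      exact hα (by rw [hb, map_sub, MvPowerSeries.coeff_monomial_same, sub_self])
    rw [hb, map_sub, MvPowerSeries.coeff_monomial_ne hne, sub_zero] at hα
    exact lt_of_le_of_ne (h.2 α hα) fun h' => hne (primeWeight_injective h').symm
  -- Raising `s` by one multiplies the leading weight by 1/w, w = `primeWeight e`, and every other
  -- term by at most 1/(w + 1); their ratio gains the factor q = w/(w + 1) < 1.
  set q : ℝ≥0∞ := ((primeWeight e + 1 : ℕ) : ℝ≥0∞)⁻¹ * (primeWeight e : ℝ≥0∞) with hq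
  have hpe : (primeWeight e : ℝ≥0∞) ≠ 0 := by simpa using (primeWeight_pos e).ne'
  have hq1 : q < 1 := by
    rw [hq, ← ENNReal.div_eq_inv_mul]
    refine ENNReal.div_lt_of_lt_mul ?_
    rw [one_mul]
    exact_mod_cast Nat.lt_succ_self _
  have hpos : 2⁻¹ * (‖c‖ₑ * serWeight s₁ e) ≠ 0 := by
    simp [h.1, c, serWeight_ne_zero]
  have hlim : Tendsto (fun t : ℕ => serNorm s₁ b * q ^ t) atTop (𝓝 0) := by
    have := ENNReal.Tendsto.const_mul (ENNReal.tendsto_pow_atTop_nhds_zero_of_lt_one hq1)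
      (Or.inr hbs)
    simpa using this
  obtain ⟨t₀, ht₀⟩ := eventually_atTop.mp
    (hlim.eventually (eventually_le_nhds (pos_iff_ne_zero.mpr hpos)))
  refine ⟨s₁ + t₀, fun s hs => ?_⟩
  obtain ⟨t, rfl⟩ : ∃ t, s = s₁ + t := ⟨s - s₁, by omega⟩
  have h1 : serNorm (s₁ + t) b ≤ serNorm s₁ b * ((primeWeight e + 1 : ℕ) : ℝ≥0∞)⁻¹ ^ t := by
    rw [serNorm, serNorm, ← ENNReal.tsum_mul_right]
    refine ENNReal.tsum_le_tsum fun α => ?_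
    by_cases hα : MvPowerSeries.coeff α b = 0
    · simp [hα]
    · rw [serWeight_exp_add, ← mul_assoc]
      refine mul_le_mul_right (pow_le_pow_left' (ENNReal.inv_le_inv.mpr ?_) t) _
      exact_mod_cast hsupp α hα
  have h2 : serNorm s₁ b * ((primeWeight e + 1 : ℕ) : ℝ≥0∞)⁻¹ ^ t =
      serNorm s₁ b * q ^ t * serWeight t e := by
    rw [hq, mul_pow, serWeight, mul_assoc, mul_assoc, ← mul_pow (primeWeight e : ℝ≥0∞),
      ENNReal.mul_inv_cancel hpe (by simp), one_pow, mul_one]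
  rw [h2] at h1
  refine h1.trans ?_
  rw [serWeight_exp_add, ← mul_assoc, ← mul_assoc, mul_assoc 2⁻¹]
  exact mul_le_mul_left (ht₀ t (by omega)) _

end ConvergentSeries

/-! ### Division of convergent power series -/

section Division

open scoped ENNReal
open MvPowerSeries

variable {n : ℕ}

/-- Absolutely convergent series converge. -/
theorem exists_serNorm_sub_sum_le (s : ℕ) (a : ℕ → MvPowerSeries (Fin n) ℂ)
    (ha : ∑' m, serNorm s (a m) ≠ ⊤) :
    ∃ u, ∀ N, serNorm s (u - ∑ m ∈ Finset.range N, a m) ≤ ∑' m, serNorm s (a (m + N)) := by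
  have hsum : ∀ α, Summable fun m => coeff α (a m) := by
    intro α
    refine Summable.of_enorm (ne_top_of_le_ne_top ?_ (?_ : _ ≤
      (∑' m, serNorm s (a m)) * (serWeight s α)⁻¹))
    · exact ENNReal.mul_ne_top ha (ENNReal.inv_ne_top.mpr (serWeight_ne_zero s α))
    · rw [← ENNReal.tsum_mul_right]
      refine ENNReal.tsum_le_tsum fun m => ?_
      rw [← div_eq_mul_inv, ENNReal.le_div_iff_mul_le (Or.inl (serWeight_ne_zero s α))
        (Or.inl (serWeight_ne_top s α))]
      exact coeff_le_serNorm s (a m) α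
  let u : MvPowerSeries (Fin n) ℂ := fun α => ∑' m, coeff α (a m)
  refine ⟨u, fun N => ?_⟩
  simp_rw [serNorm]
  rw [ENNReal.tsum_comm]
  refine ENNReal.tsum_le_tsum fun α => ?_
  rw [ENNReal.tsum_mul_right]
  gcongr
  have : coeff α (u - ∑ m ∈ Finset.range N, a m) =
      ∑' m, coeff α (a (m + N)) := by
    rw [map_sub, map_sum, sub_eq_iff_eq_add', (hsum α).sum_add_tsum_nat_add N]
    rfl
  rw [this]
  exact enorm_tsum_le_tsum_enorm

theorem eq_zero_of_serNorm_eq_zero {s : ℕ} {a : MvPowerSeries (Fin n) ℂ} (h : serNorm s a = 0) :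
    a = 0 := by
  ext α
  have := ENNReal.tsum_eq_zero.mp h α
  simpa [serWeight_ne_zero] using this

/-- Contractions have fixed points. -/
theorem exists_sub_map_eq_of_contraction (s : ℕ)
    (T : MvPowerSeries (Fin n) ℂ →ₗ[ℂ] MvPowerSeries (Fin n) ℂ)
    (hT : ∀ b, serNorm s (T b) ≤ 2⁻¹ * serNorm s b) {g : MvPowerSeries (Fin n) ℂ}
    (hg : serNorm s g ≠ ⊤) : ∃ u, u - T u = g ∧ serNorm s u ≠ ⊤ := by
  have hpow : ∀ m, serNorm s ((T ^ m) g) ≤ 2⁻¹ ^ m * serNorm s g := by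
    intro m
    induction m with
    | zero => simp
    | succ m ih =>
      rw [pow_succ' T, Module.End.mul_apply, pow_succ', mul_assoc]
      exact (hT _).trans (by gcongr)
  have htail : ∀ N, ∑' m, serNorm s ((T ^ (m + N)) g) ≤ 2⁻¹ ^ N * (2 * serNorm s g) := by
    intro N
    calc ∑' m, serNorm s ((T ^ (m + N)) g) ≤ ∑' m, 2⁻¹ ^ m * (2⁻¹ ^ N * serNorm s g) :=
          ENNReal.tsum_le_tsum fun m => (hpow _).trans_eq (by rw [pow_add, mul_assoc])
      _ = 2⁻¹ ^ N * (2 * serNorm s g) := by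
          rw [ENNReal.tsum_mul_right, ENNReal.tsum_geometric, ENNReal.one_sub_inv_two, inv_inv]
          ring
  have h0 := htail 0
  rw [pow_zero, one_mul] at h0
  have hfin : 2 * serNorm s g ≠ ⊤ := ENNReal.mul_ne_top (by simp) hg
  obtain ⟨u, hu⟩ := exists_serNorm_sub_sum_le s (fun m => (T ^ m) g)
    (ne_top_of_le_ne_top hfin h0)
  refine ⟨u, ?_, ?_⟩
  · rw [← sub_eq_zero]
    refine eq_zero_of_serNorm_eq_zero (s := s) (le_antisymm ?_ bot_le)
    -- With v the tail of the Neumann series u = ∑ T^m g, the error is v - T v - T^N g, whence 5 = 2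
    -- + 2 + 1.
    have hN : ∀ N, serNorm s (u - T u - g) ≤ 2⁻¹ ^ N * (5 * serNorm s g) := by
      intro N
      set v := u - ∑ m ∈ Finset.range N, (T ^ m) g with hv
      have hvN : serNorm s v ≤ 2⁻¹ ^ N * (2 * serNorm s g) := (hu N).trans (htail N)
      have hdec : u - T u - g = v + -T v + -(T ^ N) g := by
        have h1 : T (∑ m ∈ Finset.range N, (T ^ m) g) + g =
            ∑ m ∈ Finset.range N, (T ^ m) g + (T ^ N) g := by
          rw [← Finset.sum_range_succ, Finset.sum_range_succ', map_sum]
          simp [pow_succ']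
        have h2 : T v = T u - T (∑ m ∈ Finset.range N, (T ^ m) g) := map_sub _ _ _
        rw [h2, hv, eq_sub_of_add_eq h1]
        abel
      calc serNorm s (u - T u - g) ≤ serNorm s v + serNorm s v + 2⁻¹ ^ N * serNorm s g := by
            rw [hdec]
            refine (serNorm_add_le _ _ _).trans (add_le_add ((serNorm_add_le _ _ _).trans
              (add_le_add le_rfl ?_)) ?_)
            · rw [serNorm_neg]
              exact (hT v).trans (mul_le_of_le_one_left' (by simp))
            · rw [serNorm_neg]
              exact hpow N
        _ ≤ 2⁻¹ ^ N * (2 * serNorm s g) + 2⁻¹ ^ N * (2 * serNorm s g) +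
              2⁻¹ ^ N * serNorm s g := by gcongr
        _ = 2⁻¹ ^ N * (5 * serNorm s g) := by ring
    have hlim : Tendsto (fun N : ℕ => (2⁻¹ : ℝ≥0∞) ^ N * (5 * serNorm s g)) atTop (𝓝 0) := by
      have := ENNReal.Tendsto.mul_const (b := 5 * serNorm s g)
        (ENNReal.tendsto_pow_atTop_nhds_zero_of_lt_one (r := 2⁻¹) (by simp))
        (Or.inr (ENNReal.mul_ne_top (by simp) hg))
      simpa using this
    exact ge_of_tendsto' hlim hN
  · have := (hu 0).trans h0
    rw [Finset.sum_range_zero, sub_zero] at this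
    exact ne_top_of_le_ne_top hfin this

/-- The quotient by `X ^ e` of the part of a power series with exponents in `S`. -/
noncomputable def divMonomialOn (S : Set (Fin n →₀ ℕ)) (e : Fin n →₀ ℕ) :
    MvPowerSeries (Fin n) ℂ →ₗ[ℂ] MvPowerSeries (Fin n) ℂ where
  toFun g β := S.indicator (fun α => coeff α g) (β + e)
  map_add' g g' := by
    ext β
    change S.indicator (fun α => coeff α (g + g')) (β + e) =
      S.indicator (fun α => coeff α g) (β + e) + S.indicator (fun α => coeff α g') (β + e)
    by_cases h : β + e ∈ S <;> simp [h]
  map_smul' c g := by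
    ext β
    change S.indicator (fun α => coeff α (c • g)) (β + e) =
      c • S.indicator (fun α => coeff α g) (β + e)
    by_cases h : β + e ∈ S <;> simp [h]

theorem coeff_divMonomialOn (S : Set (Fin n →₀ ℕ)) (e β : Fin n →₀ ℕ)
    (g : MvPowerSeries (Fin n) ℂ) :
    coeff β (divMonomialOn S e g) = S.indicator (fun α => coeff α g) (β + e) := rfl

theorem serWeight_mul_serNorm_divMonomialOn_le (s : ℕ) (S : Set (Fin n →₀ ℕ)) (e : Fin n →₀ ℕ)
    (g : MvPowerSeries (Fin n) ℂ) : serWeight s e * serNorm s (divMonomialOn S e g) ≤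
      ∑' α, S.indicator (fun α => ‖coeff α g‖ₑ * serWeight s α) α := by
  rw [serNorm, ← ENNReal.tsum_mul_left]
  refine le_trans (le_of_eq (tsum_congr fun β => ?_)) (ENNReal.tsum_comp_le_tsum_of_injective
    (add_left_injective e) (S.indicator fun α => ‖coeff α g‖ₑ * serWeight s α))
  rw [coeff_divMonomialOn]
  by_cases h : β + e ∈ S
  · rw [Set.indicator_of_mem h, Set.indicator_of_mem h, serWeight_add]
    ring
  · rw [Set.indicator_of_notMem h, Set.indicator_of_notMem h]
    simp

theorem coeff_monomial_mul_divMonomialOn {S : Set (Fin n →₀ ℕ)} {e : Fin n →₀ ℕ}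
    (hS : ∀ α ∈ S, e ≤ α) (α : Fin n →₀ ℕ) (g : MvPowerSeries (Fin n) ℂ) :
    coeff α (divMonomialOn S e g * monomial e 1) = S.indicator (fun α => coeff α g) α := by
  classical
  rw [coeff_mul_monomial, mul_one]
  split_ifs with h
  · rw [coeff_divMonomialOn, tsub_add_cancel_of_le h]
  · rw [Set.indicator_of_notMem fun h' => h (hS α h')]

/-- Simultaneous division by power series which are dominated by monomials. -/
theorem exists_division {ι : Type*} [Fintype ι] (s : ℕ) (f : ι → MvPowerSeries (Fin n) ℂ)
    (e : ι → Fin n →₀ ℕ)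
    (hf : ∀ i, serNorm s (f i - monomial (e i) 1) ≤ 2⁻¹ * serWeight s (e i))
    {g : MvPowerSeries (Fin n) ℂ} (hg : serNorm s g ≠ ⊤) :
    ∃ (q : ι → MvPowerSeries (Fin n) ℂ) (r : MvPowerSeries (Fin n) ℂ),
      g = ∑ i, q i * f i + r ∧ (∀ i, serNorm s (q i) ≠ ⊤) ∧
      ∀ α, coeff α r ≠ 0 → ∀ i, ¬ e i ≤ α := by
  classical
  -- Each divisible exponent is assigned to a single divisor, so that the partial quotients do not
  -- overlap and their norms add up.
  have hidx : ∀ α, ∃ o : Option ι, (∀ i, o = some i → e i ≤ α) ∧ (o = none → ∀ i, ¬ e i ≤ α) := by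
    intro α
    by_cases h : ∃ i, e i ≤ α
    · exact ⟨some h.choose, by simpa using h.choose_spec, by simp⟩
    · exact ⟨none, by simp, by simpa using h⟩
  choose idx hidx1 hidx2 using hidx
  set S : ι → Set (Fin n →₀ ℕ) := fun i => {α | idx α = some i} with hS
  set Q : ι → MvPowerSeries (Fin n) ℂ →ₗ[ℂ] MvPowerSeries (Fin n) ℂ :=
    fun i => divMonomialOn (S i) (e i) with hQ
  have hQsum : ∀ b, ∑ i, serWeight s (e i) * serNorm s (Q i b) ≤ serNorm s b := by
    intro b
    calc ∑ i, serWeight s (e i) * serNorm s (Q i b)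
        ≤ ∑ i, ∑' α, (S i).indicator (fun α => ‖coeff α b‖ₑ * serWeight s α) α :=
          Finset.sum_le_sum fun i _ => serWeight_mul_serNorm_divMonomialOn_le s _ _ b
      _ = ∑' α, ∑ i, (S i).indicator (fun α => ‖coeff α b‖ₑ * serWeight s α) α :=
          (Summable.tsum_finsetSum fun i _ => ENNReal.summable).symm
      _ ≤ serNorm s b := by
          refine ENNReal.tsum_le_tsum fun α => ?_
          rcases h : idx α with _ | i
          · rw [Finset.sum_eq_zero]
            · exact bot_le
            · intro i _
              exact Set.indicator_of_notMem (by simp [hS, h]) _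
          · rw [Finset.sum_eq_single i (fun j _ hj => Set.indicator_of_notMem
              (by simpa [hS, h] using hj.symm) _) (by simp)]
            exact Set.indicator_le_self' (fun _ _ => bot_le) α
  -- Division by the monomials is exact; `T` is the error of using `f i` instead, a contraction by
  -- `hf`. If u - T u = g, then g = ∑ Q_i(u) f_i + (u - ∑ Q_i(u) X^{e_i}), and the bracket is the
  -- part of u with unassigned exponents.
  set T : MvPowerSeries (Fin n) ℂ →ₗ[ℂ] MvPowerSeries (Fin n) ℂ :=
    ∑ i, LinearMap.mulRight ℂ (monomial (e i) 1 - f i) ∘ₗ Q i with hTdef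
  have hTapp : ∀ b, T b = ∑ i, Q i b * (monomial (e i) 1 - f i) := fun b => by simp [hTdef]
  have hT : ∀ b, serNorm s (T b) ≤ 2⁻¹ * serNorm s b := by
    intro b
    rw [hTapp]
    refine (serNorm_sum_le _ _ _).trans ?_
    refine le_trans ?_ (mul_le_mul_right (hQsum b) _)
    rw [Finset.mul_sum]
    refine Finset.sum_le_sum fun i _ => (serNorm_mul_le _ _ _).trans ?_
    rw [← serNorm_neg s (_ - f i), neg_sub, ← mul_assoc, mul_comm]
    gcongr
    exact hf i
  obtain ⟨u, hu, hus⟩ := exists_sub_map_eq_of_contraction s T hT hg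
  refine ⟨fun i => Q i u, u - ∑ i, Q i u * monomial (e i) 1, ?_, fun i h => ?_, fun α hα i hi => ?_⟩
  · rw [← hu, hTapp]
    simp only [mul_sub, Finset.sum_sub_distrib]
    ring
  · have h1 : serWeight s (e i) * serNorm s (Q i u) ≤ serNorm s u :=
      (Finset.single_le_sum (f := fun i => serWeight s (e i) * serNorm s (Q i u))
        (fun _ _ => bot_le) (Finset.mem_univ i)).trans (hQsum u)
    rw [h, ENNReal.mul_top (serWeight_ne_zero s _)] at h1
    exact hus (top_le_iff.mp h1)
  · refine hα ?_
    have hco : ∀ i, coeff α (Q i u * monomial (e i) 1) =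
        (S i).indicator (fun α => coeff α u) α := fun i =>
      coeff_monomial_mul_divMonomialOn (fun α hα => hidx1 α i hα) α u
    rw [map_sub, map_sum, Finset.sum_congr rfl fun i _ => hco i]
    rcases h : idx α with _ | j
    · exact absurd hi (hidx2 α h i)
    · rw [Finset.sum_eq_single j (fun k _ hk => Set.indicator_of_notMem
        (by simpa [hS, h] using hk.symm) _) (by simp), Set.indicator_of_mem (by simp [hS, h]),
        sub_self]

end Division

/-! ### The ring of convergent power series: noetherianity, coordinates, derivatives -/

section ConvergentSeriesRing

open scoped ENNReal
open MvPowerSeries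

variable {n : ℕ}

theorem monomial_mem_convSeries (e : Fin n →₀ ℕ) (c : ℂ) : monomial e c ∈ ConvSeries n :=
  ⟨0, by
    rw [serNorm_monomial]
    exact ENNReal.mul_ne_top enorm_ne_top (serWeight_ne_top _ _)⟩

instance isNoetherianRing_convSeries : IsNoetherianRing (ConvSeries n) := by
  classical
  refine isNoetherianRing_iff_ideal_fg _ |>.mpr fun I => ?_
  set E : Set (Fin n →₀ ℕ) := {e | ∃ a ∈ I, IsLeadExp (a : MvPowerSeries (Fin n) ℂ) e} with hE
  set M : Set (Fin n →₀ ℕ) := {e | Minimal (· ∈ E) e} with hM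
  -- Dickson's lemma. Series in `I` with these leading exponents form a standard basis, which
  -- generates `I`.
  have hMfin : M.Finite := WellQuasiOrderedLE.finite_of_isAntichain (setOfPred_minimal_antichain _)
  have : Fintype M := hMfin.fintype
  have hlead : ∀ e : M, ∃ a ∈ I, IsLeadExp (a : MvPowerSeries (Fin n) ℂ) e ∧
      coeff (e : Fin n →₀ ℕ) (a : MvPowerSeries (Fin n) ℂ) = 1 := by
    rintro ⟨e, he⟩
    obtain ⟨a, ha, hae⟩ := he.prop
    have hc := hae.1
    refine ⟨(coeff e (a : MvPowerSeries (Fin n) ℂ))⁻¹ • a, Submodule.smul_of_tower_mem I _ ha,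
      ⟨?_, fun α hα => hae.2 α fun h => hα ?_⟩, ?_⟩
    · simp [hc]
    · simp [h]
    · simp [hc]
  choose f hfI hflead hf1 using hlead
  refine ⟨Finset.univ.image f, le_antisymm (Ideal.span_le.mpr ?_) fun g hg => ?_⟩
  · intro a ha
    simp only [Finset.coe_image, Finset.coe_univ, Set.image_univ, Set.mem_range] at ha
    obtain ⟨e, rfl⟩ := ha
    exact hfI e
  · obtain ⟨s₁, hs₁⟩ := g.2
    choose s₀ hs₀ using fun e => (hflead e).exists_serNorm_le (f e).2
    set s := s₁ ⊔ Finset.univ.sup s₀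
    have hs : ∀ e, s₀ e ≤ s := fun e => (Finset.le_sup (Finset.mem_univ e)).trans le_sup_right
    obtain ⟨q, r, hqr, hq, hr⟩ := exists_division s (fun e => (f e : MvPowerSeries (Fin n) ℂ))
      (fun e : M => (e : Fin n →₀ ℕ)) (fun e => by simpa [hf1] using hs₀ e s (hs e))
      (ne_top_of_le_ne_top hs₁ (serNorm_antitone _ le_sup_left))
    have hsum : (∑ e, (⟨q e, s, hq e⟩ : ConvSeries n) * f e) ∈
        Ideal.span (Finset.univ.image f : Set (ConvSeries n)) :=
      sum_mem fun e _ => Ideal.mul_mem_left _ _ (Ideal.subset_span (by simp))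
    have hle : Ideal.span (Finset.univ.image f : Set (ConvSeries n)) ≤ I := by
      refine Ideal.span_le.mpr fun a ha => ?_
      simp only [Finset.coe_image, Finset.coe_univ, Set.image_univ, Set.mem_range] at ha
      obtain ⟨e, rfl⟩ := ha
      exact hfI e
    set r' : ConvSeries n := g - ∑ e, (⟨q e, s, hq e⟩ : ConvSeries n) * f e with hr'
    have hr'r : (r' : MvPowerSeries (Fin n) ℂ) = r := by
      rw [hr']
      push_cast
      rw [hqr]
      simp
    -- A nonzero remainder would lie in `I`, so its leading exponent would be at least some minimal
    -- one, contrary to the division.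
    have hr0 : r' = 0 := by
      by_contra h0
      obtain ⟨e, he⟩ := exists_isLeadExp (a := (r' : MvPowerSeries (Fin n) ℂ)) (by simpa using h0)
      have heE : e ∈ E := ⟨r', I.sub_mem hg (hle hsum), he⟩
      obtain ⟨m, hme, hm⟩ := exists_minimal_le_of_wellFoundedLT (· ∈ E) e heE
      exact hr e (hr'r ▸ he.1) ⟨m, hm⟩ hme
    rw [hr', sub_eq_zero] at hr0
    rw [hr0]
    exact hsum

variable (n) in
/-- The coordinates, as convergent power series. -/
noncomputable def convX (i : Fin n) : ConvSeries n :=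
  ⟨X i, monomial_mem_convSeries _ _⟩

/-- Dividing by the coordinates leaves a constant remainder. -/
theorem mem_span_convX {a : ConvSeries n}
    (ha : constantCoeff (a : MvPowerSeries (Fin n) ℂ) = 0) :
    a ∈ Ideal.span (Set.range (convX n)) := by
  classical
  obtain ⟨s, hs⟩ := a.2
  obtain ⟨q, r, hqr, hq, hr⟩ := exists_division s (fun i : Fin n => X i)
    (fun i => Finsupp.single i 1) (fun i => by simp [X, serNorm_zero]) hs
  have hr0 : r = 0 := by
    ext α
    by_contra hα
    have h0 : α = 0 := by
      ext i
      by_contra hi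
      exact hr α hα i (Finsupp.single_le_iff.mpr (Nat.one_le_iff_ne_zero.mpr hi))
    apply hα
    rw [h0, coeff_zero_eq_constantCoeff_apply]
    have := congrArg constantCoeff hqr
    rw [ha] at this
    simpa using this.symm
  have : a = ∑ i, (⟨q i, s, hq i⟩ : ConvSeries n) * convX n i := by
    apply Subtype.ext
    rw [hqr, hr0]
    push_cast
    simp [convX]
  rw [this]
  exact sum_mem fun i _ => Ideal.mul_mem_left _ _ (Ideal.subset_span ⟨i, rfl⟩)

theorem pderiv_mem_convSeries (i : Fin n) {a : MvPowerSeries (Fin n) ℂ} (ha : a ∈ ConvSeries n) :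
    pderiv ℂ i a ∈ ConvSeries n := by
  obtain ⟨s, hs⟩ := ha
  refine ⟨s + 1, ?_⟩
  set e : Fin n →₀ ℕ := Finsupp.single i 1
  have hfin : (serWeight (s + 1) e)⁻¹ * serNorm s a ≠ ⊤ :=
    ENNReal.mul_ne_top (ENNReal.inv_ne_top.mpr (serWeight_ne_zero _ _)) hs
  refine ne_top_of_le_ne_top hfin ?_
  rw [← ENNReal.div_eq_inv_mul, ENNReal.le_div_iff_mul_le (Or.inl (serWeight_ne_zero _ _))
    (Or.inl (serWeight_ne_top _ _)), serNorm, ← ENNReal.tsum_mul_right]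
  refine le_trans (ENNReal.tsum_le_tsum fun β => ?_) (ENNReal.tsum_comp_le_tsum_of_injective
    (add_left_injective e) fun α => ‖coeff α a‖ₑ * serWeight s α)
  rw [mul_assoc, ← serWeight_add, coeff_pderiv, enorm_mul, mul_assoc, serWeight_exp_add]
  refine mul_le_mul_right ?_ _
  have h1 : ‖((β i : ℂ) + 1)‖ₑ ≤ (primeWeight (β + e) : ℝ≥0∞) := by
    have h2 : ((β i : ℂ) + 1) = ((β + e) i : ℕ) := by simp [e]
    rw [h2, ← ofReal_norm, Complex.norm_natCast, ENNReal.ofReal_natCast]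
    exact_mod_cast le_primeWeight _ _
  calc ‖((β i : ℂ) + 1)‖ₑ * (serWeight s (β + e) * serWeight 1 (β + e))
      ≤ primeWeight (β + e) * (serWeight s (β + e) * serWeight 1 (β + e)) := by gcongr
    _ = serWeight s (β + e) * (primeWeight (β + e) * (primeWeight (β + e) : ℝ≥0∞)⁻¹) := by
        rw [serWeight, serWeight, pow_one]; ring
    _ ≤ serWeight s (β + e) := by
        rw [ENNReal.mul_inv_cancel (by simpa using (primeWeight_pos (β + e)).ne') (by simp),
          mul_one]

/-- Partial derivatives of convergent power series. -/
noncomputable def convPderiv (i : Fin n) : Derivation ℂ (ConvSeries n) (ConvSeries n) where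
  toFun a := ⟨pderiv ℂ i (a : MvPowerSeries (Fin n) ℂ), pderiv_mem_convSeries i a.2⟩
  map_add' a b := Subtype.ext (by simp)
  map_smul' c a := Subtype.ext (by simp)
  map_one_eq_zero' := Subtype.ext (by simp)
  leibniz' a b := Subtype.ext (by simp)

theorem convPderiv_convX (i j : Fin n) :
    convPderiv i (convX n j) = if i = j then 1 else 0 := by
  apply Subtype.ext
  rw [convPderiv, convX]
  split_ifs with h
  · subst h; simp
  · simp [pderiv_X_of_ne (R := ℂ) (fun h' => h h'.symm)]

end ConvergentSeriesRing

/-! ### Evaluation of convergent power series -/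

section Evaluation

open scoped ENNReal
open MvPowerSeries

variable {n : ℕ}

/-- The value of a monomial at a point. -/
noncomputable def monomialEval (y : CSpace n) (α : Fin n →₀ ℕ) : ℂ := ∏ i, y i ^ α i

theorem monomialEval_zero (y : CSpace n) : monomialEval y 0 = 1 := by simp [monomialEval]

theorem monomialEval_add (y : CSpace n) (α β : Fin n →₀ ℕ) :
    monomialEval y (α + β) = monomialEval y α * monomialEval y β := by
  simp [monomialEval, pow_add, Finset.prod_mul_distrib]

theorem monomialEval_single (y : CSpace n) (i : Fin n) :
    monomialEval y (Finsupp.single i 1) = y i := by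
  classical
  rw [monomialEval, Finset.prod_eq_single i (fun j _ hj => by simp [hj.symm])
    (by simp)]
  simp

theorem monomialEval_sum {ι : Type*} (t : Finset ι) (y : CSpace n) (f : ι → Fin n →₀ ℕ) :
    monomialEval y (∑ i ∈ t, f i) = ∏ i ∈ t, monomialEval y (f i) := by
  classical
  induction t using Finset.induction_on with
  | empty => simp [monomialEval_zero]
  | insert i t hi ih => rw [Finset.sum_insert hi, Finset.prod_insert hi, monomialEval_add, ih]

variable (n) in
/-- The closed polydisc with radii `p_i ^ (-s)`. -/
def primePolydisc (s : ℕ) : Set (CSpace n) :=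
  {y | ∀ i, ‖y i‖ₑ ≤ ((Nat.nth Nat.Prime i : ℝ≥0∞)⁻¹) ^ s}

theorem serWeight_eq_prod (s : ℕ) (α : Fin n →₀ ℕ) :
    serWeight s α = ∏ i : Fin n, (((Nat.nth Nat.Prime i : ℝ≥0∞)⁻¹) ^ s) ^ α i := by
  rw [serWeight, primeWeight, Nat.cast_prod, ENNReal.prod_inv_distrib, ← Finset.prod_pow]
  · refine Finset.prod_congr rfl fun i _ => ?_
    rw [Nat.cast_pow, ENNReal.inv_pow, pow_right_comm]
  · intro i _ j _ _
    exact Or.inr (by simp)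

theorem enorm_monomialEval (y : CSpace n) (α : Fin n →₀ ℕ) :
    ‖monomialEval y α‖ₑ = ∏ i, ‖y i‖ₑ ^ α i := by
  rw [monomialEval, enorm_eq_nnnorm, nnnorm_prod, ENNReal.ofNNReal_finsetProd]
  exact Finset.prod_congr rfl fun i _ => by rw [nnnorm_pow, ENNReal.coe_pow]; rfl

theorem enorm_monomialEval_le {s : ℕ} {y : CSpace n} (hy : y ∈ primePolydisc n s)
    (α : Fin n →₀ ℕ) : ‖monomialEval y α‖ₑ ≤ serWeight s α := by
  rw [serWeight_eq_prod, enorm_monomialEval]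
  exact Finset.prod_le_prod' fun i _ => pow_le_pow_left' (hy i) _

theorem primePolydisc_mem_nhds (s : ℕ) : primePolydisc n s ∈ 𝓝 (0 : CSpace n) := by
  have : ∀ i : Fin n, ∀ᶠ y : CSpace n in 𝓝 0, ‖y i‖ₑ ≤ ((Nat.nth Nat.Prime i : ℝ≥0∞)⁻¹) ^ s := by
    intro i
    have hc : Tendsto (fun y : CSpace n => ‖y i‖ₑ) (𝓝 0) (𝓝 0) := by
      have : Continuous fun y : CSpace n => ‖y i‖ₑ := by fun_prop
      simpa using this.tendsto 0
    exact hc.eventually (eventually_le_nhds (pos_iff_ne_zero.mpr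
      (pow_ne_zero _ (ENNReal.inv_ne_zero.mpr (by simp)))))
  exact eventually_all.mpr this

/-- The sum of a power series at a point. -/
noncomputable def serEval (a : MvPowerSeries (Fin n) ℂ) (y : CSpace n) : ℂ :=
  ∑' α, coeff α a * monomialEval y α

theorem tsum_enorm_serEval_le (s : ℕ) (a : MvPowerSeries (Fin n) ℂ) {y : CSpace n}
    (hy : y ∈ primePolydisc n s) : ∑' α, ‖coeff α a * monomialEval y α‖ₑ ≤ serNorm s a := by
  refine ENNReal.tsum_le_tsum fun α => ?_
  rw [enorm_mul]
  gcongr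
  exact enorm_monomialEval_le hy α

theorem enorm_serEval_le (s : ℕ) (a : MvPowerSeries (Fin n) ℂ) {y : CSpace n}
    (hy : y ∈ primePolydisc n s) : ‖serEval a y‖ₑ ≤ serNorm s a :=
  enorm_tsum_le_tsum_enorm.trans (tsum_enorm_serEval_le s a hy)

theorem summable_norm_serEval {s : ℕ} {a : MvPowerSeries (Fin n) ℂ} (ha : serNorm s a ≠ ⊤)
    {y : CSpace n} (hy : y ∈ primePolydisc n s) :
    Summable fun α => ‖coeff α a * monomialEval y α‖ := by
  refine Summable.of_enorm (ne_top_of_le_ne_top ha ?_)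
  simpa using tsum_enorm_serEval_le s a hy

theorem serEval_monomial (e : Fin n →₀ ℕ) (c : ℂ) (y : CSpace n) :
    serEval (monomial e c) y = c * monomialEval y e := by
  classical
  rw [serEval, tsum_eq_single e fun α hα => by rw [coeff_monomial_ne hα, zero_mul],
    coeff_monomial_same]

theorem serEval_add {s : ℕ} {a b : MvPowerSeries (Fin n) ℂ} (ha : serNorm s a ≠ ⊤)
    (hb : serNorm s b ≠ ⊤) {y : CSpace n} (hy : y ∈ primePolydisc n s) :
    serEval (a + b) y = serEval a y + serEval b y := by
  rw [serEval, serEval, serEval, ← (summable_norm_serEval ha hy).of_norm.tsum_add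
    (summable_norm_serEval hb hy).of_norm]
  simp [add_mul]

theorem coeff_mul_mul_monomialEval (a b : MvPowerSeries (Fin n) ℂ) (y : CSpace n)
    (γ : Fin n →₀ ℕ) : coeff γ (a * b) * monomialEval y γ =
      ∑ p ∈ Finset.HasAntidiagonal.antidiagonal γ,
        coeff p.1 a * monomialEval y p.1 * (coeff p.2 b * monomialEval y p.2) := by
  rw [coeff_mul, Finset.sum_mul]
  refine Finset.sum_congr rfl fun p hp => ?_
  have hpγ : p.1 + p.2 = γ := Finset.HasAntidiagonal.mem_antidiagonal.mp hp
  have hm : monomialEval y γ = monomialEval y p.1 * monomialEval y p.2 := by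
    rw [← hpγ, monomialEval_add]
  rw [hm]
  ring

theorem tsum_mul_tsum_eq_of_summable_norm {A : Type*} [AddCommMonoid A]
    [Finset.HasAntidiagonal A] {f g : A → ℂ} (hf : Summable fun x => ‖f x‖)
    (hg : Summable fun x => ‖g x‖) : (∑' x, f x) * ∑' x, g x =
      ∑' x, ∑ p ∈ Finset.HasAntidiagonal.antidiagonal x, f p.1 * g p.2 :=
  hf.of_norm.tsum_mul_tsum_eq_tsum_sum_antidiagonal hg.of_norm
    (summable_mul_of_summable_norm hf hg)

theorem serEval_mul {s : ℕ} {a b : MvPowerSeries (Fin n) ℂ} (ha : serNorm s a ≠ ⊤)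
    (hb : serNorm s b ≠ ⊤) {y : CSpace n} (hy : y ∈ primePolydisc n s) :
    serEval (a * b) y = serEval a y * serEval b y :=
  (tsum_congr fun γ => coeff_mul_mul_monomialEval a b y γ).trans
    (tsum_mul_tsum_eq_of_summable_norm (summable_norm_serEval ha hy)
      (summable_norm_serEval hb hy)).symm

theorem serEval_at_zero (a : MvPowerSeries (Fin n) ℂ) : serEval a 0 = constantCoeff a := by
  rw [serEval, tsum_eq_single 0, monomialEval_zero, mul_one, coeff_zero_eq_constantCoeff_apply]
  intro α hα
  obtain ⟨i, hi⟩ := Finsupp.ne_iff.mp hα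
  rw [monomialEval, Finset.prod_eq_zero (Finset.mem_univ i), mul_zero]
  simpa using hi

/-- The point with coordinates `p_i ^ (-s)`. -/
noncomputable def primePoint (n s : ℕ) : CSpace n :=
  WithLp.toLp 2 fun i => (((Nat.nth Nat.Prime i : ℂ))⁻¹) ^ s

theorem enorm_primePoint (s : ℕ) (i : Fin n) :
    ‖primePoint n s i‖ₑ = ((Nat.nth Nat.Prime i : ℝ≥0∞)⁻¹) ^ s := by
  have h0 : (Nat.nth Nat.Prime i : ℂ) ≠ 0 := by exact_mod_cast (Nat.prime_nth_prime i).ne_zero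
  rw [primePoint, enorm_pow, enorm_inv h0, ← ofReal_norm (Nat.nth Nat.Prime i : ℂ),
    Complex.norm_natCast, ENNReal.ofReal_natCast]

theorem tendsto_primePoint : Tendsto (primePoint n) atTop (𝓝 0) := by
  have h : Tendsto (fun s => fun i : Fin n => (((Nat.nth Nat.Prime i : ℂ))⁻¹) ^ s) atTop
      (𝓝 (0 : Fin n → ℂ)) := by
    refine tendsto_pi_nhds.mpr fun i => tendsto_pow_atTop_nhds_zero_of_norm_lt_one ?_
    rw [norm_inv, Complex.norm_natCast]
    exact inv_lt_one_of_one_lt₀ (by exact_mod_cast (Nat.prime_nth_prime i).one_lt)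
  exact ((PiLp.continuous_toLp 2 fun _ : Fin n => ℂ).tendsto 0).comp h

/-- A convergent power series is determined by its values near the origin. -/
theorem eq_zero_of_serEval_eventually_eq_zero {a : MvPowerSeries (Fin n) ℂ} (ha : a ∈ ConvSeries n)
    (h : ∀ᶠ y in 𝓝 0, serEval a y = 0) : a = 0 := by
  by_contra h0
  obtain ⟨e, he⟩ := exists_isLeadExp h0
  obtain ⟨s₀, hs₀⟩ := he.exists_serNorm_le ha
  obtain ⟨s₁, hs₁⟩ := ha
  obtain ⟨s, hs, hsz⟩ := ((eventually_ge_atTop (s₀ ⊔ s₁)).and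
    (tendsto_primePoint.eventually h)).exists
  have hy : primePoint n s ∈ primePolydisc n s := fun i => (enorm_primePoint s i).le
  set c := coeff e a
  set w := ‖c‖ₑ * serWeight s e
  have hle := hs₀ s (le_sup_left.trans hs)
  have hw0 : w ≠ 0 := by simp [w, c, he.1, serWeight_ne_zero]
  have hwt : w ≠ ⊤ := ENNReal.mul_ne_top enorm_ne_top (serWeight_ne_top s e)
  have hadd : serEval (monomial e c + (a - monomial e c)) (primePoint n s) =
      serEval (monomial e c) (primePoint n s) + serEval (a - monomial e c) (primePoint n s) := by
    refine serEval_add ?_ (ne_top_of_le_ne_top (ENNReal.mul_ne_top (by simp) hwt) hle) hy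
    rwa [serNorm_monomial]
  rw [add_sub_cancel, hsz] at hadd
  -- At the corner of the polydisc the leading monomial attains its weighted norm, while the rest is
  -- at most half of it, so no cancellation is possible.
  have hnorm : ‖serEval (monomial e c) (primePoint n s)‖ₑ = w := by
    rw [serEval_monomial, enorm_mul, enorm_monomialEval]
    simp only [w, enorm_primePoint, serWeight_eq_prod]
  rw [eq_neg_of_add_eq_zero_left hadd.symm, enorm_neg] at hnorm
  have hlt : w ≤ 2⁻¹ * w := hnorm.symm.le.trans ((enorm_serEval_le s _ hy).trans hle)
  rw [← ENNReal.div_eq_inv_mul] at hlt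
  exact (ENNReal.half_lt_self hw0 hwt).not_ge hlt

end Evaluation

/-! ### Power series and analytic functions, compared through noncommutative words -/

section Words

open scoped ENNReal NNReal
open MvPowerSeries

variable {n : ℕ}

/-- The exponent of the monomial which is the product of the letters of a word. -/
noncomputable def wordContent (w : Σ k, Fin k → Fin n) : Fin n →₀ ℕ :=
  ∑ j, Finsupp.single (w.2 j) 1

theorem sum_wordContent (w : Σ k, Fin k → Fin n) : ∑ i, wordContent w i = w.1 := by
  classical
  simp only [wordContent, Finsupp.finsetSum_apply]
  rw [Finset.sum_comm]
  simp [Finsupp.single_apply]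

theorem wordContent_surjective : Function.Surjective (wordContent (n := n)) := by
  intro α
  induction α using Finsupp.induction_linear with
  | zero => exact ⟨⟨0, Fin.elim0⟩, by simp [wordContent]⟩
  | add α β hα hβ =>
    obtain ⟨⟨k, v⟩, rfl⟩ := hα
    obtain ⟨⟨l, w⟩, rfl⟩ := hβ
    exact ⟨⟨k + l, Fin.append v w⟩, by simp [wordContent, Fin.sum_univ_add]⟩
  | single i m => exact ⟨⟨m, fun _ => i⟩, by simp [wordContent]⟩

theorem monomialEval_wordContent (y : CSpace n) (w : Σ k, Fin k → Fin n) :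
    monomialEval y (wordContent w) = ∏ j, y (w.2 j) := by
  simp [wordContent, monomialEval_sum, monomialEval_single]

/-- The formal multilinear series with given coefficients in noncommuting coordinates. -/
noncomputable def wordSeries (c : (Σ k, Fin k → Fin n) → ℂ) :
    FormalMultilinearSeries ℂ (CSpace n) ℂ := fun k =>
  ∑ w : Fin k → Fin n, c ⟨k, w⟩ •
    (ContinuousMultilinearMap.mkPiAlgebraFin ℂ k ℂ).compContinuousLinearMap
    fun j => (EuclideanSpace.proj (w j) : CSpace n →L[ℂ] ℂ)

theorem wordSeries_apply (c : (Σ k, Fin k → Fin n) → ℂ) (k : ℕ) (y : CSpace n) :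
    wordSeries c k (fun _ => y) = ∑ w, c ⟨k, w⟩ * monomialEval y (wordContent ⟨k, w⟩) := by
  simp [wordSeries, monomialEval_wordContent, List.prod_ofFn]

theorem norm_proj_le (i : Fin n) : ‖(EuclideanSpace.proj i : CSpace n →L[ℂ] ℂ)‖ ≤ 1 :=
  ContinuousLinearMap.opNorm_le_bound _ zero_le_one fun y => by
    simpa using PiLp.norm_apply_le y i

theorem norm_wordSeries_le (c : (Σ k, Fin k → Fin n) → ℂ) (k : ℕ) :
    ‖wordSeries c k‖ ≤ ∑ w, ‖c ⟨k, w⟩‖ := by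
  refine (norm_sum_le _ _).trans (Finset.sum_le_sum fun w _ => ?_)
  rw [norm_smul]
  refine mul_le_of_le_one_right (norm_nonneg _) ?_
  refine (ContinuousMultilinearMap.norm_compContinuousLinearMap_le _ _).trans ?_
  rw [ContinuousMultilinearMap.norm_mkPiAlgebraFin, one_mul]
  exact Finset.prod_le_one (fun _ _ => norm_nonneg _) fun j _ => norm_proj_le (w j)

theorem analyticAt_tsum_word (c : (Σ k, Fin k → Fin n) → ℂ) {r : ℝ≥0} (hr : 0 < r)
    (hc : Summable fun w => ‖c w‖ * (r : ℝ) ^ w.1) :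
    AnalyticAt ℂ (fun y => ∑' w, c w * monomialEval y (wordContent w)) 0 := by
  have hs : HasFPowerSeriesOnBall (fun y => ∑' w, c w * monomialEval y (wordContent w))
      (wordSeries c) 0 r := by
    refine ⟨?_, by exact_mod_cast hr, fun {y} hy => ?_⟩
    · refine FormalMultilinearSeries.le_radius_of_summable_norm _ ?_
      refine Summable.of_nonneg_of_le (fun k => by positivity) (fun k => ?_) hc.sigma
      rw [tsum_fintype]
      refine (mul_le_mul_of_nonneg_right (norm_wordSeries_le c k) (by positivity)).trans_eq ?_
      exact Finset.sum_mul _ _ _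
    · have hyr : ‖y‖ ≤ r := by
        rw [mem_eball_zero_iff, enorm_eq_nnnorm, ENNReal.coe_lt_coe] at hy
        exact_mod_cast hy.le
      have hsum : Summable fun w : Σ k, Fin k → Fin n =>
          c w * monomialEval y (wordContent w) := by
        refine Summable.of_norm_bounded hc fun w => ?_
        rw [norm_mul, monomialEval_wordContent, norm_prod]
        gcongr
        refine (Finset.prod_le_prod (fun _ _ => norm_nonneg _) fun j _ =>
          (PiLp.norm_apply_le y (w.2 j)).trans hyr).trans_eq (by simp)
      rw [zero_add]
      have := hsum.hasSum.sigma fun k => hasSum_fintype _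
      simpa only [wordSeries_apply] using this
  exact hs.analyticAt

/-- One word is chosen for each exponent, which turns the power series into a formal multilinear
series with the same sum. -/
theorem analyticAt_serEval {a : MvPowerSeries (Fin n) ℂ} (ha : a ∈ ConvSeries n) :
    AnalyticAt ℂ (serEval a) 0 := by
  classical
  obtain ⟨s, hs⟩ := ha
  obtain ⟨σ, hσ⟩ := (wordContent_surjective (n := n)).hasRightInverse
  have hσi : Function.Injective σ := hσ.injective
  set c : (Σ k, Fin k → Fin n) → ℂ := Function.extend σ (fun α => coeff α a) 0 with hc
  have hcσ : ∀ α, c (σ α) = coeff α a := fun α => hσi.extend_apply _ _ α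
  have hc0 : ∀ w, w ∉ Set.range σ → c w = 0 := fun w hw =>
    Function.extend_apply' _ _ _ fun h => hw h
  have heq : serEval a = fun y => ∑' w, c w * monomialEval y (wordContent w) := by
    ext y
    rw [← hσi.tsum_eq, serEval]
    · exact tsum_congr fun α => by rw [hcσ, hσ α]
    · intro w hw
      by_contra h
      exact hw (by simp [hc0 w h])
  rw [heq]
  -- Primes are numbered from 0, so the n-th exceeds those used for the coordinates i < n, and this
  -- single radius is below all p_i^(-s).
  set r : ℝ≥0 := ((Nat.nth Nat.Prime n : ℝ≥0)⁻¹) ^ s with hr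
  have hpn : (Nat.nth Nat.Prime n : ℝ≥0) ≠ 0 := by
    exact_mod_cast (Nat.prime_nth_prime n).ne_zero
  refine analyticAt_tsum_word c (r := r) (by positivity) ?_
  rw [← hσi.summable_iff]
  · refine Summable.of_enorm (ne_top_of_le_ne_top hs (ENNReal.tsum_le_tsum fun α => ?_))
    have hdeg : (σ α).1 = ∑ i, α i := by rw [← sum_wordContent, hσ α]
    rw [Function.comp_apply, hcσ, enorm_mul, enorm_norm, hdeg]
    gcongr
    rw [serWeight_eq_prod, ← Finset.prod_pow_eq_pow_sum, enorm_eq_nnnorm, nnnorm_prod,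
      ENNReal.ofNNReal_finsetProd]
    refine Finset.prod_le_prod' fun i _ => ?_
    rw [nnnorm_pow, ENNReal.coe_pow]
    refine pow_le_pow_left' ?_ _
    have : ‖(r : ℝ)‖₊ = r := by simp
    rw [this, hr, ENNReal.coe_pow, ENNReal.coe_inv hpn]
    refine pow_le_pow_left' (ENNReal.inv_le_inv.mpr ?_) _
    exact_mod_cast (Nat.nth_strictMono Nat.infinite_setOfPred_prime).monotone i.2.le
  · intro w hw
    simp [hc0 w hw]

theorem multilinear_apply_eq_sum (k : ℕ) (p : CSpace n [×k]→L[ℂ] ℂ) (y : CSpace n) :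
    p (fun _ => y) = ∑ w : Fin k → Fin n,
      p (fun j => EuclideanSpace.single (w j) 1) * monomialEval y (wordContent ⟨k, w⟩) := by
  classical
  have hy : y = ∑ i, y i • EuclideanSpace.single i (1 : ℂ) := by
    ext j
    simp [Finset.sum_apply, Pi.single_apply]
  conv_lhs => rw [hy]
  rw [ContinuousMultilinearMap.map_sum]
  refine Finset.sum_congr rfl fun w _ => ?_
  rw [ContinuousMultilinearMap.map_smul_univ, monomialEval_wordContent, smul_eq_mul, mul_comm]

/-- Analytic functions are sums of convergent power series. -/
theorem exists_serEval_eventuallyEq {f : CSpace n → ℂ} (hf : AnalyticAt ℂ f 0) :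
    ∃ a ∈ ConvSeries n, ∀ᶠ y in 𝓝 0, f y = serEval a y := by
  classical
  obtain ⟨p, R, hp⟩ := hf
  set c : (Σ k, Fin k → Fin n) → ℂ := fun w => p w.1 fun j => EuclideanSpace.single (w.2 j) 1
    with hcdef
  have hc : ∀ w, ‖c w‖ ≤ ‖p w.1‖ := fun w => by
    simpa using (p w.1).le_opNorm fun j => EuclideanSpace.single (w.2 j) (1 : ℂ)
  -- There are n^k words of length k, each of weight at most 2^(-s k) because all primes are at
  -- least 2.
  obtain ⟨s, hs⟩ : ∃ s : ℕ, (n : ℝ≥0∞) * (2⁻¹ : ℝ≥0∞) ^ s < p.radius := by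
    have hlim : Tendsto (fun s : ℕ => (n : ℝ≥0∞) * (2⁻¹ : ℝ≥0∞) ^ s) atTop (𝓝 0) := by
      have := ENNReal.Tendsto.const_mul (a := (n : ℝ≥0∞))
        (ENNReal.tendsto_pow_atTop_nhds_zero_of_lt_one (r := 2⁻¹) (by simp)) (Or.inr (by simp))
      simpa using this
    exact (hlim.eventually (eventually_lt_nhds hp.radius_pos)).exists
  have hW : ∑' w, ‖c w‖ₑ * serWeight s (wordContent w) ≠ ⊤ := by
    set r : ℝ≥0 := n * 2⁻¹ ^ s with hr
    have hrr : (r : ℝ≥0∞) = n * (2⁻¹ : ℝ≥0∞) ^ s := by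
      rw [hr, ENNReal.coe_mul, ENNReal.coe_pow, ENNReal.coe_inv two_ne_zero]
      rfl
    have hfin : ∑' k, ‖‖p k‖ * (r : ℝ) ^ k‖ₑ ≠ ⊤ := by
      have hsum : Summable fun k => ‖p k‖ * (r : ℝ) ^ k := p.summable_norm_mul_pow (hrr ▸ hs)
      exact ENNReal.tsum_coe_ne_top_iff_summable.mpr (NNReal.summable_coe.mp (by simpa using! hsum))
    rw [ENNReal.tsum_sigma']
    refine ne_top_of_le_ne_top hfin (ENNReal.tsum_le_tsum fun k => ?_)
    have h1 : ∀ w : Fin k → Fin n, ‖c ⟨k, w⟩‖ₑ * serWeight s (wordContent ⟨k, w⟩) ≤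
        ‖p k‖ₑ * (2⁻¹ ^ s) ^ k := by
      intro w
      refine mul_le_mul' (enorm_le_iff_norm_le.mpr (hc ⟨k, w⟩)) ?_
      rw [serWeight, pow_right_comm, ← ENNReal.inv_pow (a := 2)]
      refine pow_le_pow_left' (ENNReal.inv_le_inv.mpr ?_) _
      have := two_pow_degree_le_primeWeight (wordContent ⟨k, w⟩)
      rw [sum_wordContent] at this
      exact_mod_cast this
    refine (ENNReal.tsum_le_tsum h1).trans (le_of_eq ?_)
    rw [tsum_fintype, Finset.sum_const, Finset.card_univ, Fintype.card_fun, Fintype.card_fin,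
      Fintype.card_fin, nsmul_eq_mul, enorm_mul, enorm_norm, enorm_pow]
    have : ‖(r : ℝ)‖ₑ = (n : ℝ≥0∞) * (2⁻¹ : ℝ≥0∞) ^ s := by
      rw [← hrr, enorm_eq_nnnorm]; simp
    rw [this]
    push_cast
    ring
  -- All words with the same commutative monomial are collected.
  let a : MvPowerSeries (Fin n) ℂ := fun α => ∑' w : wordContent ⁻¹' {α}, c w
  have hco : ∀ α, coeff α a = ∑' w : wordContent ⁻¹' {α}, c w := fun _ => rfl
  refine ⟨a, ⟨s, ?_⟩, ?_⟩
  · rw [← ENNReal.tsum_fiberwise _ wordContent] at hW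
    refine ne_top_of_le_ne_top hW (ENNReal.tsum_le_tsum fun α => ?_)
    calc ‖coeff α a‖ₑ * serWeight s α
        ≤ (∑' w : wordContent ⁻¹' {α}, ‖c w‖ₑ) * serWeight s α := by
          rw [hco]
          gcongr
          exact enorm_tsum_le_tsum_enorm
      _ = ∑' w : wordContent ⁻¹' {α}, ‖c w‖ₑ * serWeight s (wordContent w.1) := by
          rw [← ENNReal.tsum_mul_right]
          exact tsum_congr fun w => by rw [show wordContent w.1 = α from w.2]
  · filter_upwards [primePolydisc_mem_nhds s, Metric.eball_mem_nhds 0 hp.r_pos] with y hy hyR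
    have hsum : Summable fun w => c w * monomialEval y (wordContent w) := by
      refine Summable.of_enorm (ne_top_of_le_ne_top hW (ENNReal.tsum_le_tsum fun w => ?_))
      rw [enorm_mul]
      gcongr
      exact enorm_monomialEval_le hy _
    have h1 : HasSum (fun k => p k fun _ => y) (∑' w, c w * monomialEval y (wordContent w)) := by
      have := hsum.hasSum.sigma fun k => hasSum_fintype _
      simp only [multilinear_apply_eq_sum]
      exact this
    have h2 : HasSum (fun k => p k fun _ => y) (f y) := by
      simpa using hp.hasSum hyR
    rw [h2.unique h1, ← (hsum.hasSum.tsum_fiberwise wordContent).tsum_eq, serEval]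
    refine tsum_congr fun α => ?_
    rw [hco, ← tsum_mul_right]
    exact tsum_congr fun w => by rw [show wordContent w.1 = α from w.2]

end Words

/-! ### The local ring of a complex manifold -/

section HolomorphicGerms

open IsLocalRing

variable {n : ℕ} {V : Type*} [TopologicalSpace V] [ChartedSpace (CSpace n) V]

theorem exists_germ_eq {x : V} (f : HolGerm n x) :
    ∃ (g : V → ℂ) (hg : HolAt n g x), hg.germ = f := by
  obtain ⟨_, g, hg, rfl⟩ := f
  exact ⟨g, hg, rfl⟩

theorem eval_germ {g : V → ℂ} {x : V} (hg : HolAt n g x) : HolGerm.eval x hg.germ = g x := rfl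

theorem eval_algebraMap (x : V) (c : ℂ) : HolGerm.eval x (algebraMap ℂ (HolGerm n x) c) = c := rfl

theorem mem_maximalIdeal_iff_eval {x : V} {f : HolGerm n x} :
    f ∈ maximalIdeal (HolGerm n x) ↔ HolGerm.eval x f = 0 := by
  rw [mem_maximalIdeal, mem_nonunits_iff]
  constructor
  · intro hf
    by_contra h0
    obtain ⟨g, hg, rfl⟩ := exists_germ_eq f
    rw [eval_germ] at h0
    refine hf (IsUnit.of_mul_eq_one (HolAt.germ (hg.inv₀ h0)) (Subtype.ext (Germ.coe_eq.2 ?_)))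
    filter_upwards [hg.continuousAt.eventually_ne h0] with y hy
    exact mul_inv_cancel₀ hy
  · intro h0 hf
    exact (hf.map (HolGerm.eval x)).ne_zero h0

theorem isRadical_idealAt (D : Set V) (x : V) : (idealAt n D x).IsRadical := by
  rintro f ⟨m, g', hg', hgf, h⟩
  obtain ⟨g, hg, rfl⟩ := exists_germ_eq f
  refine ⟨g, hg, rfl, ?_⟩
  have heq : ∀ᶠ y in 𝓝 x, g' y = g y ^ m := Germ.coe_eq.1 (congrArg Subtype.val hgf)
  filter_upwards [h, heq] with y hy hym hD
  exact eq_zero_of_pow_eq_zero (hym.symm.trans (hy hD))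

theorem HolAt.analyticAt_comp_chart_symm {g : V → ℂ} {x : V} (hg : HolAt n g x) :
    AnalyticAt ℂ (fun z => g ((chartAt (CSpace n) x).symm (z + chartAt (CSpace n) x x))) 0 := by
  have h := (contMDiffAt_iff.mp hg).2
  simp only [mfld_simps] at h
  rw [contDiffWithinAt_univ] at h
  have h1 : AnalyticAt ℂ (g ∘ (chartAt (CSpace n) x).symm) (0 + chartAt (CSpace n) x x) := by
    rw [zero_add]
    exact h.analyticAt
  exact AnalyticAt.fun_comp (g := g ∘ (chartAt (CSpace n) x).symm)
    (f := fun z => z + chartAt (CSpace n) x x) h1 (by fun_prop)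

variable (n) in
/-- Coordinates centered at `x`. -/
noncomputable def centeredChart (x : V) (y : V) : CSpace n :=
  chartAt (CSpace n) x y - chartAt (CSpace n) x x

theorem map_centeredChart_nhds (x : V) : map (centeredChart n x) (𝓝 x) = 𝓝 0 := by
  have h1 : centeredChart n x = (Homeomorph.subRight (chartAt (CSpace n) x x)) ∘
      chartAt (CSpace n) x := rfl
  rw [h1, ← map_map, (chartAt (CSpace n) x).map_nhds_eq (mem_chart_source _ x),
    Homeomorph.map_nhds_eq]
  simp

theorem holAt_comp_centeredChart [IsManifold 𝓘(ℂ, CSpace n) ω V] {f : CSpace n → ℂ}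
    (hf : AnalyticAt ℂ f 0) (x : V) : HolAt n (fun y => f (centeredChart n x y)) x := by
  have h1 : ContMDiffAt 𝓘(ℂ, CSpace n) 𝓘(ℂ, CSpace n) ω (chartAt (CSpace n) x) x :=
    contMDiffAt_of_mem_maximalAtlas (IsManifold.chart_mem_maximalAtlas x) (mem_chart_source _ x)
  have h2 : ContDiffAt ℂ ω (fun z => f (z - chartAt (CSpace n) x x)) (chartAt (CSpace n) x x) := by
    refine AnalyticAt.contDiffAt (AnalyticAt.fun_comp (g := f)
      (f := fun z => z - chartAt (CSpace n) x x) ?_ (by fun_prop))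
    rwa [sub_self]
  exact ContMDiffAt.comp (g := fun z => f (z - chartAt (CSpace n) x x)) x h2.contMDiffAt h1

variable [IsManifold 𝓘(ℂ, CSpace n) ω V]

/-- The germ of a holomorphic function with a given power series. -/
noncomputable def convSeriesGerm (x : V) : ConvSeries n →ₐ[ℂ] HolGerm n x where
  toFun a := (holAt_comp_centeredChart (analyticAt_serEval a.2) x).germ
  map_one' := by
    refine Subtype.ext (Germ.coe_eq.2 (Eventually.of_forall fun y => ?_))
    exact (serEval_monomial 0 1 _).trans (by rw [monomialEval_zero, one_mul])
  map_zero' := by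
    refine Subtype.ext (Germ.coe_eq.2 (Eventually.of_forall fun y => ?_))
    simp [serEval]
  commutes' c := by
    refine Subtype.ext (Germ.coe_eq.2 (Eventually.of_forall fun y => ?_))
    exact (serEval_monomial 0 c _).trans (by rw [monomialEval_zero, mul_one])
  map_mul' := by
    rintro ⟨a, s, hs⟩ ⟨b, t, ht⟩
    refine Subtype.ext (Germ.coe_eq.2 ?_)
    have h := (map_centeredChart_nhds (n := n) x).le (primePolydisc_mem_nhds (s ⊔ t))
    filter_upwards [h] with y hy
    exact serEval_mul (ne_top_of_le_ne_top hs (serNorm_antitone a le_sup_left))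
      (ne_top_of_le_ne_top ht (serNorm_antitone b le_sup_right)) hy
  map_add' := by
    rintro ⟨a, s, hs⟩ ⟨b, t, ht⟩
    refine Subtype.ext (Germ.coe_eq.2 ?_)
    have h := (map_centeredChart_nhds (n := n) x).le (primePolydisc_mem_nhds (s ⊔ t))
    filter_upwards [h] with y hy
    exact serEval_add (ne_top_of_le_ne_top hs (serNorm_antitone a le_sup_left))
      (ne_top_of_le_ne_top ht (serNorm_antitone b le_sup_right)) hy

theorem eval_convSeriesGerm (x : V) (a : ConvSeries n) : HolGerm.eval x (convSeriesGerm x a) =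
    MvPowerSeries.constantCoeff (a : MvPowerSeries (Fin n) ℂ) := by
  have h : HolGerm.eval x (convSeriesGerm x a) = serEval a (centeredChart n x x) := rfl
  rw [h, centeredChart, sub_self, serEval_at_zero]

theorem convSeriesGerm_bijective (x : V) : Function.Bijective (convSeriesGerm (n := n) x) := by
  constructor
  · rw [injective_iff_map_eq_zero]
    intro a ha
    have h : ∀ᶠ y in 𝓝 x, serEval a.1 (centeredChart n x y) = 0 :=
      Germ.coe_eq.1 (congrArg Subtype.val ha)
    refine Subtype.ext (eq_zero_of_serEval_eventually_eq_zero a.2 ?_)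
    rw [← map_centeredChart_nhds (n := n) x]
    exact h
  · intro f
    obtain ⟨g, hg, rfl⟩ := exists_germ_eq f
    obtain ⟨a, ha, hga⟩ := exists_serEval_eventuallyEq hg.analyticAt_comp_chart_symm
    refine ⟨⟨a, ha⟩, Subtype.ext (Germ.coe_eq.2 ?_)⟩
    rw [← map_centeredChart_nhds (n := n) x] at hga
    filter_upwards [hga, (chartAt (CSpace n) x).eventually_left_inverse (mem_chart_source _ x)]
      with y hy hxy
    rw [← hy, centeredChart, sub_add_cancel, hxy]

/-- The local ring of an `n`-dimensional complex manifold at a point is the ring of convergent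
power series in `n` variables. -/
noncomputable def convSeriesEquiv (x : V) : ConvSeries n ≃ₐ[ℂ] HolGerm n x :=
  AlgEquiv.ofBijective (convSeriesGerm x) (convSeriesGerm_bijective x)

theorem eval_convSeriesEquiv (x : V) (a : ConvSeries n) : HolGerm.eval x (convSeriesEquiv x a) =
    MvPowerSeries.constantCoeff (a : MvPowerSeries (Fin n) ℂ) := eval_convSeriesGerm x a

theorem isNoetherianRing_holGerm (x : V) : IsNoetherianRing (HolGerm n x) :=
  isNoetherianRing_of_ringEquiv (ConvSeries n) (convSeriesEquiv x).toRingEquiv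

theorem isDomain_holGerm (x : V) : IsDomain (HolGerm n x) :=
  have : IsDomain (MvPowerSeries (Fin n) ℂ) := NoZeroDivisors.to_isDomain _
  (convSeriesEquiv (n := n) x).symm.toMulEquiv.isDomain (ConvSeries n)

/-- Transport of derivations along an isomorphism of algebras. -/
def AlgEquiv.conjDerivation {k A B : Type*} [CommRing k] [CommRing A] [CommRing B] [Algebra k A]
    [Algebra k B] (e : A ≃ₐ[k] B) (D : Derivation k A A) : Derivation k B B :=
  Derivation.mk' (e.toLinearMap ∘ₗ D.toLinearMap ∘ₗ e.symm.toLinearMap) fun a b => by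
    simp

theorem AlgEquiv.conjDerivation_apply {k A B : Type*} [CommRing k] [CommRing A] [CommRing B]
    [Algebra k A] [Algebra k B] (e : A ≃ₐ[k] B) (D : Derivation k A A) (a : A) :
    e.conjDerivation D (e a) = e (D a) := by
  change e (D (e.symm (e a))) = e (D a)
  rw [AlgEquiv.symm_apply_apply]

/-- Local coordinates of a complex manifold. -/
noncomputable def regularCoords (x : V) : RegularCoords n (HolGerm n x) where
  x i := convSeriesEquiv x (convX n i)
  pd i := (convSeriesEquiv x).conjDerivation (convPderiv i)
  pd_x i j := by
    rw [AlgEquiv.conjDerivation_apply, convPderiv_convX]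
    split_ifs <;> simp
  span_x := by
    refine le_antisymm (Ideal.span_le.mpr ?_) fun f hf => ?_
    · rintro _ ⟨i, rfl⟩
      rw [SetLike.mem_coe, mem_maximalIdeal_iff_eval, eval_convSeriesEquiv]
      exact MvPowerSeries.constantCoeff_X i
    · obtain ⟨a, rfl⟩ := (convSeriesEquiv x).surjective f
      rw [mem_maximalIdeal_iff_eval, eval_convSeriesEquiv] at hf
      have := Ideal.mem_map_of_mem (convSeriesEquiv x) (mem_span_convX hf)
      rw [Ideal.map_span, ← Set.range_comp] at this
      exact this
  residue f := by
    refine ⟨HolGerm.eval x f, ?_⟩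
    rw [mem_maximalIdeal_iff_eval, map_sub, eval_algebraMap, sub_self]

end HolomorphicGerms

/-! ### The theorem for free divisors on manifolds -/

theorem proposition3p5 (p : ℕ) {V : Type*} [TopologicalSpace V] [ChartedSpace (CSpace (p + 1)) V]
    [IsManifold 𝓘(ℂ, CSpace (p + 1)) ω V] (D : Set V) (hD : IsFreeDivisor (p + 1) D)
    (x : V) (hx : IsSingularAt (p + 1) D x) (k : ℕ) (hk : 1 ≤ k) (hkp : k ≤ p) :
    moduleDepth (HolGerm (p + 1) x) (KahlerForms (idealAt (p + 1) D x) k) = ((p - 1 : ℕ) : ℕ∞) ∧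
    ¬ IsCohenMacaulayModule (HolGerm (p + 1) x) (KahlerForms (idealAt (p + 1) D x) k) ∧
    ∀ h : HolGerm (p + 1) x, IsReducedEquation D x h →
      IsCohenMacaulayModule (HolGerm (p + 1) x) (CheckForms h k) := by
  have := isNoetherianRing_holGerm (n := p + 1) x
  have := isDomain_holGerm (n := p + 1) x
  have S := regularCoords (n := p + 1) x
  obtain ⟨j, rfl⟩ : ∃ j, k = j + 1 := ⟨k - 1, by omega⟩
  have key : ∀ h : HolGerm (p + 1) x, IsReducedEquation D x h →
      h ∈ IsLocalRing.maximalIdeal (HolGerm (p + 1) x) ∧ (Ideal.span {h}).IsRadical ∧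
      (∀ X : VField (HolGerm (p + 1) x), X h ∈ IsLocalRing.maximalIdeal (HolGerm (p + 1) x)) ∧
      Nonempty (LogFrame S h) := by
    intro h hh
    have hrad : (Ideal.span {h}).IsRadical := hh.ideal_eq ▸ isRadical_idealAt D x
    refine ⟨?_, hrad, fun X => ?_, ?_⟩
    · obtain ⟨g, hg, rfl, hgD⟩ := hh.zeroSet
      rw [mem_maximalIdeal_iff_eval, eval_germ]
      exact hgD.self_of_nhds.mp hx.1
    · rw [mem_maximalIdeal_iff_eval]
      exact hx.2 h (hh.ideal_eq ▸ Ideal.mem_span_singleton_self h) X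
    · refine S.exists_logFrame hh.ne_zero hrad ?_
      rw [← hh.ideal_eq]
      exact hD.2 x
  obtain ⟨h, hh⟩ := hD.1 x
  obtain ⟨hm, hrad, hsing, ⟨F⟩⟩ := key h hh
  have hdepth := moduleDepth_kahlerForms S hh.ne_zero hm hrad hsing F (j := j) (by omega)
  obtain ⟨hnt, hdim⟩ := supportDim_kahlerForms_ge S hh.ne_zero hm hrad F (j := j) (by omega)
  rw [hh.ideal_eq]
  refine ⟨hdepth, ?_, fun h' hh' => ?_⟩
  · rintro (hs | hs)
    · exact not_subsingleton _ hs
    · rw [← hs, hdepth] at hdim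
      -- Depth equal to dimension would give p ≤ p - 1, which is absurd also for truncated
      -- subtraction because p ≥ 1.
      have : ((p + 1 - 1 : ℕ) : ℕ∞) ≤ ((p + 1 - 2 : ℕ) : ℕ∞) := WithBot.coe_le_coe.mp hdim
      rw [Nat.cast_le] at this
      omega
  · obtain ⟨hm', hrad', -, ⟨F'⟩⟩ := key h' hh'
    exact (isCohenMacaulay_checkForms S hh'.ne_zero hm' hrad' F' (by omega)).2
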